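/- **Setting.** $\mathbb H^2$ carries the global coordinates $(x_1,x_2)\in\mathbb R^2$ with $\Psi(x_1,x_2)=(\cosh x_2+\tfrac12e^{-x_2}x_1^2,\ \sinh x_2+\tfrac12e^{-x_2}x_1^2,\ e^{-x_2}x_1)$ on the hyperboloid, metric $h=e^{-2x_2}dx_1^2+dx_2^2$, Christoffel symbols $\Gamma^k_{ij}$, volume $e^{-x_2}dx_1dx_2$, and $\Delta f=h^{ii}(\partial_i^2f-\Gamma^k_{ii}\partial_kf)$ (sums over repeated indices, $i,k\in\{1,2\}$). Let $r$ be the distance to the point with coordinates $(0,0)$ and $\Theta_1(y)=e^{y_2}\partial_{y_1}$, $\Theta_2(y)=\partial_{y_2}$. For a map $u$ into $\mathbb H^2$ with an orthonormal frame $e_1,e_2$ along it, put $\phi_\alpha=(\langle\partial_\alpha u,e_1\rangle,\langle\partial_\alpha u,e_2\rangle)$, $[A_\alpha]^k_j=\langle\nabla_\alpha e_j,e_k\rangle$, $D_\alpha=\partial_\alpha+A_\alpha$; also $(a\wedge b)c=\langle a,c\rangle b-\langle b,c\rangle a$, with the Hermitian product (linear in the first slot) on $\mathbb C^2$, and $\mathbf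 R$ is the curvature tensor of the target, $\mathbf R(X,Y)Z=\nabla_X\nabla_YZ-\nabla_Y\nabla_XZ-\nabla_{[X,Y]}Z$, expressed in the frame. A smooth harmonic map $Q:\mathbb H^2\to\mathbb H^2$ is *admissible* (with constants $R_0$ and $\varrho>0$) if its image lies in the geodesic ball of radius $R_0$ about $(0,0)$, $\nabla^kdQ\in L^2$ for $k=0,1,2$, and $e^{\varrho r}|dQ|\in L^\infty$. Let $A_i^\infty,\phi_i^\infty$ be the connection coefficients and differential fields of $Q$ in the frame $\Theta(Q)$, and $$W\varphi=-2h^{ii}A_i^\infty\partial_i\varphi-h^{ii}A_i^\infty A_i^\infty\varphi-h^{ii}(\varphi\wedge\phi_i^\infty)\phi_i^\infty-h^{ii}(\partial_iA_i^\infty-\Gamma^k_{ii}A_k^\infty)\varphi .$$ Let $u(t,x)$, $0<t<T$, be a map into $\mathbb H^2$ (for instance a wave map). A *caloric gauge* over $u$ with limit frame $\Theta(Q)$ is a map $\widetilde u(s,t,x)$ of class $C^3$ and an orthonormal frame $\Omega(s,t,x)$ along it of class $C^2$, for $s>0$, $0<t<T$, with $\partial_s\widetilde u=\tau(\widetilde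 u)$ (the tension field in $x$), $\widetilde u\to u$ as $s\to0^+$, $\nabla_s\Omega_j=0$ and, as $s\to\infty$, $\widetilde u\to Q$ and $\langle\Omega_i,\Theta_j(\widetilde u)\rangle\to\langle\Theta_i(Q),\Theta_j(Q)\rangle$. Let $\phi_s,\phi_t,\phi_i,A_t,A_i$ be its fields, $\mathfrak W=D_t\phi_t-h^{ii}D_i\phi_i+h^{ii}\Gamma^k_{ii}\phi_k$, and write $A_i=A_i^\infty+A_i^{con}$, $\phi_i=\phi_i^\infty+\phi_i^{con}$. **Lemma.** There are constants $\mu_0,\delta>0$ such that for every admissible harmonic map $Q$ the following hold. 1. In every caloric gauge with limit frame $\Theta(Q)$, for $s>0$, $0<t<T$, $x\in\mathbb H^2$, $$\begin{aligned}(\partial_t^2-\Delta+W)\phi_s={}&-2A_t\partial_t\phi_s-A_tA_t\phi_s-(\partial_tA_t)\phi_s+\partial_s\mathfrak W+\mathbf R(\partial_t\widetilde u,\partial_s\widetilde u)\partial_t\widetilde u+2h^{ii}A_i^{con}\partial_i\phi_s\\&+h^{ii}A_i^{con}A_i^\infty\phi_s+h^{ii}A_i^\infty A_i^{con}\phi_s+h^{ii}A_i^{con}A_i^{con}\phi_s+h^{ii}(\partial_iA_i^{con}-\Gamma_{ii}^kA_k^{con})\phi_s\\&+h^{ii}(\phi_s\wedge\phi_i^\infty)\phi_i^{con}+h^{ii}(\phi_s\wedge\phi_i^{con})\phi_i^\infty+h^{ii}(\phi_s\wedge\phi_i^{con})\phi_i^{con}.\end{aligned}$$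 Moreover, for any $s>0$ and $0<t<T$ for which the entries of $\phi_s\wedge\phi_i$ and $\partial_s\phi_i$ ($i=1,2$) at time $t$ are, locally uniformly in $x$, dominated on $(s,\infty)$ by an integrable function of the heat time, $$A_i^{con}(s,t,x)=-\int_s^\infty\phi_s\wedge\phi_i\,d\kappa,\qquad \phi_i^{con}(s,t,x)=-\int_s^\infty\partial_s\phi_i\,d\kappa\qquad(x\in\mathbb H^2).$$ 2. The operator $-\Delta+W$ on $C_c^\infty(\mathbb H^2;\mathbb C^2)$ has a closure $H$ in $L^2(\mathbb H^2;\mathbb C^2)$, and $H$ is self-adjoint with domain $\{f\in L^2:\Delta f\in L^2\text{ in the sense of distributions}\}$. 3. If moreover, for some $0<\mu_1\le\mu_0$, $\|dQ\|_{L^2}<\mu_1$, $\|e^{\varrho r}|dQ|\|_{L^\infty}<\mu_1$ and $\|\nabla^2dQ\|_{L^\infty}+\|\nabla dQ\|_{L^\infty}<\mu_1$, then $H$ is strictly positive: $\langle Hf,f\rangle\ge\delta\|f\|_{L^2}^2$ for all $f$ in its domain. -/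

import Mathlib

open Set Filter Topology MeasureTheory
open scoped Matrix ContDiff ENNReal InnerProductSpace

noncomputable section

namespace MagneticHyp

/-! ### The hyperbolic plane in its global (Iwasawa) coordinates -/

/-- A point of `ℍ²` in the global coordinates `(x₁, x₂) = (x 0, x 1)`. Coordinate components of
tangent vectors, and components with respect to an orthonormal frame, have the same type. -/
abbrev Pt := Fin 2 → ℝ

/-- The coordinate diffeomorphism `Ψ` onto the hyperboloid `[X, X] = 1`, `X⁰ > 0`. -/
def hyperboloid (x : Pt) : Fin 3 → ℝ :=
  ![Real.cosh (x 1) + Real.exp (-x 1) * x 0 ^ 2 / 2,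
    Real.sinh (x 1) + Real.exp (-x 1) * x 0 ^ 2 / 2,
    Real.exp (-x 1) * x 0]

/-- The Lorentzian form `[X, Y] = X⁰Y⁰ - X¹Y¹ - X²Y²`. -/
def lorentz (X Y : Fin 3 → ℝ) : ℝ := X 0 * Y 0 - X 1 * Y 1 - X 2 * Y 2

/-- Hyperbolic distance, `cosh d(x, y) = [Ψ x, Ψ y]`. -/
def hypDist (x y : Pt) : ℝ := Real.arcosh (lorentz (hyperboloid x) (hyperboloid y))

/-- Distance to the origin: the coordinates `(0, 0)` are the point `(1, 0, 0)` of the hyperboloid,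
that is, the centre of the Poincaré disk. -/
def rad (x : Pt) : ℝ := hypDist x 0

/-- The diagonal entries `h_ii` of the metric `e^{-2 x₂} dx₁² + dx₂²`
(its off-diagonal entries vanish). -/
def metric (x : Pt) : Fin 2 → ℝ := ![Real.exp (-2 * x 1), 1]

/-- The diagonal entries `h^{ii}` of the inverse metric. -/
def metricInv (x : Pt) : Fin 2 → ℝ := ![Real.exp (2 * x 1), 1]

/-- The Riemannian inner product of two tangent vectors at `y`. -/
def metricInner (y : Pt) (v w : Pt) : ℝ := ∑ k, metric y k * v k * w k

/-- The Christoffel symbols `Γ^k_{ij}`: `Γ¹₁₂ = Γ¹₂₁ = -1`, `Γ²₁₁ = e^{-2 x₂}`, all others vanish. -/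
def christoffel (x : Pt) (k i j : Fin 2) : ℝ :=
  if k = 0 then (if i = j then 0 else -1)
  else (if i = 0 ∧ j = 0 then Real.exp (-2 * x 1) else 0)

/-- The Riemannian volume `e^{-x₂} dx₁ dx₂`. -/
def volH : Measure Pt :=
  (volume : Measure Pt).withDensity fun x => ENNReal.ofReal (Real.exp (-x 1))

/-- The partial derivative `∂_i`. -/
def partialD {F : Type*} [NormedAddCommGroup F] [NormedSpace ℝ F]
    (i : Fin 2) (f : Pt → F) (x : Pt) : F :=
  fderiv ℝ f x (Pi.single i 1)

/-- The Laplace-Beltrami operator `Δ f = h^{ii} (∂_i ∂_i f - Γ^k_{ii} ∂_k f)`. -/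
def lap {F : Type*} [NormedAddCommGroup F] [NormedSpace ℝ F] (f : Pt → F) (x : Pt) : F :=
  ∑ i, metricInv x i •
    (partialD i (partialD i f) x - ∑ k, christoffel x k i i • partialD k f x)

/-- The Riemann curvature tensor
`R(X, Y) Z = ∇_X ∇_Y Z - ∇_Y ∇_X Z - ∇_{[X, Y]} Z` at `y`, in coordinates. -/
def riemann (y : Pt) (X Y Z : Pt) : Pt := fun l =>
  ∑ i, ∑ j, ∑ k,
    (partialD i (fun w => christoffel w l j k) y - partialD j (fun w => christoffel w l i k) y
      + ∑ m, (christoffel y l i m * christoffel y m j k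
              - christoffel y l j m * christoffel y m i k)) * X i * Y j * Z k

/-! ### Maps into the hyperbolic plane, tension field, admissible harmonic maps -/

/-- The covariant derivative of a section `S` of `(T*ℍ²)^{⊗ n} ⊗ Q^*(Tℍ²)`
(with coordinate components `S x J k`) for the connection induced by the two Levi-Civita
connections; the new index, the direction of differentiation, comes first. -/
def covDeriv (Q : Pt → Pt) {n : ℕ} (S : Pt → (Fin n → Fin 2) → Fin 2 → ℝ) :
    Pt → (Fin (n + 1) → Fin 2) → Fin 2 → ℝ := fun x J k =>
  partialD (J 0) (fun y => S y (Fin.tail J) k) x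
    - ∑ a, ∑ m, christoffel x m (J 0) (Fin.tail J a) * S x (Function.update (Fin.tail J) a m) k
    + ∑ p, ∑ q, christoffel (Q x) k p q * partialD (J 0) Q x p * S x (Fin.tail J) q

/-- The tensor `∇^n dQ`. -/
def iterCovDeriv (Q : Pt → Pt) : (n : ℕ) → Pt → (Fin (n + 1) → Fin 2) → Fin 2 → ℝ
  | 0 => fun x J k => partialD (J 0) Q x k
  | n + 1 => covDeriv Q (iterCovDeriv Q n)

/-- The pointwise norm `|∇^n dQ|`. -/
def normIterCovDeriv (Q : Pt → Pt) (n : ℕ) (x : Pt) : ℝ :=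
  √(∑ J : Fin (n + 1) → Fin 2, ∑ k,
      (∏ a, metricInv x (J a)) * metric (Q x) k * iterCovDeriv Q n x J k ^ 2)

/-- The tension field `τ(Q)`, the trace of `∇dQ`. -/
def tension (Q : Pt → Pt) (x : Pt) : Pt := fun k =>
  ∑ i, metricInv x i * iterCovDeriv Q 1 x ![i, i] k

/-- Admissible harmonic maps: smooth, harmonic, with image in the geodesic ball of radius `R₀`
about the origin, with `∇^k dQ ∈ L²` for `k = 0, 1, 2`, and with `e^{ϱ r} |dQ| ∈ L^∞`. -/
structure IsAdmissible (R₀ ϱ : ℝ) (Q : Pt → Pt) : Prop where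
  smooth : ContDiff ℝ ∞ Q
  harmonic : ∀ x, tension Q x = 0
  image : ∀ x, rad (Q x) ≤ R₀
  energy : ∀ k ≤ 2, eLpNorm (normIterCovDeriv Q k) 2 volH < ⊤
  rate_pos : 0 < ϱ
  decay : eLpNorm (fun x => Real.exp (ϱ * rad x) * normIterCovDeriv Q 0 x) ⊤ volH < ⊤

/-- The smallness condition on the harmonic map, with parameter `μ₁`. -/
structure IsSmall (μ₁ ϱ : ℝ) (Q : Pt → Pt) : Prop where
  energy : eLpNorm (normIterCovDeriv Q 0) 2 volH < ENNReal.ofReal μ₁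
  decay : eLpNorm (fun x => Real.exp (ϱ * rad x) * normIterCovDeriv Q 0 x) ⊤ volH
    < ENNReal.ofReal μ₁
  higher : eLpNorm (normIterCovDeriv Q 2) ⊤ volH + eLpNorm (normIterCovDeriv Q 1) ⊤ volH
    < ENNReal.ofReal μ₁

/-! ### Frames, differential fields and connection coefficients -/

/-- The global orthonormal frame `Θ₁ = e^{y₂} ∂/∂y₁`, `Θ₂ = ∂/∂y₂`. -/
def Theta (y : Pt) : Fin 2 → Pt := ![![Real.exp (y 1), 0], ![0, 1]]

section Gauge

variable {E : Type*} [NormedAddCommGroup E] [NormedSpace ℝ E]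

/-- The covariant derivative `∇_v X` of a vector field `X` along the map `u` in the constant
direction `v`: `(∇_v X)^k = ∂_v X^k + Γ^k_{pq}(u) ∂_v u^p X^q`. -/
def covAlong (u X : E → Pt) (v z : E) : Pt := fun k =>
  fderiv ℝ X z v k + ∑ p, ∑ q, christoffel (u z) k p q * fderiv ℝ u z v p * X z q

/-- Components in the frame `e` at `z` of a tangent vector `X` at `u z`. -/
def frameComp (u : E → Pt) (e : Fin 2 → E → Pt) (z : E) (X : Pt) : Pt := fun j =>
  metricInner (u z) X (e j z)

/-- The differential field `φ_v = (⟨∂_v u, e_1⟩, ⟨∂_v u, e_2⟩)`. -/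
def diffField (u : E → Pt) (e : Fin 2 → E → Pt) (v z : E) : Pt :=
  frameComp u e z (fderiv ℝ u z v)

/-- The connection coefficients `[A_v]^k_j = ⟨∇_v e_j, e_k⟩` (row `k`, column `j`). -/
def connMat (u : E → Pt) (e : Fin 2 → E → Pt) (v z : E) : Matrix (Fin 2) (Fin 2) ℝ :=
  Matrix.of fun k j => metricInner (u z) (covAlong u (e j) v z) (e k z)

/-- The induced covariant derivative `D_v φ = ∂_v φ + A_v φ` of fields of frame components. -/
def gaugeD (u : E → Pt) (e : Fin 2 → E → Pt) (v : E) (f : E → Pt) (z : E) : Pt :=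
  fderiv ℝ f z v + connMat u e v z *ᵥ f z

end Gauge

/-- `(a ∧ b) c = ⟨a, c⟩ b - ⟨b, c⟩ a`, for the Euclidean inner product on `ℝ²` and the
(first-slot linear) Hermitian one on `ℂ²`. -/
def wedge {𝕜 : Type*} [RCLike 𝕜] (a b c : Fin 2 → 𝕜) : Fin 2 → 𝕜 :=
  (a ⬝ᵥ star c) • b - (b ⬝ᵥ star c) • a

/-- The matrix `h^{ii} (∂_i A_i - Γ^k_{ii} A_k)` of a connection `A`. -/
def divConn (A : Fin 2 → Pt → Matrix (Fin 2) (Fin 2) ℝ) (x : Pt) : Matrix (Fin 2) (Fin 2) ℝ :=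
  ∑ i, metricInv x i •
    (Matrix.of (fun k j => partialD i (fun y => A i y k j) x) - ∑ l, christoffel x l i i • A l x)

/-! ### The limit fields of `Q` and the magnetic operator -/

/-- The frame `Ξ(x) = Θ(Q(x))` along `Q`. -/
def limitFrame (Q : Pt → Pt) : Fin 2 → Pt → Pt := fun j x => Theta (Q x) j

/-- The limit connection `A^∞_i` of `Q` in the frame `Θ(Q)`. -/
def connInf (Q : Pt → Pt) (i : Fin 2) (x : Pt) : Matrix (Fin 2) (Fin 2) ℝ :=
  connMat Q (limitFrame Q) (Pi.single i 1) x

/-- The limit differential field `φ^∞_i` of `Q` in the frame `Θ(Q)`. -/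
def phiInf (Q : Pt → Pt) (i : Fin 2) (x : Pt) : Pt :=
  diffField Q (limitFrame Q) (Pi.single i 1) x

/-- A real matrix acting on `𝕜²`. -/
def matAct {𝕜 : Type*} [RCLike 𝕜] (A : Matrix (Fin 2) (Fin 2) ℝ) (v : Fin 2 → 𝕜) : Fin 2 → 𝕜 :=
  A.map (algebraMap ℝ 𝕜) *ᵥ v

/-- The magnetic operator
`W φ = -2 h^{ii} A^∞_i ∂_i φ - h^{ii} A^∞_i A^∞_i φ - h^{ii} (φ ∧ φ^∞_i) φ^∞_i
  - h^{ii} (∂_i A^∞_i - Γ^k_{ii} A^∞_k) φ`. -/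
def magneticW {𝕜 : Type*} [RCLike 𝕜] (Q : Pt → Pt) (f : Pt → Fin 2 → 𝕜) (x : Pt) :
    Fin 2 → 𝕜 :=
  - (2 : ℝ) • ∑ i, metricInv x i • matAct (connInf Q i x) (partialD i f x)
  - ∑ i, metricInv x i • matAct (connInf Q i x) (matAct (connInf Q i x) (f x))
  - ∑ i, metricInv x i • wedge (f x) (fun k => algebraMap ℝ 𝕜 (phiInf Q i x k))
      (fun k => algebraMap ℝ 𝕜 (phiInf Q i x k))
  - matAct (divConn (connInf Q) x) (f x)

/-! ### The caloric gauge -/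

/-- Points `(s, t, x)`: heat time, time, space. -/
abbrev SpaceTime := ℝ × ℝ × Pt

/-- The coordinate direction of `∂_s`. -/
def dirS : SpaceTime := (1, 0, 0)

/-- The coordinate direction of `∂_t`. -/
def dirT : SpaceTime := (0, 1, 0)

/-- The coordinate direction of `∂_i`, `i = 1, 2`. -/
def dirX (i : Fin 2) : SpaceTime := (0, 0, Pi.single i 1)

/-- The region `s > 0`, `0 < t < T`, `x ∈ ℍ²`. -/
def slab (T : ℝ) : Set SpaceTime := Ioi 0 ×ˢ Ioo 0 T ×ˢ univ

/-- `(U, Ω)` is a caloric gauge over the map `u(t, x)`, `0 < t < T`, with limit map `Q` and limit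
frame `Ξ`: `U` is the heat flow of `u`, the orthonormal frame `Ω` along `U` is parallel in `s`, and
`U → Q`, `Ω → Ξ` as `s → ∞`, frames being compared through their components in `Θ`. -/
structure IsCaloricGauge (T : ℝ) (u : ℝ → Pt → Pt) (Q : Pt → Pt) (Ξ : Fin 2 → Pt → Pt)
    (U : SpaceTime → Pt) (Ω : Fin 2 → SpaceTime → Pt) : Prop where
  regular_map : ContDiffOn ℝ 3 U (slab T)
  regular_frame : ∀ j, ContDiffOn ℝ 2 (Ω j) (slab T)
  initial : ∀ t ∈ Ioo 0 T, ∀ x, Tendsto (fun s => U (s, t, x)) (𝓝[>] 0) (𝓝 (u t x))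
  heat_flow : ∀ z ∈ slab T,
    fderiv ℝ U z dirS = tension (fun y => U (z.1, z.2.1, y)) z.2.2
  orthonormal : ∀ z ∈ slab T, ∀ i j,
    metricInner (U z) (Ω i z) (Ω j z) = if i = j then 1 else 0
  parallel : ∀ z ∈ slab T, ∀ j, covAlong U (Ω j) dirS z = 0
  limit_map : ∀ t ∈ Ioo 0 T, ∀ x, Tendsto (fun s => U (s, t, x)) atTop (𝓝 (Q x))
  limit_frame : ∀ t ∈ Ioo 0 T, ∀ x, ∀ i j,
    Tendsto (fun s => metricInner (U (s, t, x)) (Ω i (s, t, x)) (Theta (U (s, t, x)) j)) atTop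
      (𝓝 (metricInner (Q x) (Ξ i x) (Theta (Q x) j)))

/-- The heat tension field `φ_s`. -/
def phiS (U : SpaceTime → Pt) (Ω : Fin 2 → SpaceTime → Pt) : SpaceTime → Pt :=
  diffField U Ω dirS

/-- The field `φ_t`. -/
def phiT (U : SpaceTime → Pt) (Ω : Fin 2 → SpaceTime → Pt) : SpaceTime → Pt :=
  diffField U Ω dirT

/-- The wave tension field `𝔚 = D_t φ_t - h^{ii} D_i φ_i + h^{ii} Γ^k_{ii} φ_k`. -/
def waveTension (U : SpaceTime → Pt) (Ω : Fin 2 → SpaceTime → Pt) (z : SpaceTime) : Pt :=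
  gaugeD U Ω dirT (phiT U Ω) z
  - ∑ i, metricInv z.2.2 i • gaugeD U Ω (dirX i) (diffField U Ω (dirX i)) z
  + ∑ i, metricInv z.2.2 i • ∑ k, christoffel z.2.2 k i i • diffField U Ω (dirX k) z

/-- The remainder `A^con_i` in the splitting `A_i = A^∞_i + A^con_i`. -/
def connCon (Q : Pt → Pt) (U : SpaceTime → Pt) (Ω : Fin 2 → SpaceTime → Pt) (i : Fin 2)
    (z : SpaceTime) : Matrix (Fin 2) (Fin 2) ℝ :=
  connMat U Ω (dirX i) z - connInf Q i z.2.2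

/-- The remainder `φ^con_i` in the splitting `φ_i = φ^∞_i + φ^con_i`. -/
def phiCon (Q : Pt → Pt) (U : SpaceTime → Pt) (Ω : Fin 2 → SpaceTime → Pt) (i : Fin 2)
    (z : SpaceTime) : Pt :=
  diffField U Ω (dirX i) z - phiInf Q i z.2.2

/-- The right-hand side of the wave equation for `φ_s`:
`-2 A_t ∂_t φ_s - A_t A_t φ_s - (∂_t A_t) φ_s + ∂_s 𝔚 + R(∂_t U, ∂_s U)(∂_t U)
 + 2 h^{ii} A^con_i ∂_i φ_s + h^{ii} A^con_i A^∞_i φ_s + h^{ii} A^∞_i A^con_i φ_s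
 + h^{ii} A^con_i A^con_i φ_s + h^{ii} (∂_i A^con_i - Γ^k_{ii} A^con_k) φ_s
 + h^{ii} (φ_s ∧ φ^∞_i) φ^con_i + h^{ii} (φ_s ∧ φ^con_i) φ^∞_i + h^{ii} (φ_s ∧ φ^con_i) φ^con_i`. -/
def masterRHS (Q : Pt → Pt) (U : SpaceTime → Pt) (Ω : Fin 2 → SpaceTime → Pt)
    (z : SpaceTime) : Pt :=
  - (2 : ℝ) • (connMat U Ω dirT z *ᵥ fderiv ℝ (phiS U Ω) z dirT)
  - connMat U Ω dirT z *ᵥ (connMat U Ω dirT z *ᵥ phiS U Ω z)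
  - Matrix.of (fun k j => fderiv ℝ (fun w => connMat U Ω dirT w k j) z dirT) *ᵥ phiS U Ω z
  + fderiv ℝ (waveTension U Ω) z dirS
  + frameComp U Ω z
      (riemann (U z) (fderiv ℝ U z dirT) (fderiv ℝ U z dirS) (fderiv ℝ U z dirT))
  + (2 : ℝ) • ∑ i, metricInv z.2.2 i • (connCon Q U Ω i z *ᵥ fderiv ℝ (phiS U Ω) z (dirX i))
  + ∑ i, metricInv z.2.2 i • (connCon Q U Ω i z *ᵥ (connInf Q i z.2.2 *ᵥ phiS U Ω z))
  + ∑ i, metricInv z.2.2 i • (connInf Q i z.2.2 *ᵥ (connCon Q U Ω i z *ᵥ phiS U Ω z))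
  + ∑ i, metricInv z.2.2 i • (connCon Q U Ω i z *ᵥ (connCon Q U Ω i z *ᵥ phiS U Ω z))
  + divConn (fun i y => connCon Q U Ω i (z.1, z.2.1, y)) z.2.2 *ᵥ phiS U Ω z
  + ∑ i, metricInv z.2.2 i • wedge (phiS U Ω z) (phiInf Q i z.2.2) (phiCon Q U Ω i z)
  + ∑ i, metricInv z.2.2 i • wedge (phiS U Ω z) (phiCon Q U Ω i z) (phiInf Q i z.2.2)
  + ∑ i, metricInv z.2.2 i • wedge (phiS U Ω z) (phiCon Q U Ω i z) (phiCon Q U Ω i z)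

/-- On `(s, ∞)`, at time `t`, the fields `φ_s ∧ φ_i` (entry `(k, j)` being `((φ_s ∧ φ_i) e_j)_k`)
and `∂_s φ_i` are dominated, locally uniformly in `x`, by an integrable function of heat time. -/
def HeatTimeDominated (U : SpaceTime → Pt) (Ω : Fin 2 → SpaceTime → Pt) (s t : ℝ) : Prop :=
  ∀ x₀ : Pt, ∃ V ∈ 𝓝 x₀, ∃ b : ℝ → ℝ, IntegrableOn b (Ioi s) ∧
    ∀ κ ∈ Ioi s, ∀ x ∈ V, ∀ i k : Fin 2,
      (∀ j : Fin 2, |wedge (phiS U Ω (κ, t, x)) (diffField U Ω (dirX i) (κ, t, x))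
        (Pi.single j 1) k| ≤ b κ) ∧
      |fderiv ℝ (diffField U Ω (dirX i)) (κ, t, x) dirS k| ≤ b κ

/-! ### The operator `-Δ + W` on `L²(ℍ²; ℂ²)` -/

/-- The Hilbert space `L²(ℍ²; ℂ²)`. -/
abbrev L2H := Lp (EuclideanSpace ℂ (Fin 2)) 2 volH

/-- Test functions: `C_c^∞(ℍ²; ℂ²)`. -/
def IsTest (ψ : Pt → Fin 2 → ℂ) : Prop := ContDiff ℝ ∞ ψ ∧ HasCompactSupport ψ

/-- The graph of `-Δ + W` on `C_c^∞(ℍ²; ℂ²)`, inside `L² × L²`. -/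
def coreGraph (Q : Pt → Pt) : Set (L2H × L2H) :=
  {p | ∃ ψ, IsTest ψ ∧ (p.1 =ᵐ[volH] fun x => WithLp.toLp 2 (ψ x)) ∧
    (p.2 =ᵐ[volH] fun x => WithLp.toLp 2 (-lap ψ x + magneticW Q ψ x))}

/-- The domain of the Laplacian: those `f ∈ L²` whose distributional Laplacian is in `L²`. -/
def lapDomain : Set L2H :=
  {f | ∃ g : L2H, ∀ ψ, IsTest ψ →
    ∫ x, ⟪(WithLp.toLp 2 (lap ψ x) : EuclideanSpace ℂ (Fin 2)), f x⟫_ℂ ∂volH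
      = ∫ x, ⟪(WithLp.toLp 2 (ψ x) : EuclideanSpace ℂ (Fin 2)), g x⟫_ℂ ∂volH}

end MagneticHyp

end

open MagneticHyp

namespace MagneticHyp

/-! ### Pointwise geometry of the target -/

/-! The wave equation comes from commuting `∂_s` through the definition of `𝔚`. The frame is
parallel in heat time, so `A_s = 0` and `∂_s = D_s` on frame components. The pulled-back connection
is torsion free, hence `D_s φ_α = D_α φ_s`, and its curvature is the wedge, hence `D_s D_α φ_α = D_α
D_α φ_s + (φ_s ∧ φ_α) φ_α` (`fderiv_gaugeD_diffField`). Differentiating `𝔚` therefore gives a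
covariant wave equation for `φ_s`. Expanding each `D_α` and splitting `A_i`, `φ_i` into limit and
remainder, the terms built from the limit fields alone are exactly `W φ_s`, and all others form the
right-hand side (`wave_equation`).

For the integral formulas, `∂_s A_i = φ_s ∧ φ_i`, so the fundamental theorem of calculus leaves only
the boundary values at `s = ∞` to identify. The gauge prescribes just the pointwise limits of the
map and of the frame, not of their derivatives. Domination makes `A_i` and `φ_i` converge to
continuous limits along each coordinate line, boundedly, and a limit of derivatives under these
conditions is the derivative of the limit (`hasDerivAt_of_tendsto_of_bounded`). This forces the
boundary values to be `A_i^∞` and `φ_i^∞`.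

Self-adjointness is a Kato–Rellich argument (`exists_isSelfAdjoint_closure`). Harmonicity turns the
divergence of `A^∞` into an expression quadratic in `dQ`, so `W` has first order coefficients of
size `|dQ|` and zeroth order ones of size `|dQ|²`. As `|dQ|` is bounded, `‖Wψ‖²` is controlled by
the form of `-Δ + 1`. It remains to see that `-Δ + l` has dense range on test functions, i.e. that a
weak solution `g ∈ L²` of `Δg = l g` vanishes. Smoothing `g` by a kernel `k(cosh d(x, y))` preserves
the equation, because the Laplacian of such a kernel is the same in `x` and in `y`, and preserves
`L²` by Schur's test. The smooth solution is killed by an energy estimate with cutoffs, and letting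
the kernel concentrate on the diagonal gives `g = 0` (`ae_eq_zero_of_weak_resolvent`).

For positivity, the target has negative curvature, so the form of `-Δ + W` is `∫ h^{ii} |D_i ψ|²`
plus an integral of squares (`formDensity_self`). The term `|D_2 ψ|²` alone gives the spectral gap
`1/4` of the hyperbolic plane, since the skew matrix `A_2^∞` does not affect `Re ⟨ψ, D_2 ψ⟩`
(`quarter_le_form`). -/

@[simp] theorem christoffel_zero_zero_zero (x : Pt) : christoffel x 0 0 0 = 0 := by
  simp [christoffel]

@[simp] theorem christoffel_zero_zero_one (x : Pt) : christoffel x 0 0 1 = -1 := by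
  simp [christoffel]

@[simp] theorem christoffel_zero_one_zero (x : Pt) : christoffel x 0 1 0 = -1 := by
  simp [christoffel]

@[simp] theorem christoffel_zero_one_one (x : Pt) : christoffel x 0 1 1 = 0 := by
  simp [christoffel]

@[simp] theorem christoffel_one_zero_zero (x : Pt) :
    christoffel x 1 0 0 = Real.exp (-2 * x 1) := by
  simp [christoffel]

@[simp] theorem christoffel_one_zero_one (x : Pt) : christoffel x 1 0 1 = 0 := by
  simp [christoffel]

@[simp] theorem christoffel_one_one_zero (x : Pt) : christoffel x 1 1 0 = 0 := by
  simp [christoffel]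

@[simp] theorem christoffel_one_one_one (x : Pt) : christoffel x 1 1 1 = 0 := by
  simp [christoffel]

theorem hasFDerivAt_exp_coord (c : ℝ) (y : Pt) :
    HasFDerivAt (fun w : Pt => Real.exp (c * w 1))
      (Real.exp (c * y 1) • c • (ContinuousLinearMap.proj 1 : Pt →L[ℝ] ℝ)) y := by
  have h1 : HasFDerivAt (fun w : Pt => w 1) (ContinuousLinearMap.proj 1 : Pt →L[ℝ] ℝ) y :=
    (ContinuousLinearMap.proj 1 : Pt →L[ℝ] ℝ).hasFDerivAt
  exact (h1.const_mul c).exp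

theorem metricInner_eq (y v w : Pt) :
    metricInner y v w = Real.exp (-2 * y 1) * v 0 * w 0 + v 1 * w 1 := by
  simp [metricInner, metric]

/-- The curvature tensor of the hyperbolic plane. -/
theorem riemann_eq (y X Y Z : Pt) :
    riemann y X Y Z = metricInner y X Z • Y - metricInner y Y Z • X := by
  have h : fderiv ℝ (fun w : Pt => Real.exp (-(2 * w 1))) y
      = Real.exp (-(2 * y 1)) • (-2 : ℝ) • (ContinuousLinearMap.proj 1 : Pt →L[ℝ] ℝ) := by
    simpa only [neg_mul] using (hasFDerivAt_exp_coord (-2) y).fderiv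
  -- The case distinction on indices is moved outside the dependence on the base point, so that each
  -- coefficient is differentiated either as a constant or as `e^{-2 y₂}`.
  have e : ∀ k i j : Fin 2, (fun w : Pt => christoffel w k i j) =
      if k = 0 then (if i = j then fun _ => 0 else fun _ => -1)
      else (if i = 0 ∧ j = 0 then fun w => Real.exp (-2 * w 1) else fun _ => 0) := by
    intro k i j
    funext w
    simp only [christoffel]
    split_ifs <;> rfl
  funext l
  simp only [riemann, e, partialD, metricInner_eq]
  fin_cases l <;> simp [h, Fin.sum_univ_two] <;> ring

/-! ### The pulled-back connection along a map -/

section Along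

variable {E : Type*} [NormedAddCommGroup E] [NormedSpace ℝ E]

theorem fderiv_coord {f : E → Pt} {z : E} (hf : DifferentiableAt ℝ f z) (v : E) (k : Fin 2) :
    fderiv ℝ (fun w => f w k) z v = fderiv ℝ f z v k := by
  have := ((ContinuousLinearMap.proj k : Pt →L[ℝ] ℝ).hasFDerivAt.comp z hf.hasFDerivAt).fderiv
  have h2 : (fun w => f w k) = (ContinuousLinearMap.proj k : Pt →L[ℝ] ℝ) ∘ f := rfl
  rw [h2, this]
  rfl

theorem covAlong_zero (u X : E → Pt) (v z : E) :
    covAlong u X v z 0 = fderiv ℝ X z v 0 - fderiv ℝ u z v 0 * X z 1 - fderiv ℝ u z v 1 * X z 0 := by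
  simp [covAlong, Fin.sum_univ_two]
  ring

theorem covAlong_one (u X : E → Pt) (v z : E) :
    covAlong u X v z 1
      = fderiv ℝ X z v 1 + Real.exp (-2 * u z 1) * fderiv ℝ u z v 0 * X z 0 := by
  simp [covAlong, Fin.sum_univ_two]

theorem hasFDerivAt_coord {f : E → Pt} {z : E} (hf : DifferentiableAt ℝ f z) (k : Fin 2) :
    HasFDerivAt (fun w => f w k) ((ContinuousLinearMap.proj k : Pt →L[ℝ] ℝ).comp (fderiv ℝ f z)) z :=
  (ContinuousLinearMap.proj k : Pt →L[ℝ] ℝ).hasFDerivAt.comp z hf.hasFDerivAt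

/-- Compatibility of the pulled back connection with the metric. -/
theorem hasFDerivAt_metricInner {u X Y : E → Pt} {z : E} (hu : DifferentiableAt ℝ u z)
    (hX : DifferentiableAt ℝ X z) (hY : DifferentiableAt ℝ Y z) :
    DifferentiableAt ℝ (fun w => metricInner (u w) (X w) (Y w)) z ∧ ∀ v,
    fderiv ℝ (fun w => metricInner (u w) (X w) (Y w)) z v
      = metricInner (u z) (covAlong u X v z) (Y z) + metricInner (u z) (X z) (covAlong u Y v z) := by
  have h := ((((hasFDerivAt_coord hu 1).const_mul (-2)).exp.mul (hasFDerivAt_coord hX 0)).mul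
    (hasFDerivAt_coord hY 0)).add ((hasFDerivAt_coord hX 1).mul (hasFDerivAt_coord hY 1))
  have e : (fun w => metricInner (u w) (X w) (Y w)) = fun w =>
      Real.exp (-2 * u w 1) * X w 0 * Y w 0 + X w 1 * Y w 1 := by
    funext w; rw [metricInner_eq]
  rw [e]
  refine ⟨h.differentiableAt, fun v => ?_⟩
  erw [h.fderiv]
  simp only [metricInner_eq, covAlong_zero, covAlong_one]
  simp
  ring

/-- Mixed second derivatives commute. -/
theorem fderiv_fderiv_comm {F : Type*} [NormedAddCommGroup F] [NormedSpace ℝ F] {f : E → F} {z : E}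
    (hf : ContDiffAt ℝ 2 f z) (v w : E) :
    fderiv ℝ (fun y => fderiv ℝ f y w) z v = fderiv ℝ (fun y => fderiv ℝ f y v) z w := by
  have hd : DifferentiableAt ℝ (fderiv ℝ f) z :=
    (hf.fderiv_right (m := 1) (by norm_num)).differentiableAt (by norm_num)
  have h1 : ∀ a b : E, fderiv ℝ (fun y => fderiv ℝ f y a) z b = fderiv ℝ (fderiv ℝ f) z b a := by
    intro a b
    rw [fderiv_clm_apply hd (differentiableAt_const a)]
    simp
  rw [h1, h1]
  exact (hf.isSymmSndFDerivAt (by simp)).eq v w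

/-- The pulled back connection is torsion free. -/
theorem covAlong_fderiv_comm {u : E → Pt} {z : E} (hu : ContDiffAt ℝ 2 u z) (v w : E) :
    covAlong u (fun y => fderiv ℝ u y w) v z = covAlong u (fun y => fderiv ℝ u y v) w z := by
  funext k
  fin_cases k
  · simp only [Fin.zero_eta, covAlong_zero, fderiv_fderiv_comm hu v w]; ring
  · simp only [Fin.mk_one, covAlong_one, fderiv_fderiv_comm hu v w]; ring

theorem differentiableAt_fderiv_apply {F : Type*} [NormedAddCommGroup F] [NormedSpace ℝ F]
    {f : E → F} {z : E} (hf : ContDiffAt ℝ 2 f z) (v : E) :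
    DifferentiableAt ℝ (fun y => fderiv ℝ f y v) z :=
  ((hf.fderiv_right (m := 1) (by norm_num)).differentiableAt (by norm_num)).clm_apply
    (differentiableAt_const v)

/-- With second derivatives spelled out in coordinates, the commutator of two covariant derivatives
becomes a polynomial identity modulo the symmetry of second derivatives. -/
theorem hasFDerivAt_covAlong {u X : E → Pt} {z : E} (hu : ContDiffAt ℝ 2 u z)
    (hX : ContDiffAt ℝ 2 X z) (v : E) :
    DifferentiableAt ℝ (covAlong u X v) z ∧ ∀ w,
    fderiv ℝ (covAlong u X v) z w = ![
      fderiv ℝ (fun y => fderiv ℝ X y v) z w 0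
        - (fderiv ℝ (fun y => fderiv ℝ u y v) z w 0 * X z 1 + fderiv ℝ u z v 0 * fderiv ℝ X z w 1)
        - (fderiv ℝ (fun y => fderiv ℝ u y v) z w 1 * X z 0 + fderiv ℝ u z v 1 * fderiv ℝ X z w 0),
      fderiv ℝ (fun y => fderiv ℝ X y v) z w 1
        + Real.exp (-2 * u z 1) * (-2 * fderiv ℝ u z w 1 * fderiv ℝ u z v 0 * X z 0
          + fderiv ℝ (fun y => fderiv ℝ u y v) z w 0 * X z 0
          + fderiv ℝ u z v 0 * fderiv ℝ X z w 0)] := by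
  have hX1 := hX.differentiableAt (by norm_num)
  have hu1 := hu.differentiableAt (by norm_num)
  have a := differentiableAt_fderiv_apply hX v
  have b := differentiableAt_fderiv_apply hu v
  have h0 := ((hasFDerivAt_coord a 0).sub ((hasFDerivAt_coord b 0).mul (hasFDerivAt_coord hX1 1))).sub
    ((hasFDerivAt_coord b 1).mul (hasFDerivAt_coord hX1 0))
  have h1 := (hasFDerivAt_coord a 1).add ((((hasFDerivAt_coord hu1 1).const_mul (-2)).exp.mul
    (hasFDerivAt_coord b 0)).mul (hasFDerivAt_coord hX1 0))
  have e0 : (fun y => covAlong u X v y 0) = fun y => fderiv ℝ X y v 0 - fderiv ℝ u y v 0 * X y 1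
      - fderiv ℝ u y v 1 * X y 0 := by funext y; rw [covAlong_zero]
  have e1 : (fun y => covAlong u X v y 1) = fun y => fderiv ℝ X y v 1
      + Real.exp (-2 * u y 1) * fderiv ℝ u y v 0 * X y 0 := by funext y; rw [covAlong_one]
  have d0 : DifferentiableAt ℝ (fun y => covAlong u X v y 0) z := by
    rw [e0]; exact h0.differentiableAt
  have d1 : DifferentiableAt ℝ (fun y => covAlong u X v y 1) z := by
    rw [e1]; exact h1.differentiableAt
  have d : DifferentiableAt ℝ (covAlong u X v) z := by
    refine differentiableAt_pi.2 fun k => ?_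
    fin_cases k
    · exact d0
    · exact d1
  refine ⟨d, fun w => ?_⟩
  funext k
  rw [← fderiv_coord d]
  fin_cases k
  · simp only [Fin.zero_eta]
    rw [e0]
    erw [h0.fderiv]
    simp
    ring
  · simp only [Fin.mk_one]
    rw [e1]
    erw [h1.fderiv]
    simp
    ring

/-- The commutator of covariant derivatives along a map is the curvature. -/
theorem covAlong_comm {u X : E → Pt} {z : E} (hu : ContDiffAt ℝ 2 u z)
    (hX : ContDiffAt ℝ 2 X z) (v w : E) :
    covAlong u (covAlong u X w) v z = covAlong u (covAlong u X v) w z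
      + riemann (u z) (fderiv ℝ u z v) (fderiv ℝ u z w) (X z) := by
  have hv := (hasFDerivAt_covAlong hu hX v).2 w
  have hw := (hasFDerivAt_covAlong hu hX w).2 v
  funext k
  rw [riemann_eq]
  fin_cases k
  · simp only [Pi.add_apply, Fin.zero_eta, covAlong_zero, covAlong_one, hv, hw, metricInner_eq,
      fderiv_fderiv_comm hu v w, fderiv_fderiv_comm hX v w]
    simp
    ring
  · simp only [Pi.add_apply, Fin.mk_one, covAlong_zero, covAlong_one, hv, hw, metricInner_eq,
      fderiv_fderiv_comm hu v w, fderiv_fderiv_comm hX v w]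
    simp
    ring

end Along

/-! ### Orthonormal frames -/

section Frames

variable {E : Type*}

/-- The vectors `e₁ z, e₂ z` form an orthonormal basis of the tangent space at `u z`. -/
def IsOrthonormalAt (u : E → Pt) (e : Fin 2 → E → Pt) (z : E) : Prop :=
  ∀ i j, metricInner (u z) (e i z) (e j z) = if i = j then 1 else 0

theorem metricInner_comm (y v w : Pt) : metricInner y v w = metricInner y w v := by
  simp only [metricInner_eq]; ring

theorem metricInner_add_left (y v v' w : Pt) :
    metricInner y (v + v') w = metricInner y v w + metricInner y v' w := by
  simp only [metricInner_eq, Pi.add_apply]; ring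

theorem metricInner_smul_left (y : Pt) (c : ℝ) (v w : Pt) :
    metricInner y (c • v) w = c * metricInner y v w := by
  simp only [metricInner_eq, Pi.smul_apply, smul_eq_mul]; ring

/-- Parseval's identity in an orthonormal frame. -/
theorem IsOrthonormalAt.parseval {u : E → Pt} {e : Fin 2 → E → Pt} {z : E}
    (h : IsOrthonormalAt u e z) (X Y : Pt) :
    metricInner (u z) X Y = ∑ k, frameComp u e z X k * frameComp u e z Y k := by
  have h00 := h 0 0
  have h01 := h 0 1
  have h11 := h 1 1
  have hs : Real.exp (-2 * u z 1) = Real.exp (-u z 1) * Real.exp (-u z 1) := by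
    rw [← Real.exp_add]; ring_nf
  simp only [metricInner_eq, Fin.sum_univ_two, frameComp, hs] at *
  simp only [if_true] at *
  simp only [Fin.zero_eq_one_iff, OfNat.ofNat_ne_one, if_false] at h01
  set s := Real.exp (-u z 1)
  -- Scaling first components by `s = e^{-u₂}` makes the frame an orthogonal matrix: orthonormality
  -- says `M Mᵀ = 1`. A one-sided inverse of a square matrix is two-sided, and `Mᵀ M = 1` is the
  -- completeness relation.
  have hM : !![s * e 0 z 0, e 0 z 1; s * e 1 z 0, e 1 z 1]
      * !![s * e 0 z 0, s * e 1 z 0; e 0 z 1, e 1 z 1] = 1 := by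
    ext i j
    fin_cases i <;> fin_cases j <;> simp [Matrix.mul_apply, Fin.sum_univ_two] <;> linarith
  have hM' := mul_eq_one_comm.1 hM
  have k00 : s * e 0 z 0 * (s * e 0 z 0) + s * e 1 z 0 * (s * e 1 z 0) = 1 := by
    simpa [Matrix.mul_apply, Fin.sum_univ_two] using congr_fun (congr_fun hM' 0) 0
  have k01 : s * e 0 z 0 * e 0 z 1 + s * e 1 z 0 * e 1 z 1 = 0 := by
    simpa [Matrix.mul_apply, Fin.sum_univ_two] using congr_fun (congr_fun hM' 0) 1
  have k11 : e 0 z 1 * e 0 z 1 + e 1 z 1 * e 1 z 1 = 1 := by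
    simpa [Matrix.mul_apply, Fin.sum_univ_two] using congr_fun (congr_fun hM' 1) 1
  linear_combination (-s ^ 2 * X 0 * Y 0) * k00 - (s * X 0 * Y 1 + s * X 1 * Y 0) * k01
    - X 1 * Y 1 * k11

theorem frameComp_add (u : E → Pt) (e : Fin 2 → E → Pt) (z : E) (X Y : Pt) :
    frameComp u e z (X + Y) = frameComp u e z X + frameComp u e z Y := by
  funext k; simp [frameComp, metricInner_add_left]

theorem frameComp_smul (u : E → Pt) (e : Fin 2 → E → Pt) (z : E) (c : ℝ) (X : Pt) :
    frameComp u e z (c • X) = c • frameComp u e z X := by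
  funext k; simp [frameComp, metricInner_smul_left]

/-- In an orthonormal frame the curvature operator is the wedge product of components. -/
theorem IsOrthonormalAt.frameComp_riemann {u : E → Pt} {e : Fin 2 → E → Pt} {z : E}
    (h : IsOrthonormalAt u e z) (X Y Z : Pt) :
    frameComp u e z (riemann (u z) X Y Z)
      = wedge (frameComp u e z X) (frameComp u e z Y) (frameComp u e z Z) := by
  rw [riemann_eq, sub_eq_add_neg, ← neg_smul, frameComp_add, frameComp_smul, frameComp_smul,
    h.parseval X Z, h.parseval Y Z]
  funext k
  simp [wedge, dotProduct, Fin.sum_univ_two]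
  ring

theorem IsOrthonormalAt.frameComp_self {u : E → Pt} {e : Fin 2 → E → Pt} {z : E}
    (h : IsOrthonormalAt u e z) (j : Fin 2) : frameComp u e z (e j z) = Pi.single j 1 := by
  funext k
  rw [frameComp, h j k]
  by_cases hk : j = k
  · subst hk; simp
  · simp [hk, Ne.symm hk]

variable [NormedAddCommGroup E] [NormedSpace ℝ E]

/-- Differentiating the constants `⟨e_i, e_j⟩` with a metric connection shows that `A_v` is
skew-symmetric. -/
theorem fderiv_metricInner_frame {u : E → Pt} {e : Fin 2 → E → Pt} {z : E}
    (ho : ∀ᶠ w in 𝓝 z, IsOrthonormalAt u e w) (hu : DifferentiableAt ℝ u z)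
    (he : ∀ j, DifferentiableAt ℝ (e j) z) (v : E) (i j : Fin 2) :
    connMat u e v z j i + connMat u e v z i j = 0 := by
  have h := (hasFDerivAt_metricInner hu (he i) (he j)).2 v
  have h2 : (fun w => metricInner (u w) (e i w) (e j w)) =ᶠ[𝓝 z] fun _ => if i = j then 1 else 0 := by
    filter_upwards [ho] with w hw using hw i j
  rw [h2.fderiv_eq] at h
  simp only [connMat, Matrix.of_apply]
  rw [metricInner_comm _ (covAlong u (e j) v z), ← h]
  simp

theorem differentiableAt_frameComp {u X : E → Pt} {e : Fin 2 → E → Pt} {z : E}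
    (hu : DifferentiableAt ℝ u z) (hX : DifferentiableAt ℝ X z)
    (he : ∀ j, DifferentiableAt ℝ (e j) z) :
    DifferentiableAt ℝ (fun w => frameComp u e w (X w)) z :=
  differentiableAt_pi.2 fun j => (hasFDerivAt_metricInner hu hX (he j)).1

/-- The frame components intertwine the pulled back connection and `D`. -/
theorem gaugeD_frameComp {u X : E → Pt} {e : Fin 2 → E → Pt} {z : E}
    (ho : ∀ᶠ w in 𝓝 z, IsOrthonormalAt u e w) (hu : DifferentiableAt ℝ u z)
    (hX : DifferentiableAt ℝ X z) (he : ∀ j, DifferentiableAt ℝ (e j) z) (v : E) :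
    gaugeD u e v (fun w => frameComp u e w (X w)) z = frameComp u e z (covAlong u X v z) := by
  funext j
  have h := (hasFDerivAt_metricInner hu hX (he j)).2 v
  have hf : DifferentiableAt ℝ (fun w => frameComp u e w (X w)) z :=
    differentiableAt_frameComp hu hX he
  rw [gaugeD, Pi.add_apply, ← fderiv_coord hf]
  simp only [frameComp] at h ⊢
  -- Parseval expands `⟨X, ∇_v e_j⟩` in the frame; by skew-symmetry of `A_v` it is minus the `j`-th
  -- component of `A_v` applied to the components of `X`, which the connection term of `D_v`
  -- cancels.
  rw [h, ho.self_of_nhds.parseval (X z)]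
  have h0 := fderiv_metricInner_frame ho hu he v 0 j
  have h1 := fderiv_metricInner_frame ho hu he v 1 j
  simp only [Matrix.mulVec, dotProduct, Fin.sum_univ_two, frameComp] at *
  simp only [connMat, Matrix.of_apply] at *
  linear_combination metricInner (u z) (X z) (e 0 z) * h0 + metricInner (u z) (X z) (e 1 z) * h1

end Frames

/-! ### Gauge identities in a frame that is parallel in one direction -/

theorem mulVec_two {R : Type*} [CommRing R] (A : Matrix (Fin 2) (Fin 2) R) (v : Fin 2 → R)
    (k : Fin 2) : (A *ᵥ v) k = A k 0 * v 0 + A k 1 * v 1 := by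
  simp [Matrix.mulVec, dotProduct, Fin.sum_univ_two]

section Parallel

variable {E : Type*} [NormedAddCommGroup E] [NormedSpace ℝ E]

/-- Near `z`, the map `u` is `C³` and `e` is an orthonormal `C²` frame along `u` which is parallel
in the direction `s`. -/
def IsParallelFrameNear (u : E → Pt) (e : Fin 2 → E → Pt) (s z : E) : Prop :=
  ∀ᶠ w in 𝓝 z, ContDiffAt ℝ 3 u w ∧ (∀ j, ContDiffAt ℝ 2 (e j) w) ∧ IsOrthonormalAt u e w ∧
    ∀ j, covAlong u (e j) s w = 0

namespace IsParallelFrameNear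

variable {u : E → Pt} {e : Fin 2 → E → Pt} {s z : E}

theorem eventually (h : IsParallelFrameNear u e s z) :
    ∀ᶠ w in 𝓝 z, IsParallelFrameNear u e s w := eventually_eventually_nhds.2 h

theorem contDiffAt_map (h : IsParallelFrameNear u e s z) : ContDiffAt ℝ 3 u z := h.self_of_nhds.1

theorem contDiffAt_map_two (h : IsParallelFrameNear u e s z) : ContDiffAt ℝ 2 u z :=
  h.contDiffAt_map.of_le (by norm_num)

theorem contDiffAt_frame (h : IsParallelFrameNear u e s z) (j : Fin 2) : ContDiffAt ℝ 2 (e j) z :=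
  h.self_of_nhds.2.1 j

theorem differentiableAt_map (h : IsParallelFrameNear u e s z) : DifferentiableAt ℝ u z :=
  h.contDiffAt_map.differentiableAt (by norm_num)

theorem differentiableAt_frame (h : IsParallelFrameNear u e s z) (j : Fin 2) :
    DifferentiableAt ℝ (e j) z := (h.contDiffAt_frame j).differentiableAt (by norm_num)

theorem orthonormal (h : IsParallelFrameNear u e s z) : ∀ᶠ w in 𝓝 z, IsOrthonormalAt u e w :=
  h.mono fun _ hw => hw.2.2.1

theorem contDiffAt_fderiv (h : IsParallelFrameNear u e s z) (v : E) :
    ContDiffAt ℝ 2 (fun w => fderiv ℝ u w v) z :=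
  (h.contDiffAt_map.fderiv_right (m := 2) (by norm_num)).clm_apply contDiffAt_const

theorem contDiffAt_frameComp (h : IsParallelFrameNear u e s z) {X : E → Pt}
    (hX : ContDiffAt ℝ 2 X z) : ContDiffAt ℝ 2 (fun w => frameComp u e w (X w)) z := by
  have c : ∀ {f : E → Pt} (k : Fin 2), ContDiffAt ℝ 2 f z → ContDiffAt ℝ 2 (fun w => f w k) z :=
    fun k hf => contDiffAt_pi.1 hf k
  refine contDiffAt_pi.2 fun j => ?_
  simp only [frameComp, metricInner_eq]
  exact (((contDiffAt_const.mul (c 1 h.contDiffAt_map_two)).exp.mul (c 0 hX)).mul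
    (c 0 (h.contDiffAt_frame j))).add ((c 1 hX).mul (c 1 (h.contDiffAt_frame j)))

/-- One derivative of a `C³` map in a `C²` frame is `C²`, just enough for the second derivatives of
`φ_s` in the wave equation. -/
theorem contDiffAt_diffField (h : IsParallelFrameNear u e s z) (v : E) :
    ContDiffAt ℝ 2 (diffField u e v) z :=
  h.contDiffAt_frameComp (h.contDiffAt_fderiv v)

theorem differentiableAt_connMat (h : IsParallelFrameNear u e s z) (v : E) (k j : Fin 2) :
    DifferentiableAt ℝ (fun w => connMat u e v w k j) z :=
  (hasFDerivAt_metricInner h.differentiableAt_map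
    (hasFDerivAt_covAlong h.contDiffAt_map_two (h.contDiffAt_frame j) v).1
    (h.differentiableAt_frame k)).1

/-- This is the gauge condition `A_s = 0`; it turns `D_s` into the plain derivative `∂_s`. -/
theorem connMat_eq_zero (h : IsParallelFrameNear u e s z) : connMat u e s z = 0 := by
  ext k j
  simp [connMat, h.self_of_nhds.2.2.2 j, metricInner_eq]

theorem gaugeD_eq_fderiv (h : IsParallelFrameNear u e s z) (f : E → Pt) :
    gaugeD u e s f z = fderiv ℝ f z s := by
  simp [gaugeD, h.connMat_eq_zero]

theorem gaugeD_comp (h : IsParallelFrameNear u e s z) {X : E → Pt} (hX : DifferentiableAt ℝ X z)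
    (v : E) :
    gaugeD u e v (fun w => frameComp u e w (X w)) z = frameComp u e z (covAlong u X v z) :=
  gaugeD_frameComp h.orthonormal h.differentiableAt_map hX h.differentiableAt_frame v

theorem gaugeD_diffField (h : IsParallelFrameNear u e s z) (v w : E) :
    gaugeD u e v (diffField u e w) z
      = frameComp u e z (covAlong u (fun y => fderiv ℝ u y w) v z) :=
  h.gaugeD_comp ((h.contDiffAt_fderiv w).differentiableAt (by norm_num)) v

/-- Torsion-freeness reads `D_s φ_v = D_v φ_s`, and the left side is `∂_s φ_v` because `A_s = 0`. -/
theorem fderiv_diffField (h : IsParallelFrameNear u e s z) (v : E) :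
    fderiv ℝ (diffField u e v) z s = gaugeD u e v (diffField u e s) z := by
  rw [← h.gaugeD_eq_fderiv, h.gaugeD_diffField, h.gaugeD_diffField,
    covAlong_fderiv_comm h.contDiffAt_map_two]

theorem _root_.Filter.EventuallyEq.covAlong_eq {u X Y : E → Pt} {z : E} (h : X =ᶠ[𝓝 z] Y) (v : E) :
    covAlong u X v z = covAlong u Y v z := by
  funext k
  simp only [covAlong, h.fderiv_eq, h.eq_of_nhds]

theorem _root_.Filter.EventuallyEq.gaugeD_eq {u : E → Pt} {e : Fin 2 → E → Pt} {X Y : E → Pt} {z : E}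
    (h : X =ᶠ[𝓝 z] Y) (v : E) :
    gaugeD u e v X z = gaugeD u e v Y z := by
  simp only [gaugeD, h.fderiv_eq, h.eq_of_nhds]

theorem differentiableAt_gaugeD_diffField (h : IsParallelFrameNear u e s z) (v w : E) :
    DifferentiableAt ℝ (gaugeD u e v (diffField u e w)) z := by
  have h1 : gaugeD u e v (diffField u e w) =ᶠ[𝓝 z]
      fun y => frameComp u e y (covAlong u (fun y => fderiv ℝ u y w) v y) :=
    h.eventually.mono fun y hy => hy.gaugeD_diffField v w
  exact (differentiableAt_frameComp h.differentiableAt_map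
    (hasFDerivAt_covAlong h.contDiffAt_map_two (h.contDiffAt_fderiv w) v).1
    h.differentiableAt_frame).congr_of_eventuallyEq h1

theorem gaugeD_gaugeD_diffField (h : IsParallelFrameNear u e s z) (v' v w : E) :
    gaugeD u e v' (gaugeD u e v (diffField u e w)) z
      = frameComp u e z (covAlong u (covAlong u (fun y => fderiv ℝ u y w) v) v' z) := by
  have h1 : gaugeD u e v (diffField u e w) =ᶠ[𝓝 z]
      fun y => frameComp u e y (covAlong u (fun y => fderiv ℝ u y w) v y) :=
    h.eventually.mono fun y hy => hy.gaugeD_diffField v w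
  rw [h1.gaugeD_eq, h.gaugeD_comp
    (hasFDerivAt_covAlong h.contDiffAt_map_two (h.contDiffAt_fderiv w) v).1]

/-- Moving `D_s` past the outer `D_v` costs the curvature `(φ_s ∧ φ_v) φ_v`; moving it past the
inner one is free by torsion-freeness. For `v = ∂_i` this curvature term is the source of the zeroth
order wedge term of `W`. -/
theorem fderiv_gaugeD_diffField (h : IsParallelFrameNear u e s z) (v : E) :
    fderiv ℝ (gaugeD u e v (diffField u e v)) z s
      = gaugeD u e v (gaugeD u e v (diffField u e s)) z
        + wedge (diffField u e s z) (diffField u e v z) (diffField u e v z) := by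
  have h1 : covAlong u (fun y => fderiv ℝ u y v) s =ᶠ[𝓝 z] covAlong u (fun y => fderiv ℝ u y s) v :=
    h.eventually.mono fun y hy => covAlong_fderiv_comm hy.contDiffAt_map_two s v
  rw [← h.gaugeD_eq_fderiv, h.gaugeD_gaugeD_diffField, h.gaugeD_gaugeD_diffField,
    covAlong_comm h.contDiffAt_map_two (h.contDiffAt_fderiv v), frameComp_add,
    h1.covAlong_eq, h.orthonormal.self_of_nhds.frameComp_riemann]
  rfl

/-- The `s`-derivative of the connection is the curvature. -/
theorem fderiv_connMat (h : IsParallelFrameNear u e s z) (v : E) (k j : Fin 2) :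
    fderiv ℝ (fun w => connMat u e v w k j) z s
      = wedge (diffField u e s z) (diffField u e v z) (Pi.single j 1) k := by
  have h0 : covAlong u (e j) s =ᶠ[𝓝 z] fun _ => 0 :=
    h.mono fun w hw => hw.2.2.2 j
  -- The order of derivatives is chosen so that `∇_v ∇_s e_j` drops out; what is left of `∇_s ∇_v
  -- e_j` is pure curvature.
  have h1 : covAlong u (covAlong u (e j) s) v z = 0 := by
    rw [h0.covAlong_eq]
    funext k
    simp [covAlong]
  have h2 := (hasFDerivAt_metricInner h.differentiableAt_map
    (hasFDerivAt_covAlong h.contDiffAt_map_two (h.contDiffAt_frame j) v).1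
    (h.differentiableAt_frame k)).2 s
  have h3 := congr_fun (h.orthonormal.self_of_nhds.frameComp_riemann (fderiv ℝ u z s)
    (fderiv ℝ u z v) (e j z)) k
  rw [h.orthonormal.self_of_nhds.frameComp_self] at h3
  simp only [connMat, Matrix.of_apply]
  rw [h2, covAlong_comm h.contDiffAt_map_two (h.contDiffAt_frame j), h1, zero_add,
    h.self_of_nhds.2.2.2 k, metricInner_comm _ (covAlong u (e j) v z)]
  simp only [metricInner_eq (v := 0), Pi.zero_apply, mul_zero, zero_mul, add_zero]
  exact h3

/-- Expansion of `D_v D_v`. -/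
theorem gaugeD_gaugeD (h : IsParallelFrameNear u e s z) {f : E → Pt} (hf : ContDiffAt ℝ 2 f z)
    (v : E) :
    gaugeD u e v (gaugeD u e v f) z = fderiv ℝ (fun w => fderiv ℝ f w v) z v
      + (2 : ℝ) • (connMat u e v z *ᵥ fderiv ℝ f z v)
      + Matrix.of (fun k j => fderiv ℝ (fun w => connMat u e v w k j) z v) *ᵥ f z
      + connMat u e v z *ᵥ (connMat u e v z *ᵥ f z) := by
  have hf1 := hf.differentiableAt (by norm_num)
  have hA := h.differentiableAt_connMat v
  have hc : ∀ k, HasFDerivAt (fun w => gaugeD u e v f w k) _ z := fun k =>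
    (hasFDerivAt_coord (differentiableAt_fderiv_apply hf v) k).add
      ((((hA k 0).hasFDerivAt).mul (hasFDerivAt_coord hf1 0)).add
        (((hA k 1).hasFDerivAt).mul (hasFDerivAt_coord hf1 1))) |>.congr_of_eventuallyEq
          (Eventually.of_forall fun w => by
            simp only [gaugeD, Pi.add_apply, Pi.mul_apply, mulVec_two])
  have hd : DifferentiableAt ℝ (gaugeD u e v f) z :=
    differentiableAt_pi.2 fun k => (hc k).differentiableAt
  funext k
  rw [gaugeD, Pi.add_apply, ← fderiv_coord hd, (hc k).fderiv]
  simp only [gaugeD, Pi.add_apply, Pi.smul_apply, smul_eq_mul, mulVec_two, Matrix.of_apply,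
    add_apply, smul_apply, ContinuousLinearMap.comp_apply,
    ContinuousLinearMap.proj_apply]
  ring

end IsParallelFrameNear

end Parallel


/-! ### The wave equation for the heat tension field -/

section Wave

theorem isOpen_slab (T : ℝ) : IsOpen (slab T) :=
  isOpen_Ioi.prod (isOpen_Ioo.prod isOpen_univ)

theorem IsCaloricGauge.isParallelFrameNear {T : ℝ} {u : ℝ → Pt → Pt} {Q : Pt → Pt}
    {Ξ : Fin 2 → Pt → Pt} {U : SpaceTime → Pt} {Ω : Fin 2 → SpaceTime → Pt}
    (h : IsCaloricGauge T u Q Ξ U Ω) {z : SpaceTime} (hz : z ∈ slab T) :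
    IsParallelFrameNear U Ω dirS z := by
  filter_upwards [(isOpen_slab T).mem_nhds hz] with w hw
  exact ⟨h.regular_map.contDiffAt ((isOpen_slab T).mem_nhds hw),
    fun j => (h.regular_frame j).contDiffAt ((isOpen_slab T).mem_nhds hw),
    h.orthonormal w hw, h.parallel w hw⟩

/-- A slice derivative is a derivative in a coordinate direction. -/
theorem partialD_slice {F : Type*} [NormedAddCommGroup F] [NormedSpace ℝ F] {f : SpaceTime → F}
    {s t : ℝ} {x : Pt} (hf : DifferentiableAt ℝ f (s, t, x)) (i : Fin 2) :
    partialD i (fun y => f (s, t, y)) x = fderiv ℝ f (s, t, x) (dirX i) := by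
  have h1 : HasFDerivAt (fun y : Pt => ((s, t, y) : SpaceTime))
      ((ContinuousLinearMap.inr ℝ ℝ (ℝ × Pt)).comp (ContinuousLinearMap.inr ℝ ℝ Pt)) x := by
    exact (hasFDerivAt_const (𝕜 := ℝ) s x).prodMk
      ((hasFDerivAt_const (𝕜 := ℝ) t x).prodMk (hasFDerivAt_id x))
  have := (hf.hasFDerivAt.comp x h1).fderiv
  rw [partialD]
  erw [this]
  rfl

/-- The metric coefficients and Christoffel symbols in `𝔚` depend on `x` only, so `∂_s` passes
through them. -/
theorem fderiv_space_smul {c : Pt → ℝ} {f : SpaceTime → Pt} {z : SpaceTime}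
    (hc : DifferentiableAt ℝ c z.2.2) (hf : DifferentiableAt ℝ f z) :
    DifferentiableAt ℝ (fun w => c w.2.2 • f w) z ∧
    fderiv ℝ (fun w => c w.2.2 • f w) z dirS = c z.2.2 • fderiv ℝ f z dirS := by
  have h1 : HasFDerivAt (fun w : SpaceTime => c w.2.2) _ z :=
    hc.hasFDerivAt.comp z ((hasFDerivAt_snd (𝕜 := ℝ) (E := ℝ) (F := Pt)).comp z
      (hasFDerivAt_snd (𝕜 := ℝ) (E := ℝ) (F := ℝ × Pt)))
  have h2 := h1.smul hf.hasFDerivAt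
  refine ⟨h2.differentiableAt, ?_⟩
  erw [h2.fderiv]
  simp [dirS]

theorem differentiable_metricInv (i : Fin 2) : Differentiable ℝ fun x : Pt => metricInv x i := by
  fin_cases i
  · simp [metricInv]
    fun_prop
  · simp [metricInv]

theorem differentiable_christoffel (k i j : Fin 2) :
    Differentiable ℝ fun x : Pt => christoffel x k i j := by
  fin_cases k <;> fin_cases i <;> fin_cases j <;> simp
  fun_prop

variable {U : SpaceTime → Pt} {Ω : Fin 2 → SpaceTime → Pt}

theorem IsParallelFrameNear.fderiv_waveTension {z : SpaceTime}
    (h : IsParallelFrameNear U Ω dirS z) :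
    fderiv ℝ (waveTension U Ω) z dirS
      = fderiv ℝ (gaugeD U Ω dirT (phiT U Ω)) z dirS
        - ∑ i, metricInv z.2.2 i • fderiv ℝ (gaugeD U Ω (dirX i) (diffField U Ω (dirX i))) z dirS
        + ∑ i, metricInv z.2.2 i • ∑ k, christoffel z.2.2 k i i
          • fderiv ℝ (diffField U Ω (dirX k)) z dirS := by
  have h1 := h.differentiableAt_gaugeD_diffField dirT dirT
  have h2 := fun i : Fin 2 => fderiv_space_smul (differentiable_metricInv i z.2.2)
    (h.differentiableAt_gaugeD_diffField (dirX i) (dirX i))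
  have h3 := fun i k : Fin 2 => fderiv_space_smul (differentiable_christoffel k i i z.2.2)
    ((h.contDiffAt_diffField (dirX k)).differentiableAt (by norm_num))
  have h3' := fun i : Fin 2 => (h3 i 0).1.add (h3 i 1).1
  have h4 := fun i : Fin 2 => fderiv_space_smul (differentiable_metricInv i z.2.2) (h3' i)
  have e : waveTension U Ω = (gaugeD U Ω dirT (diffField U Ω dirT)
      - ((fun w => metricInv w.2.2 0 • gaugeD U Ω (dirX 0) (diffField U Ω (dirX 0)) w)
        + fun w => metricInv w.2.2 1 • gaugeD U Ω (dirX 1) (diffField U Ω (dirX 1)) w))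
      + ((fun w => metricInv w.2.2 0 • ((fun w => christoffel w.2.2 0 0 0 • diffField U Ω (dirX 0) w)
            + fun w => christoffel w.2.2 1 0 0 • diffField U Ω (dirX 1) w) w)
        + fun w => metricInv w.2.2 1 • ((fun w => christoffel w.2.2 0 1 1 • diffField U Ω (dirX 0) w)
            + fun w => christoffel w.2.2 1 1 1 • diffField U Ω (dirX 1) w) w) := by
    funext w
    simp only [waveTension, Fin.sum_univ_two, Pi.add_apply, Pi.sub_apply]
    rfl
  rw [e, fderiv_add (h1.sub ((h2 0).1.add (h2 1).1)) ((h4 0).1.add (h4 1).1),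
    fderiv_sub h1 ((h2 0).1.add (h2 1).1), fderiv_add (h2 0).1 (h2 1).1,
    fderiv_add (h4 0).1 (h4 1).1]
  simp only [add_apply, sub_apply, (h2 0).2, (h2 1).2,
    (h4 0).2, (h4 1).2]
  rw [fderiv_add (h3 0 0).1 (h3 0 1).1, fderiv_add (h3 1 0).1 (h3 1 1).1]
  simp only [add_apply, (h3 0 0).2, (h3 0 1).2, (h3 1 0).2, (h3 1 1).2,
    Fin.sum_univ_two]
  rfl

theorem IsCaloricGauge.lap_phiS {T : ℝ} {u : ℝ → Pt → Pt} {Q : Pt → Pt}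
    {Ξ : Fin 2 → Pt → Pt} (h : IsCaloricGauge T u Q Ξ U Ω) {z : SpaceTime} (hz : z ∈ slab T) :
    lap (fun y => phiS U Ω (z.1, z.2.1, y)) z.2.2
      = ∑ i, metricInv z.2.2 i •
        (fderiv ℝ (fun w => fderiv ℝ (phiS U Ω) w (dirX i)) z (dirX i)
          - ∑ k, christoffel z.2.2 k i i • fderiv ℝ (phiS U Ω) z (dirX k)) := by
  have hs : ∀ y, (z.1, z.2.1, y) ∈ slab T := fun y => ⟨hz.1, hz.2.1, mem_univ _⟩
  have h2 : ∀ y, ContDiffAt ℝ 2 (phiS U Ω) (z.1, z.2.1, y) := fun y =>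
    (h.isParallelFrameNear (hs y)).contDiffAt_diffField dirS
  have h1 : ∀ i, partialD i (fun y => phiS U Ω (z.1, z.2.1, y))
      = fun y => fderiv ℝ (phiS U Ω) (z.1, z.2.1, y) (dirX i) := fun i => by
    funext y
    exact partialD_slice ((h2 y).differentiableAt (by norm_num)) i
  simp only [lap, h1]
  refine Finset.sum_congr rfl fun i _ => ?_
  have := partialD_slice (f := fun w => fderiv ℝ (phiS U Ω) w (dirX i))
    (differentiableAt_fderiv_apply (h2 z.2.2) (dirX i)) i
  rw [this]

/-! ### The fields of a map in the frame `Θ` -/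

/-- The scalar coefficient `a_i = e^{-Q₂} ∂_i Q₁` of the limit connection. -/
noncomputable def connScalar (Q : Pt → Pt) (i : Fin 2) (x : Pt) : ℝ :=
  Real.exp (-Q x 1) * partialD i Q x 0

theorem hasFDerivAt_Theta_zero {E : Type*} [NormedAddCommGroup E] [NormedSpace ℝ E] {u : E → Pt}
    {x : E} (hu : DifferentiableAt ℝ u x) :
    HasFDerivAt (fun y => Theta (u y) 0) (ContinuousLinearMap.pi
      ![Real.exp (u x 1) • (ContinuousLinearMap.proj 1 : Pt →L[ℝ] ℝ).comp (fderiv ℝ u x), 0]) x := by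
  refine hasFDerivAt_pi.2 fun k => ?_
  fin_cases k
  · exact (hasFDerivAt_coord hu 1).exp
  · exact hasFDerivAt_const _ _

theorem Theta_one (y : Pt) : Theta y 1 = ![0, 1] := rfl

theorem differentiableAt_Theta {E : Type*} [NormedAddCommGroup E] [NormedSpace ℝ E] {u : E → Pt}
    {x : E} (hu : DifferentiableAt ℝ u x) (j : Fin 2) :
    DifferentiableAt ℝ (fun y => Theta (u y) j) x := by
  fin_cases j
  · exact (hasFDerivAt_Theta_zero hu).differentiableAt
  · exact differentiableAt_const _

/-- The connection of the frame `Θ(u)`. -/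
theorem connMat_Theta {E : Type*} [NormedAddCommGroup E] [NormedSpace ℝ E] {u : E → Pt}
    {x : E} (hu : DifferentiableAt ℝ u x) (v : E) :
    connMat u (fun j y => Theta (u y) j) v x
      = !![0, -(Real.exp (-u x 1) * fderiv ℝ u x v 0); Real.exp (-u x 1) * fderiv ℝ u x v 0, 0] := by
  have h0 : fderiv ℝ (fun y => Theta (u y) 0) x v = ![Real.exp (u x 1) * fderiv ℝ u x v 1, 0] := by
    rw [(hasFDerivAt_Theta_zero hu).fderiv]
    funext k
    fin_cases k <;> simp
  have h1 : fderiv ℝ (fun y => Theta (u y) 1) x v = 0 := by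
    simp only [Theta_one]; simp
  have e1 : Real.exp (-2 * u x 1) * Real.exp (u x 1) = Real.exp (-u x 1) := by
    rw [← Real.exp_add]; ring_nf
  ext k j
  simp only [connMat, Matrix.of_apply, metricInner_eq]
  fin_cases k <;> fin_cases j <;>
    simp only [Fin.zero_eta, Fin.mk_one, covAlong_zero, covAlong_one, h0, h1] <;>
    simp [Theta] <;> (try simp only [neg_mul] at e1)
  · ring
  · linear_combination (fderiv ℝ u x v 0) * e1
  · linear_combination (fderiv ℝ u x v 0) * e1

theorem connInf_eq {Q : Pt → Pt} {x : Pt} (hQ : DifferentiableAt ℝ Q x) (i : Fin 2) :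
    connInf Q i x = !![0, -connScalar Q i x; connScalar Q i x, 0] :=
  connMat_Theta hQ _

theorem phiInf_eq (Q : Pt → Pt) (i : Fin 2) (x : Pt) :
    phiInf Q i x = ![connScalar Q i x, partialD i Q x 1] := by
  have e1 : Real.exp (-2 * Q x 1) * Real.exp (Q x 1) = Real.exp (-Q x 1) := by
    rw [← Real.exp_add]; ring_nf
  funext k
  simp only [phiInf, diffField, frameComp, metricInner_eq, connScalar, partialD]
  fin_cases k
  · simp [limitFrame, Theta]
    simp only [neg_mul] at e1
    linear_combination (fderiv ℝ Q x (Pi.single i 1) 0) * e1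
  · simp [limitFrame, Theta]

theorem contDiff_partialD {F : Type*} [NormedAddCommGroup F] [NormedSpace ℝ F] {f : Pt → F}
    (hf : ContDiff ℝ ∞ f) (i : Fin 2) : ContDiff ℝ ∞ (partialD i f) :=
  (hf.fderiv_right (by simp)).clm_apply contDiff_const

theorem contDiff_connScalar {Q : Pt → Pt} (hQ : ContDiff ℝ ∞ Q) (i : Fin 2) :
    ContDiff ℝ ∞ (connScalar Q i) :=
  (contDiff_pi.1 hQ 1).neg.exp.mul (contDiff_pi.1 (contDiff_partialD hQ i) 0)

theorem contDiff_connInf {Q : Pt → Pt} (hQ : ContDiff ℝ ∞ Q) (i k j : Fin 2) :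
    ContDiff ℝ ∞ fun y => connInf Q i y k j := by
  have h := contDiff_connScalar hQ i
  have e : ∀ y, connInf Q i y = _ := fun y => connInf_eq (hQ.differentiable (by norm_num) y) i
  simp only [e]
  fin_cases k <;> fin_cases j <;> simp
  · exact contDiff_const
  · exact h.neg
  · exact h
  · exact contDiff_const

/-- The divergence is linear in the connection, so the remainder contributes the divergence of the
full connection minus that of the limit; the latter joins `W`. -/
theorem IsCaloricGauge.divConn_connCon {T : ℝ} {u : ℝ → Pt → Pt} {Q : Pt → Pt}
    {Ξ : Fin 2 → Pt → Pt} (h : IsCaloricGauge T u Q Ξ U Ω) (hQ : ContDiff ℝ ∞ Q)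
    {z : SpaceTime} (hz : z ∈ slab T) :
    divConn (fun i y => connCon Q U Ω i (z.1, z.2.1, y)) z.2.2
      = ∑ i, metricInv z.2.2 i •
        (Matrix.of (fun k j => fderiv ℝ (fun w => connMat U Ω (dirX i) w k j) z (dirX i))
          - ∑ l, christoffel z.2.2 l i i • connMat U Ω (dirX l) z) - divConn (connInf Q) z.2.2 := by
  have hp := h.isParallelFrameNear hz
  have e : ∀ i k j, partialD i (fun y => connCon Q U Ω i (z.1, z.2.1, y) k j) z.2.2
      = fderiv ℝ (fun w => connMat U Ω (dirX i) w k j) z (dirX i)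
        - partialD i (fun y => connInf Q i y k j) z.2.2 := by
    intro i k j
    have d1 : DifferentiableAt ℝ (fun w => connMat U Ω (dirX i) w k j) (z.1, z.2.1, z.2.2) :=
      hp.differentiableAt_connMat (dirX i) k j
    have d2 : DifferentiableAt ℝ (fun y => connInf Q i y k j) z.2.2 :=
      (contDiff_connInf hQ i k j).differentiable (by norm_num) _
    have d1' : DifferentiableAt ℝ (fun y : Pt => connMat U Ω (dirX i) (z.1, z.2.1, y) k j) z.2.2 :=
      d1.comp (f := fun y : Pt => ((z.1, z.2.1, y) : SpaceTime)) z.2.2 (by fun_prop)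
    have := partialD_slice d1 i
    rw [← this]
    simp only [partialD, connCon, Matrix.sub_apply]
    rw [fderiv_fun_sub d1' d2]
    rfl
  simp only [divConn, e]
  ext k j
  simp only [connCon, Fin.sum_univ_two, Matrix.sub_apply, Matrix.add_apply, Matrix.smul_apply,
    Matrix.of_apply, smul_eq_mul]
  ring

/-- Commuting `∂_s` into `𝔚` gives `∂_s 𝔚 = D_t D_t φ_s + (φ_s ∧ φ_t) φ_t - h^{ii} (D_i D_i φ_s +
(φ_s ∧ φ_i) φ_i) + h^{ii} Γ^k_{ii} D_k φ_s`. The curvature term `R(∂_t U, ∂_s U) ∂_t U` equals `(φ_t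
∧ φ_s) φ_t` and cancels the second summand. -/
theorem IsCaloricGauge.wave_equation {T : ℝ} {u : ℝ → Pt → Pt} {Q : Pt → Pt}
    {Ξ : Fin 2 → Pt → Pt} (h : IsCaloricGauge T u Q Ξ U Ω) (hQ : ContDiff ℝ ∞ Q)
    {z : SpaceTime} (hz : z ∈ slab T) :
    fderiv ℝ (fun w => fderiv ℝ (phiS U Ω) w dirT) z dirT
      - lap (fun y => phiS U Ω (z.1, z.2.1, y)) z.2.2
      + magneticW Q (fun y => phiS U Ω (z.1, z.2.1, y)) z.2.2 = masterRHS Q U Ω z := by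
  have hp := h.isParallelFrameNear hz
  have hφ := hp.contDiffAt_diffField dirS
  have hx : ∀ i, partialD i (fun y => phiS U Ω (z.1, z.2.1, y)) z.2.2
      = fderiv ℝ (phiS U Ω) z (dirX i) := fun i =>
    partialD_slice (hφ.differentiableAt (by norm_num)) i
  have hW := hp.fderiv_waveTension
  have hR := hp.orthonormal.self_of_nhds.frameComp_riemann (fderiv ℝ U z dirT) (fderiv ℝ U z dirS)
    (fderiv ℝ U z dirT)
  have hG := fun v => hp.fderiv_gaugeD_diffField v
  have hD := fun v => hp.fderiv_diffField v
  have hE := fun v => hp.gaugeD_gaugeD hφ v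
  have hA : ∀ i, connMat U Ω (dirX i) z = connCon Q U Ω i z + connInf Q i z.2.2 := fun i => by
    simp [connCon]
  have hF : ∀ i, diffField U Ω (dirX i) z = phiCon Q U Ω i z + phiInf Q i z.2.2 := fun i => by
    simp [phiCon]
  have hz' : phiS U Ω (z.1, z.2.1, z.2.2) = phiS U Ω z := rfl
  have ht : phiT U Ω = diffField U Ω dirT := rfl
  have hs : diffField U Ω dirS = phiS U Ω := rfl
  simp only [hs] at hG hD hE
  rw [masterRHS, hR, hW, h.lap_phiS hz, h.divConn_connCon hQ hz, magneticW, ht]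
  simp only [hx, hG, hD, hE, hz']
  have hft : frameComp U Ω z (fderiv ℝ U z dirT) = diffField U Ω dirT z := rfl
  have hfs : frameComp U Ω z (fderiv ℝ U z dirS) = phiS U Ω z := rfl
  rw [hft, hfs]
  simp only [gaugeD, hA, hF]
  -- Every derivative has now been expressed through the same atoms, and the rest is polynomial
  -- algebra in the components.
  generalize phiS U Ω z = φ
  generalize diffField U Ω dirT z = φt
  generalize connMat U Ω dirT z = At
  funext k
  simp only [matAct, wedge, Fin.sum_univ_two, Pi.add_apply, Pi.sub_apply, Pi.smul_apply,
    Pi.neg_apply, smul_eq_mul, mulVec_two, Matrix.add_apply, Matrix.sub_apply, Matrix.smul_apply,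
    Matrix.of_apply, Matrix.map_apply, dotProduct, Pi.star_apply, star_trivial, neg_smul,
    Algebra.algebraMap_self, RingHom.id_apply]
  ring

end Wave

/-! ### Limits in heat time -/

/-- A family of functions whose derivative in the parameter is dominated converges, with
continuous limit. -/
theorem exists_limit_of_dominated_deriv {f f' : ℝ → ℝ → ℝ} {b : ℝ → ℝ} {s r : ℝ}
    (hb : IntegrableOn b (Ioi s))
    (hd : ∀ κ, s ≤ κ → ∀ τ, HasDerivAt (fun κ => f κ τ) (f' κ τ) κ)
    (hc : Continuous (f s)) (hc1 : ∀ τ, ContinuousOn (fun κ => f' κ τ) (Ioi s))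
    (hc2 : ∀ κ, s < κ → Continuous (f' κ))
    (hbd : ∀ κ, s < κ → ∀ τ ∈ Icc (-r) r, |f' κ τ| ≤ b κ) :
    ∃ g : ℝ → ℝ, ContinuousOn g (Icc (-r) r) ∧
      (∃ M, ∀ κ, s ≤ κ → ∀ τ ∈ Icc (-r) r, |f κ τ| ≤ M) ∧
      ∀ τ ∈ Icc (-r) r, Tendsto (fun κ => f κ τ) atTop (𝓝 (g τ)) ∧
        ∫ κ in Ioi s, f' κ τ = g τ - f s τ := by
  have hmeas : ∀ τ, AEStronglyMeasurable (fun κ => f' κ τ) (volume.restrict (Ioi s)) :=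
    fun τ => (hc1 τ).aestronglyMeasurable measurableSet_Ioi
  have hbd' : ∀ τ ∈ Icc (-r) r, ∀ᵐ κ ∂volume.restrict (Ioi s), ‖f' κ τ‖ ≤ b κ := fun τ hτ =>
    (ae_restrict_iff' measurableSet_Ioi).2 (Eventually.of_forall fun κ hκ => hbd κ hκ τ hτ)
  have hint : ∀ τ ∈ Icc (-r) r, IntegrableOn (fun κ => f' κ τ) (Ioi s) := fun τ hτ =>
    hb.mono' (hmeas τ) (hbd' τ hτ)
  have hlim : ∀ τ ∈ Icc (-r) r,
      Tendsto (fun κ => f κ τ) atTop (𝓝 (f s τ + ∫ κ in Ioi s, f' κ τ)) := by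
    intro τ hτ
    have h1 := tendsto_limUnder_of_hasDerivAt_of_integrableOn_Ioi (a := s)
      (fun κ hκ => hd κ (le_of_lt hκ) τ) (hint τ hτ)
    have h2 := integral_Ioi_of_hasDerivAt_of_tendsto' (fun κ hκ => hd κ hκ τ) (hint τ hτ) h1
    rw [h2]
    simpa using h1
  -- Written as initial value plus integral, the limit inherits continuity in the parameter from
  -- dominated convergence.
  refine ⟨fun τ => f s τ + ∫ κ in Ioi s, f' κ τ, ?_, ?_, fun τ hτ => ⟨hlim τ hτ, by ring⟩⟩
  · refine hc.continuousOn.add ?_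
    refine continuousOn_of_dominated (bound := b) (fun τ _ => hmeas τ) hbd' hb ?_
    exact (ae_restrict_iff' measurableSet_Ioi).2
      (Eventually.of_forall fun κ hκ => (hc2 κ hκ).continuousOn)
  · obtain ⟨M, hM⟩ := isCompact_Icc.exists_bound_of_continuousOn (hc.continuousOn (s := Icc (-r) r))
    -- The bound is the maximum at time `s` plus the total variation allowed by `b`.
    refine ⟨M + ∫ κ in Ioi s, b κ, fun κ hκ τ hτ => ?_⟩
    have hsub : Ioc s κ ⊆ Ioi s := fun y hy => hy.1
    have e : ∫ y in s..κ, f' y τ = f κ τ - f s τ := by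
      refine intervalIntegral.integral_eq_sub_of_hasDerivAt (fun y hy => hd y ?_ τ) ?_
      · rw [uIcc_of_le hκ] at hy; exact hy.1
      · rw [intervalIntegrable_iff_integrableOn_Ioc_of_le hκ]
        exact (hint τ hτ).mono_set hsub
    have e2 : |∫ y in s..κ, f' y τ| ≤ ∫ κ in Ioi s, b κ := by
      rw [intervalIntegral.integral_of_le hκ]
      have h3 : ‖∫ y in Ioc s κ, f' y τ‖ ≤ ∫ y in Ioc s κ, b y := by
        refine norm_integral_le_of_norm_le (hb.mono_set hsub) ?_
        exact ae_restrict_of_ae_restrict_of_subset hsub (hbd' τ hτ)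
      refine h3.trans (setIntegral_mono_set hb ?_ hsub.eventuallyLE)
      filter_upwards [hbd' τ hτ] with y hy using (norm_nonneg _).trans hy
    have := hM τ hτ
    rw [Real.norm_eq_abs] at this
    have e3 : f κ τ = f s τ + ∫ y in s..κ, f' y τ := by rw [e]; ring
    rw [e3]
    exact (abs_add_le _ _).trans (add_le_add this e2)

/-- Pointwise limits of functions with bounded, pointwise convergent derivatives. -/
theorem hasDerivAt_of_tendsto_of_bounded {F F' : ℝ → ℝ → ℝ} {G g : ℝ → ℝ} {κ₀ r M : ℝ} (hr : 0 < r)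
    (hd : ∀ κ, κ₀ ≤ κ → ∀ τ, HasDerivAt (F κ) (F' κ τ) τ)
    (hc : ∀ κ, κ₀ ≤ κ → Continuous (F' κ))
    (hM : ∀ κ, κ₀ ≤ κ → ∀ τ ∈ Icc (-r) r, |F' κ τ| ≤ M)
    (hF : ∀ τ ∈ Icc (-r) r, Tendsto (fun κ => F κ τ) atTop (𝓝 (G τ)))
    (hF' : ∀ τ ∈ Icc (-r) r, Tendsto (fun κ => F' κ τ) atTop (𝓝 (g τ)))
    (hg : ContinuousOn g (Icc (-r) r)) : HasDerivAt G (g 0) 0 := by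
  have h0 : (0 : ℝ) ∈ Icc (-r) r := ⟨by linarith, hr.le⟩
  -- Bounded convergence passes to the limit in `F κ τ - F κ 0 = ∫ F' κ`, so `G` is a primitive of
  -- the continuous function `g` near `0`.
  have key : ∀ τ ∈ Icc (-r) r, G τ = G 0 + ∫ y in (0 : ℝ)..τ, g y := by
    intro τ hτ
    have hsub : uIoc 0 τ ⊆ Icc (-r) r := uIoc_subset_uIcc.trans (uIcc_subset_Icc h0 hτ)
    have h1 : Tendsto (fun κ => ∫ y in (0 : ℝ)..τ, F' κ y) atTop (𝓝 (∫ y in (0 : ℝ)..τ, g y)) := by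
      refine intervalIntegral.tendsto_integral_filter_of_dominated_convergence (fun _ => M) ?_ ?_
        intervalIntegrable_const ?_
      · filter_upwards [eventually_ge_atTop κ₀] with κ hκ using (hc κ hκ).aestronglyMeasurable
      · filter_upwards [eventually_ge_atTop κ₀] with κ hκ
        exact Eventually.of_forall fun y hy => hM κ hκ y (hsub hy)
      · exact Eventually.of_forall fun y hy => hF' y (hsub hy)
    have h2 : Tendsto (fun κ => F κ τ - F κ 0) atTop (𝓝 (∫ y in (0 : ℝ)..τ, g y)) := by
      refine h1.congr' ?_
      filter_upwards [eventually_ge_atTop κ₀] with κ hκ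
      exact intervalIntegral.integral_eq_sub_of_hasDerivAt (fun y _ => hd κ hκ y)
        ((hc κ hκ).intervalIntegrable _ _)
    have := tendsto_nhds_unique h2 ((hF τ hτ).sub (hF 0 h0))
    linarith
  have hnhds : Icc (-r) r ∈ 𝓝 (0 : ℝ) := Icc_mem_nhds (by linarith) hr
  have h3 : HasDerivAt (fun τ => G 0 + ∫ y in (0 : ℝ)..τ, g y) (g 0) 0 := by
    refine (intervalIntegral.integral_hasDerivAt_right IntervalIntegrable.refl ?_
      (hg.continuousAt hnhds)).const_add _
    exact ⟨Icc (-r) r, hnhds, hg.aestronglyMeasurable measurableSet_Icc⟩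
  refine h3.congr_of_eventuallyEq ?_
  filter_upwards [hnhds] with τ hτ using key τ hτ

theorem isOrthonormalAt_Theta {E : Type*} (u : E → Pt) (z : E) :
    IsOrthonormalAt u (fun j w => Theta (u w) j) z := by
  have e : Real.exp (-(2 * u z 1)) * Real.exp (u z 1) * Real.exp (u z 1) = 1 := by
    rw [← Real.exp_add, ← Real.exp_add, Real.exp_eq_one_iff]; ring
  intro i j
  fin_cases i <;> fin_cases j <;> simp [metricInner_eq, Theta, e]

/-! ### Comparison of the frames `Ω` and `Θ` -/

section Line

variable {U : SpaceTime → Pt} {Ω : Fin 2 → SpaceTime → Pt} {z : SpaceTime}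

/-- The matrix comparing the frame `Ω` with `Θ`. -/
noncomputable def frameMat (U : SpaceTime → Pt) (Ω : Fin 2 → SpaceTime → Pt) (z : SpaceTime)
    (j l : Fin 2) : ℝ := metricInner (U z) (Ω j z) (Theta (U z) l)

/-- Each row lists the components of a unit vector in an orthonormal frame. -/
theorem IsOrthonormalAt.abs_frameMat_le (h : IsOrthonormalAt U Ω z) (j l : Fin 2) :
    |frameMat U Ω z j l| ≤ 1 := by
  have h1 := (isOrthonormalAt_Theta U z).parseval (Ω j z) (Ω j z)
  rw [h j j] at h1
  simp only [if_true, Fin.sum_univ_two, frameComp] at h1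
  have h2 : frameMat U Ω z j l ^ 2 ≤ 1 := by
    fin_cases l <;> simp only [frameMat, Fin.zero_eta, Fin.mk_one] <;>
      nlinarith [sq_nonneg (metricInner (U z) (Ω j z) (Theta (U z) 0)),
        sq_nonneg (metricInner (U z) (Ω j z) (Theta (U z) 1))]
  exact (sq_le_one_iff_abs_le_one _).1 h2

/-- The components of `∂_v U` in the frame `Θ`. -/
theorem IsOrthonormalAt.metricInner_Theta (h : IsOrthonormalAt U Ω z) (X : Pt) (l : Fin 2) :
    metricInner (U z) X (Theta (U z) l)
      = frameMat U Ω z 0 l * frameComp U Ω z X 0 + frameMat U Ω z 1 l * frameComp U Ω z X 1 := by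
  rw [h.parseval]
  simp only [Fin.sum_univ_two, frameMat, frameComp]
  rw [metricInner_comm _ (Ω 0 z) (Theta _ _), metricInner_comm _ (Ω 1 z) (Theta _ _)]
  ring

/-- This and the next identity recover the coordinate derivatives of `U` from `φ_v` and the bounded
comparison matrix, so that convergence of `φ_i` becomes convergence of `∂_i U`. -/
theorem IsParallelFrameNear.fderiv_map_one (h : IsParallelFrameNear U Ω dirS z) (v : SpaceTime) :
    fderiv ℝ U z v 1 = frameMat U Ω z 0 1 * diffField U Ω v z 0
      + frameMat U Ω z 1 1 * diffField U Ω v z 1 := by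
  have := h.orthonormal.self_of_nhds.metricInner_Theta (fderiv ℝ U z v) 1
  rw [metricInner_eq] at this
  simpa [Theta, diffField] using this

theorem IsParallelFrameNear.fderiv_map_zero (h : IsParallelFrameNear U Ω dirS z) (v : SpaceTime) :
    fderiv ℝ U z v 0 = Real.exp (U z 1) * (frameMat U Ω z 0 0 * diffField U Ω v z 0
      + frameMat U Ω z 1 0 * diffField U Ω v z 1) := by
  have := h.orthonormal.self_of_nhds.metricInner_Theta (fderiv ℝ U z v) 0
  have e : Real.exp (U z 1) * (Real.exp (-(2 * U z 1)) * Real.exp (U z 1)) = 1 := by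
    rw [← Real.exp_add, ← Real.exp_add, Real.exp_eq_one_iff]; ring
  rw [metricInner_eq] at this
  simp only [Theta, neg_mul, Matrix.cons_val_zero, Matrix.cons_val_one, mul_zero, add_zero] at this
  simp only [diffField]
  rw [← this]
  linear_combination (-fderiv ℝ U z v 0) * e

theorem IsParallelFrameNear.differentiableAt_frameMat (h : IsParallelFrameNear U Ω dirS z)
    (j l : Fin 2) : DifferentiableAt ℝ (fun w => frameMat U Ω w j l) z :=
  (hasFDerivAt_metricInner h.differentiableAt_map (h.differentiableAt_frame j)
    (differentiableAt_Theta h.differentiableAt_map l)).1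

/-- By the Leibniz rule `∂_v ⟨Ω_j, Θ_l⟩` has one part from the connection of `Ω` and one from that
of `Θ`. The latter is the infinitesimal rotation times `e^{-U₂} ∂_v U₁`, here written through `φ_v`.
In the limit this equation determines `lim A_i` from `lim φ_i`. -/
theorem IsParallelFrameNear.fderiv_frameMat (h : IsParallelFrameNear U Ω dirS z) (v : SpaceTime)
    (j l : Fin 2) :
    fderiv ℝ (fun w => frameMat U Ω w j l) z v
      = frameMat U Ω z 0 l * connMat U Ω v z 0 j + frameMat U Ω z 1 l * connMat U Ω v z 1 j
        + (frameMat U Ω z 0 0 * diffField U Ω v z 0 + frameMat U Ω z 1 0 * diffField U Ω v z 1)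
          * (frameMat U Ω z j 0 * (!![0, -1; 1, 0] : Matrix (Fin 2) (Fin 2) ℝ) 0 l
            + frameMat U Ω z j 1 * (!![0, -1; 1, 0] : Matrix (Fin 2) (Fin 2) ℝ) 1 l) := by
  have h1 := (hasFDerivAt_metricInner h.differentiableAt_map (h.differentiableAt_frame j)
    (differentiableAt_Theta h.differentiableAt_map l)).2 v
  have h2 := connMat_Theta h.differentiableAt_map v
  have e : Real.exp (-U z 1) * fderiv ℝ U z v 0 = frameMat U Ω z 0 0 * diffField U Ω v z 0
      + frameMat U Ω z 1 0 * diffField U Ω v z 1 := by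
    rw [h.fderiv_map_zero, ← mul_assoc, ← Real.exp_add]; simp
  rw [e] at h2
  have h3 : ∀ k, metricInner (U z) (covAlong U (fun y => Theta (U y) l) v z) (Theta (U z) k)
      = (frameMat U Ω z 0 0 * diffField U Ω v z 0 + frameMat U Ω z 1 0 * diffField U Ω v z 1) *
        (!![0, -1; 1, 0] : Matrix (Fin 2) (Fin 2) ℝ) k l := by
    intro k
    have := congr_fun (congr_fun h2 k) l
    simp only [connMat, Matrix.of_apply] at this
    rw [this]
    fin_cases k <;> fin_cases l <;> simp
  unfold frameMat at *
  rw [h1, h.orthonormal.self_of_nhds.metricInner_Theta,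
    (isOrthonormalAt_Theta U z).parseval (Ω j z)]
  simp only [Fin.sum_univ_two]
  simp only [frameComp, h3]
  simp only [connMat, Matrix.of_apply, frameMat]
  ring

end Line


/-! ### The heat-time integrals of `A^con` and `φ^con` -/

section HeatTime

/-- The point `(κ, t, x + τ e_i)`. -/
def coordLine (t : ℝ) (x : Pt) (i : Fin 2) (κ τ : ℝ) : SpaceTime :=
  (κ, t, x + τ • Pi.single i 1)

theorem coordLine_zero (t : ℝ) (x : Pt) (i : Fin 2) (κ : ℝ) : coordLine t x i κ 0 = (κ, t, x) := by
  simp [coordLine]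

variable {F : Type*} [NormedAddCommGroup F] [NormedSpace ℝ F] {f : SpaceTime → F} {t κ τ : ℝ}
  {x : Pt} {i : Fin 2}

theorem hasDerivAt_coordLine_left (hf : DifferentiableAt ℝ f (coordLine t x i κ τ)) :
    HasDerivAt (fun κ => f (coordLine t x i κ τ)) (fderiv ℝ f (coordLine t x i κ τ) dirS) κ := by
  have h : HasDerivAt (fun κ => coordLine t x i κ τ) dirS κ :=
    (hasDerivAt_id κ).prodMk ((hasDerivAt_const κ t).prodMk (hasDerivAt_const κ _))
  exact hf.hasFDerivAt.comp_hasDerivAt κ h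

theorem hasDerivAt_coordLine_right (hf : DifferentiableAt ℝ f (coordLine t x i κ τ)) :
    HasDerivAt (fun τ => f (coordLine t x i κ τ)) (fderiv ℝ f (coordLine t x i κ τ) (dirX i)) τ := by
  have h1 : HasDerivAt (fun τ : ℝ => x + τ • (Pi.single i 1 : Pt)) (Pi.single i 1) τ := by
    simpa using ((hasDerivAt_id τ).smul_const (Pi.single i 1 : Pt)).const_add x
  have h : HasDerivAt (fun τ => coordLine t x i κ τ) (dirX i) τ :=
    (hasDerivAt_const τ κ).prodMk ((hasDerivAt_const τ t).prodMk h1)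
  exact hf.hasFDerivAt.comp_hasDerivAt τ h

theorem continuous_coordLine_left : Continuous fun κ => coordLine t x i κ τ := by
  unfold coordLine; fun_prop

theorem continuous_coordLine_right : Continuous fun τ => coordLine t x i κ τ := by
  unfold coordLine; fun_prop

variable {U : SpaceTime → Pt} {Ω : Fin 2 → SpaceTime → Pt}

theorem IsParallelFrameNear.continuousAt_diffField {z : SpaceTime}
    (h : IsParallelFrameNear U Ω dirS z) (v : SpaceTime) (k : Fin 2) :
    ContinuousAt (fun w => diffField U Ω v w k) z :=
  continuousAt_pi.1 (h.contDiffAt_diffField v).continuousAt k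

theorem IsParallelFrameNear.continuousAt_wedge {z : SpaceTime}
    (h : IsParallelFrameNear U Ω dirS z) (v : SpaceTime) (c : Pt) (k : Fin 2) :
    ContinuousAt (fun w => wedge (phiS U Ω w) (diffField U Ω v w) c k) z := by
  have h1 := h.continuousAt_diffField dirS
  have h2 := h.continuousAt_diffField v
  simp only [wedge, dotProduct, Fin.sum_univ_two, Pi.sub_apply, Pi.smul_apply, smul_eq_mul, phiS,
    Pi.star_apply, star_trivial]
  exact ((((h1 0).mul continuousAt_const).add ((h1 1).mul continuousAt_const)).mul (h2 k)).sub
    ((((h2 0).mul continuousAt_const).add ((h2 1).mul continuousAt_const)).mul (h1 k))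

theorem IsParallelFrameNear.continuousAt_fderiv_diffField {z : SpaceTime}
    (h : IsParallelFrameNear U Ω dirS z) (v w : SpaceTime) (k : Fin 2) :
    ContinuousAt (fun y => fderiv ℝ (diffField U Ω v) y w k) z :=
  continuousAt_pi.1
    (differentiableAt_fderiv_apply (h.contDiffAt_diffField v) w).continuousAt k

/-- The work lies in the boundary terms at `s = ∞`: the gauge controls only limits of
undifferentiated quantities. Everything is restricted to a short coordinate segment through `x` on
which one integrable function dominates, and limits are differentiated along that segment. -/
theorem IsCaloricGauge.heat_time_integrals {T : ℝ} {u : ℝ → Pt → Pt} {Q : Pt → Pt}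
    (h : IsCaloricGauge T u Q (limitFrame Q) U Ω) (hQ : ContDiff ℝ ∞ Q) {s t : ℝ} (hs : 0 < s)
    (ht : t ∈ Ioo 0 T) (hdom : HeatTimeDominated U Ω s t) (x : Pt) (i k : Fin 2) :
    (∀ j : Fin 2, connCon Q U Ω i (s, t, x) k j
      = -∫ κ in Ioi s, wedge (phiS U Ω (κ, t, x))
          (diffField U Ω (dirX i) (κ, t, x)) (Pi.single j 1) k) ∧
    phiCon Q U Ω i (s, t, x) k
      = -∫ κ in Ioi s, fderiv ℝ (diffField U Ω (dirX i)) (κ, t, x) dirS k := by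
  obtain ⟨V, hV, b, hb, hbd⟩ := hdom x
  have hline : Continuous fun τ : ℝ => x + τ • (Pi.single i 1 : Pt) := by fun_prop
  obtain ⟨r, hr, hrV⟩ : ∃ r : ℝ, 0 < r ∧ ∀ τ ∈ Icc (-r) r, x + τ • (Pi.single i 1 : Pt) ∈ V := by
    have h1 : (fun τ : ℝ => x + τ • (Pi.single i 1 : Pt)) ⁻¹' V ∈ 𝓝 (0 : ℝ) :=
      hline.continuousAt.preimage_mem_nhds (by simpa using hV)
    obtain ⟨r, hr, hr'⟩ := Metric.nhds_basis_closedBall.mem_iff.1 h1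
    exact ⟨r, hr, fun τ hτ => hr' (by rw [Real.closedBall_eq_Icc]; simpa using hτ)⟩
  have h0 : (0 : ℝ) ∈ Icc (-r) r := ⟨by linarith, hr.le⟩
  have hP : ∀ κ, s ≤ κ → ∀ τ, IsParallelFrameNear U Ω dirS (coordLine t x i κ τ) :=
    fun κ hκ τ => h.isParallelFrameNear ⟨hs.trans_le hκ, ht, mem_univ _⟩
  -- the fields along the line converge, with continuous limits
  have hφ := fun k : Fin 2 => exists_limit_of_dominated_deriv (r := r)
    (f := fun κ τ => diffField U Ω (dirX i) (coordLine t x i κ τ) k)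
    (f' := fun κ τ => fderiv ℝ (diffField U Ω (dirX i)) (coordLine t x i κ τ) dirS k) hb
    (fun κ hκ τ => by
      have := hasDerivAt_coordLine_left (((hP κ hκ τ).contDiffAt_diffField (dirX i)).differentiableAt
        (by norm_num))
      exact hasDerivAt_pi.1 this k)
    (continuous_iff_continuousAt.2 fun τ => ContinuousAt.comp (f := coordLine t x i s)
      ((hP s le_rfl τ).continuousAt_diffField (dirX i) k) continuous_coordLine_right.continuousAt)
    (fun τ κ hκ => (ContinuousAt.comp (f := fun κ => coordLine t x i κ τ)
      ((hP κ (le_of_lt hκ) τ).continuousAt_fderiv_diffField (dirX i) dirS k)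
      continuous_coordLine_left.continuousAt).continuousWithinAt)
    (fun κ hκ => continuous_iff_continuousAt.2 fun τ => ContinuousAt.comp (f := coordLine t x i κ)
      ((hP κ hκ.le τ).continuousAt_fderiv_diffField (dirX i) dirS k)
      continuous_coordLine_right.continuousAt)
    (fun κ hκ τ hτ => (hbd κ hκ _ (hrV τ hτ) i k).2)
  have hA := fun k j : Fin 2 => exists_limit_of_dominated_deriv (r := r)
    (f := fun κ τ => connMat U Ω (dirX i) (coordLine t x i κ τ) k j)
    (f' := fun κ τ => wedge (phiS U Ω (coordLine t x i κ τ))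
      (diffField U Ω (dirX i) (coordLine t x i κ τ)) (Pi.single j 1) k) hb
    (fun κ hκ τ => by
      have := hasDerivAt_coordLine_left ((hP κ hκ τ).differentiableAt_connMat (dirX i) k j)
      rw [(hP κ hκ τ).fderiv_connMat] at this
      exact this)
    (continuous_iff_continuousAt.2 fun τ => ContinuousAt.comp (f := coordLine t x i s)
      ((hP s le_rfl τ).differentiableAt_connMat (dirX i) k j).continuousAt
      continuous_coordLine_right.continuousAt)
    (fun τ κ hκ => (ContinuousAt.comp (f := fun κ => coordLine t x i κ τ)
      ((hP κ (le_of_lt hκ) τ).continuousAt_wedge (dirX i) (Pi.single j 1) k)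
      continuous_coordLine_left.continuousAt).continuousWithinAt)
    (fun κ hκ => continuous_iff_continuousAt.2 fun τ => ContinuousAt.comp (f := coordLine t x i κ)
      ((hP κ hκ.le τ).continuousAt_wedge (dirX i) (Pi.single j 1) k)
      continuous_coordLine_right.continuousAt)
    (fun κ hκ τ hτ => (hbd κ hκ _ (hrV τ hτ) i k).1 j)
  choose g hgc hgM hgl using hφ
  choose Mg hMg using hgM
  choose B hBc hBM hBl using hA
  choose MB hMB using hBM
  have hφc : ∀ κ, s ≤ κ → ∀ k, Continuous fun τ => diffField U Ω (dirX i) (coordLine t x i κ τ) k :=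
    fun κ hκ k => continuous_iff_continuousAt.2 fun τ => ContinuousAt.comp (f := coordLine t x i κ)
      ((hP κ hκ τ).continuousAt_diffField (dirX i) k) continuous_coordLine_right.continuousAt
  have hAc : ∀ κ, s ≤ κ → ∀ k j, Continuous fun τ => connMat U Ω (dirX i) (coordLine t x i κ τ) k j :=
    fun κ hκ k j => continuous_iff_continuousAt.2 fun τ => ContinuousAt.comp (f := coordLine t x i κ)
      ((hP κ hκ τ).differentiableAt_connMat (dirX i) k j).continuousAt
      continuous_coordLine_right.continuousAt
  have hOc : ∀ κ, s ≤ κ → ∀ j l, Continuous fun τ => frameMat U Ω (coordLine t x i κ τ) j l :=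
    fun κ hκ k j => continuous_iff_continuousAt.2 fun τ => ContinuousAt.comp (f := coordLine t x i κ)
      ((hP κ hκ τ).differentiableAt_frameMat k j).continuousAt
      continuous_coordLine_right.continuousAt
  -- The limit frame is `Θ(Q)` itself, so the comparison matrix tends to the identity.
  have hOl : ∀ τ j l, Tendsto (fun κ => frameMat U Ω (coordLine t x i κ τ) j l) atTop
      (𝓝 (if j = l then 1 else 0)) := fun τ j l => by
    have := h.limit_frame t ht (x + τ • Pi.single i 1) j l
    rwa [show limitFrame Q j (x + τ • Pi.single i 1) = Theta (Q (x + τ • Pi.single i 1)) j from rfl,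
      isOrthonormalAt_Theta Q (x + τ • Pi.single i 1) j l] at this
  have hO1 : ∀ κ, s ≤ κ → ∀ τ j l, |frameMat U Ω (coordLine t x i κ τ) j l| ≤ 1 :=
    fun κ hκ τ => (hP κ hκ τ).orthonormal.self_of_nhds.abs_frameMat_le
  have hUl : ∀ τ k, Tendsto (fun κ => U (coordLine t x i κ τ) k) atTop
      (𝓝 (Q (x + τ • Pi.single i 1) k)) := fun τ k =>
    tendsto_pi_nhds.1 (h.limit_map t ht (x + τ • Pi.single i 1)) k
  -- components of `∂_i U` in the frame `Θ`
  set c : Fin 2 → ℝ → ℝ → ℝ := fun l κ τ =>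
    frameMat U Ω (coordLine t x i κ τ) 0 l * diffField U Ω (dirX i) (coordLine t x i κ τ) 0
      + frameMat U Ω (coordLine t x i κ τ) 1 l * diffField U Ω (dirX i) (coordLine t x i κ τ) 1 with hcdef
  have hcc : ∀ κ, s ≤ κ → ∀ l, Continuous (c l κ) := fun κ hκ l =>
    ((hOc κ hκ 0 l).mul (hφc κ hκ 0)).add ((hOc κ hκ 1 l).mul (hφc κ hκ 1))
  have hcM : ∀ κ, s ≤ κ → ∀ τ ∈ Icc (-r) r, ∀ l, |c l κ τ| ≤ Mg 0 + Mg 1 := by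
    intro κ hκ τ hτ l
    refine (abs_add_le _ _).trans (add_le_add ?_ ?_) <;> rw [abs_mul]
    · exact (mul_le_of_le_one_left (abs_nonneg _) (hO1 κ hκ τ 0 l)).trans (hMg 0 κ hκ τ hτ)
    · exact (mul_le_of_le_one_left (abs_nonneg _) (hO1 κ hκ τ 1 l)).trans (hMg 1 κ hκ τ hτ)
  -- As the comparison matrix tends to the identity, components in `Θ` and in `Ω` share their
  -- limits.
  have hcl : ∀ τ ∈ Icc (-r) r, ∀ l, Tendsto (fun κ => c l κ τ) atTop (𝓝 (g l τ)) := by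
    intro τ hτ l
    have := ((hOl τ 0 l).mul (hgl 0 τ hτ).1).add ((hOl τ 1 l).mul (hgl 1 τ hτ).1)
    fin_cases l <;> simpa using this
  have hU1 : ∀ κ, s ≤ κ → ∀ τ, HasDerivAt (fun τ => U (coordLine t x i κ τ) 1) (c 1 κ τ) τ := by
    intro κ hκ τ
    have := hasDerivAt_pi.1 (hasDerivAt_coordLine_right (hP κ hκ τ).differentiableAt_map) 1
    rwa [(hP κ hκ τ).fderiv_map_one] at this
  have hU0 : ∀ κ, s ≤ κ → ∀ τ, HasDerivAt (fun τ => U (coordLine t x i κ τ) 0)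
      (Real.exp (U (coordLine t x i κ τ) 1) * c 0 κ τ) τ := by
    intro κ hκ τ
    have := hasDerivAt_pi.1 (hasDerivAt_coordLine_right (hP κ hκ τ).differentiableAt_map) 0
    rwa [(hP κ hκ τ).fderiv_map_zero] at this
  have hQd : ∀ k, HasDerivAt (fun τ : ℝ => Q (x + τ • Pi.single i 1) k) (partialD i Q x k) 0 := by
    intro k
    have h1 : HasDerivAt (fun τ : ℝ => x + τ • (Pi.single i 1 : Pt)) (Pi.single i 1) 0 := by
      simpa using ((hasDerivAt_id (0 : ℝ)).smul_const (Pi.single i 1 : Pt)).const_add x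
    have h2 : HasFDerivAt Q (fderiv ℝ Q x) (x + (0 : ℝ) • (Pi.single i 1 : Pt)) := by
      simpa using (hQ.differentiable (by norm_num) x).hasFDerivAt
    exact hasDerivAt_pi.1 (h2.comp_hasDerivAt (0 : ℝ) h1) k
  -- The second coordinate comes first: its derivative carries no weight `e^{U₂}`, whereas the first
  -- coordinate needs a bound on `U₂` to be dominated.
  have hg1 : g 1 0 = partialD i Q x 1 :=
    (hasDerivAt_of_tendsto_of_bounded hr hU1 (fun κ hκ => hcc κ hκ 1)
      (fun κ hκ τ hτ => hcM κ hκ τ hτ 1) (fun τ _ => hUl τ 1) (fun τ hτ => hcl τ hτ 1)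
      (hgc 1)).unique (hQd 1)
  -- a bound for `U₂` along the line
  obtain ⟨κ₁, hκ₁, hU1M⟩ : ∃ κ₁, s ≤ κ₁ ∧ ∀ κ, κ₁ ≤ κ → ∀ τ ∈ Icc (-r) r,
      U (coordLine t x i κ τ) 1 ≤ Q x 1 + 1 + (Mg 0 + Mg 1) * r := by
    have h1 := (hUl 0 1).eventually (gt_mem_nhds (lt_add_one _))
    obtain ⟨κ₁, hκ₁⟩ := eventually_atTop.1 h1
    refine ⟨max s κ₁, le_max_left _ _, fun κ hκ τ hτ => ?_⟩
    have h2 := hκ₁ κ ((le_max_right _ _).trans hκ)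
    have hsκ := (le_max_left _ _).trans hκ
    -- Convergence at the midpoint of the segment and a uniform bound for the derivative bound `U₂`
    -- on the whole segment, for all late heat times.
    have h3 := (convex_Icc (-r) r).norm_image_sub_le_of_norm_hasDerivWithin_le
      (fun y _ => (hU1 κ hsκ y).hasDerivWithinAt) (fun y hy => hcM κ hsκ y hy 1) h0 hτ
    have h4 : |τ| ≤ r := abs_le.2 hτ
    have h5 : 0 ≤ Mg 0 + Mg 1 := (abs_nonneg _).trans (hcM s le_rfl 0 h0 1)
    rw [Real.norm_eq_abs, Real.norm_eq_abs, sub_zero] at h3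
    have h6 := (le_abs_self _).trans (h3.trans (mul_le_mul_of_nonneg_left h4 h5))
    simp only [zero_smul, add_zero] at h2
    linarith
  have hg0 : Real.exp (Q x 1) * g 0 0 = partialD i Q x 0 := by
    have := (hasDerivAt_of_tendsto_of_bounded (κ₀ := κ₁)
      (M := Real.exp (Q x 1 + 1 + (Mg 0 + Mg 1) * r) * (Mg 0 + Mg 1)) hr
      (fun κ hκ => hU0 κ (hκ₁.trans hκ))
      (fun κ hκ => ((Real.continuous_exp.comp (continuous_iff_continuousAt.2 fun τ =>
        (hU1 κ (hκ₁.trans hκ) τ).continuousAt))).mul (hcc κ (hκ₁.trans hκ) 0))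
      (fun κ hκ τ hτ => by
        rw [abs_mul, Real.abs_exp]
        exact mul_le_mul (Real.exp_le_exp.2 (hU1M κ hκ τ hτ)) (hcM κ (hκ₁.trans hκ) τ hτ 0)
          (abs_nonneg _) (Real.exp_pos _).le)
      (fun τ _ => hUl τ 0)
      (fun τ hτ => ((Real.continuous_exp.tendsto _).comp (hUl τ 1)).mul (hcl τ hτ 0))
      ((Real.continuous_exp.comp (((continuous_apply 1).comp hQ.continuous).comp hline)).continuousOn.mul
        (hgc 0))).unique (hQd 0)
    simpa using this
  have hg0' : g 0 0 = connScalar Q i x := by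
    rw [connScalar, ← hg0, ← mul_assoc, ← Real.exp_add]; simp
  have hφlim : ∀ k, g k 0 = phiInf Q i x k := by
    intro k
    rw [phiInf_eq]
    fin_cases k
    · exact hg0'
    · exact hg1
  -- the limit of the connection
  have hBlim : ∀ k j, B k j 0 = connInf Q i x k j := by
    intro k j
    -- The comparison matrix converges to a constant, so the limit of its derivative vanishes. With
    -- `J` the rotation matrix this reads `B k j + g 0 0 * J j k = 0`, which is solved for the limit
    -- connection `B`.
    have key := (hasDerivAt_of_tendsto_of_bounded (κ₀ := s) (r := r)
      (F := fun κ τ => frameMat U Ω (coordLine t x i κ τ) j k)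
      (G := fun _ => if j = k then 1 else 0)
      (M := MB 0 j + MB 1 j + (Mg 0 + Mg 1) * 2)
      (g := fun τ => (if (0 : Fin 2) = k then 1 else 0) * B 0 j τ
        + (if (1 : Fin 2) = k then 1 else 0) * B 1 j τ
        + g 0 τ * ((if j = 0 then 1 else 0) * (!![0, -1; 1, 0] : Matrix (Fin 2) (Fin 2) ℝ) 0 k
          + (if j = 1 then 1 else 0) * (!![0, -1; 1, 0] : Matrix (Fin 2) (Fin 2) ℝ) 1 k)) hr
      (fun κ hκ τ => by
        have := hasDerivAt_coordLine_right ((hP κ hκ τ).differentiableAt_frameMat j k)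
        rw [(hP κ hκ τ).fderiv_frameMat] at this
        exact this)
      (fun κ hκ => (((hOc κ hκ 0 k).mul (hAc κ hκ 0 j)).add ((hOc κ hκ 1 k).mul (hAc κ hκ 1 j))).add
        ((hcc κ hκ 0).mul (((hOc κ hκ j 0).mul continuous_const).add
          ((hOc κ hκ j 1).mul continuous_const))))
      (fun κ hκ τ hτ => by
        have hJ : ∀ a, |(!![0, -1; 1, 0] : Matrix (Fin 2) (Fin 2) ℝ) a k| ≤ 1 := by
          intro a; fin_cases a <;> fin_cases k <;> simp
        have hO := hO1 κ hκ τ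
        have e1 : ∀ a, |frameMat U Ω (coordLine t x i κ τ) a k
            * connMat U Ω (dirX i) (coordLine t x i κ τ) a j| ≤ MB a j := fun a => by
          rw [abs_mul]
          exact (mul_le_of_le_one_left (abs_nonneg _) (hO a k)).trans (hMB a j κ hκ τ hτ)
        have e2 : ∀ a, |frameMat U Ω (coordLine t x i κ τ) j a
            * (!![0, -1; 1, 0] : Matrix (Fin 2) (Fin 2) ℝ) a k| ≤ 1 := fun a => by
          rw [abs_mul]
          exact mul_le_one₀ (hO j a) (abs_nonneg _) (hJ a)
        have hcM0 := hcM κ hκ τ hτ 0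
        refine (abs_add_le _ _).trans (add_le_add ((abs_add_le _ _).trans
          (add_le_add (e1 0) (e1 1))) ?_)
        change |c 0 κ τ * (frameMat U Ω (coordLine t x i κ τ) j 0
            * (!![0, -1; 1, 0] : Matrix (Fin 2) (Fin 2) ℝ) 0 k
          + frameMat U Ω (coordLine t x i κ τ) j 1
            * (!![0, -1; 1, 0] : Matrix (Fin 2) (Fin 2) ℝ) 1 k)| ≤ _
        rw [abs_mul]
        refine mul_le_mul hcM0 ((abs_add_le _ _).trans ?_) (abs_nonneg _)
          ((abs_nonneg _).trans hcM0)
        linarith [e2 0, e2 1])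
      (fun τ _ => hOl τ j k)
      (fun τ hτ => (((hOl τ 0 k).mul (hBl 0 j τ hτ).1).add ((hOl τ 1 k).mul (hBl 1 j τ hτ).1)).add
        ((hcl τ hτ 0).mul (((hOl τ j 0).mul tendsto_const_nhds).add
          ((hOl τ j 1).mul tendsto_const_nhds))))
      (((continuousOn_const.mul (hBc 0 j)).add (continuousOn_const.mul (hBc 1 j))).add
        ((hgc 0).mul continuousOn_const))).unique (hasDerivAt_const (0 : ℝ) _)
    rw [connInf_eq (hQ.differentiable (by norm_num) x), ← hg0']
    fin_cases k <;> fin_cases j <;> simp at key ⊢ <;> linarith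
  constructor
  · intro j
    have := (hBl k j 0 h0).2
    simp only [coordLine_zero] at this
    rw [this, hBlim, connCon]
    simp
  · have := (hgl k 0 h0).2
    simp only [coordLine_zero] at this
    rw [this, hφlim, phiCon]
    simp

end HeatTime

/-! ### A Kato–Rellich theorem -/

section KatoRellich

variable {V E : Type*} [NormedAddCommGroup E]

theorem exists_seq_of_mem_closure_range {ι A : V → E} {p : E × E}
    (hp : p ∈ closure (range fun ψ => (ι ψ, A ψ))) :
    ∃ ψ : ℕ → V, Tendsto (fun n => ι (ψ n)) atTop (𝓝 p.1) ∧
      Tendsto (fun n => A (ψ n)) atTop (𝓝 p.2) := by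
  obtain ⟨x, hx, hlim⟩ := mem_closure_iff_seq_limit.1 hp
  choose ψ hψ using hx
  refine ⟨ψ, ?_, ?_⟩
  · have := (continuous_fst.tendsto p).comp hlim
    refine this.congr fun n => ?_
    simp [← hψ n]
  · have := (continuous_snd.tendsto p).comp hlim
    refine this.congr fun n => ?_
    simp [← hψ n]

theorem mem_closure_range_of_tendsto {ι A : V → E} {p : E × E} {ψ : ℕ → V}
    (h1 : Tendsto (fun n => ι (ψ n)) atTop (𝓝 p.1)) (h2 : Tendsto (fun n => A (ψ n)) atTop (𝓝 p.2)) :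
    p ∈ closure (range fun ψ => (ι ψ, A ψ)) :=
  mem_closure_of_tendsto (h1.prodMk_nhds h2) (Eventually.of_forall fun n => ⟨ψ n, rfl⟩)

variable [InnerProductSpace ℂ E]

theorem eq_zero_of_inner_eq_zero {f : V → E} (hf : DenseRange f) {v : E}
    (h : ∀ ψ, ⟪f ψ, v⟫_ℂ = 0) : v = 0 := by
  have : ∀ x, ⟪x, v⟫_ℂ = 0 := by
    have hc : IsClosed {x : E | ⟪x, v⟫_ℂ = 0} :=
      isClosed_eq (by fun_prop) continuous_const
    intro x
    have := closure_minimal (range_subset_iff.2 h) hc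
    exact this (hf x)
  exact inner_self_eq_zero.1 (this v)

variable [AddCommGroup V] [Module ℂ V]

theorem cauchySeq_of_norm_le {ι A B : V →ₗ[ℂ] E} {K : ℝ}
    (h : ∀ ψ, ‖B ψ‖ ≤ K * (‖ι ψ‖ + ‖A ψ‖)) {ψ : ℕ → V}
    (h1 : CauchySeq fun n => ι (ψ n)) (h2 : CauchySeq fun n => A (ψ n)) :
    CauchySeq fun n => B (ψ n) := by
  rw [cauchySeq_iff_tendsto_dist_atTop_0] at *
  have h3 := (h1.add h2).const_mul K
  simp only [add_zero, mul_zero] at h3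
  refine squeeze_zero (fun _ => dist_nonneg) (fun p => ?_) h3
  simp only [dist_eq_norm, ← map_sub]
  exact h _

/-- A relatively bounded perturbation does not change the domain of the closure. -/
theorem exists_mem_closure_of_norm_le [CompleteSpace E] {ι A B : V →ₗ[ℂ] E} {K : ℝ}
    (h : ∀ ψ, ‖B ψ‖ ≤ K * (‖ι ψ‖ + ‖A ψ‖)) {p : E × E}
    (hp : p ∈ closure (range fun ψ => (ι ψ, A ψ))) :
    ∃ w, (p.1, w) ∈ closure (range fun ψ => (ι ψ, A ψ + B ψ)) := by
  obtain ⟨ψ, h1, h2⟩ := exists_seq_of_mem_closure_range hp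
  obtain ⟨w, hw⟩ := cauchySeq_tendsto_of_complete (cauchySeq_of_norm_le h h1.cauchySeq h2.cauchySeq)
  exact ⟨p.2 + w, mem_closure_range_of_tendsto (A := fun ψ => A ψ + B ψ) h1 (h2.add hw)⟩

/-- Cauchy–Schwarz for `⟨ιψ, (A + l) ψ⟩` gives both bounds. The second controls the quadratic form,
in terms of which the perturbation will be measured. -/
theorem norm_le_of_nonneg {ι A : V →ₗ[ℂ] E} (hA : ∀ ψ, 0 ≤ (⟪ι ψ, A ψ⟫_ℂ).re) {l : ℝ} (hl : 0 < l)
    (ψ : V) : l * ‖ι ψ‖ ≤ ‖A ψ + (l : ℂ) • ι ψ‖ ∧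
      l * (⟪ι ψ, A ψ⟫_ℂ).re ≤ ‖A ψ + (l : ℂ) • ι ψ‖ ^ 2 := by
  have h1 : (⟪ι ψ, A ψ⟫_ℂ).re + l * ‖ι ψ‖ ^ 2 ≤ ‖ι ψ‖ * ‖A ψ + (l : ℂ) • ι ψ‖ := by
    have := (Complex.re_le_norm _).trans (norm_inner_le_norm (𝕜 := ℂ) (ι ψ) (A ψ + (l : ℂ) • ι ψ))
    rw [inner_add_right, inner_smul_right, inner_self_eq_norm_sq_to_K, Complex.add_re,
      Complex.re_ofReal_mul] at this
    norm_cast at this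
  have h2 := hA ψ
  set a := ‖ι ψ‖
  set y := ‖A ψ + (l : ℂ) • ι ψ‖
  have ha : 0 ≤ a := norm_nonneg _
  have hy : 0 ≤ y := norm_nonneg _
  have h3 : l * a ≤ y := by
    rcases ha.eq_or_lt with h | h
    · rw [← h]; simpa using hy
    · have : (l * a) * a ≤ y * a := by nlinarith
      exact le_of_mul_le_mul_right this h
  refine ⟨h3, ?_⟩
  have h4 : (⟪ι ψ, A ψ⟫_ℂ).re ≤ a * y := by nlinarith [mul_nonneg hl.le (sq_nonneg a)]
  nlinarith [mul_le_mul_of_nonneg_left h4 hl.le, mul_le_mul_of_nonneg_right h3 hy]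

/-- Solvability of `(A + l) u = h` in the closure. -/
theorem exists_resolvent [CompleteSpace E] {ι A : V →ₗ[ℂ] E} (hA : ∀ ψ, 0 ≤ (⟪ι ψ, A ψ⟫_ℂ).re)
    {l : ℝ} (hl : 0 < l) (hd : DenseRange fun ψ => A ψ + (l : ℂ) • ι ψ) (h : E) :
    ∃ p ∈ closure (range fun ψ => (ι ψ, A ψ)), p.2 + (l : ℂ) • p.1 = h := by
  obtain ⟨x, hx, hlim⟩ := mem_closure_iff_seq_limit.1 (hd h)
  choose ψ hψ using hx
  have hlim' : Tendsto (fun n => A (ψ n) + (l : ℂ) • ι (ψ n)) atTop (𝓝 h) :=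
    hlim.congr fun n => (hψ n).symm
  have h1 : CauchySeq fun n => ι (ψ n) := by
    -- Here the norm of `ιψ` is controlled by that of `(A + l) ψ` alone, hence the zero map in the
    -- first slot.
    refine cauchySeq_of_norm_le (ι := 0) (A := A + (l : ℂ) • ι) (B := ι) (K := l⁻¹) (fun χ => ?_)
      (ψ := ψ) ?_ hlim'.cauchySeq
    · have := (norm_le_of_nonneg hA hl χ).1
      rw [inv_mul_eq_div, le_div_iff₀ hl]
      simpa [mul_comm] using this
    · exact tendsto_const_nhds.cauchySeq (x := (0 : E))
  obtain ⟨u, hu⟩ := cauchySeq_tendsto_of_complete h1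
  refine ⟨(u, h - (l : ℂ) • u), mem_closure_range_of_tendsto hu ?_, by simp⟩
  refine (hlim'.sub (hu.const_smul (l : ℂ))).congr fun n => by simp

theorem denseRange_of_inner_eq_zero [CompleteSpace E] (A : V →ₗ[ℂ] E)
    (h : ∀ v, (∀ ψ, ⟪A ψ, v⟫_ℂ = 0) → v = 0) : DenseRange A := by
  have h1 : (LinearMap.range A).topologicalClosure = ⊤ := by
    rw [Submodule.topologicalClosure_eq_top_iff, Submodule.eq_bot_iff]
    intro v hv
    exact h v fun ψ => (Submodule.mem_orthogonal _ _).1 hv _ ⟨ψ, rfl⟩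
  have h2 := Submodule.dense_iff_topologicalClosure_eq_top.2 h1
  rwa [LinearMap.coe_range] at h2

/-- Let `T ≥ 0` and `T + P ≥ δ > 0` be symmetric on the core `ι V`, with `P` relatively form bounded,
and `T + l` of dense range for all `l > 0`. Then the closure of `T + P` is self-adjoint and has the
domain of the adjoint of `T`. -/
theorem exists_isSelfAdjoint_closure [CompleteSpace E] (ι T P : V →ₗ[ℂ] E) (hι : DenseRange ι)
    (hT : ∀ ψ χ, ⟪T ψ, ι χ⟫_ℂ = ⟪ι ψ, T χ⟫_ℂ)
    (hL : ∀ ψ χ, ⟪T ψ + P ψ, ι χ⟫_ℂ = ⟪ι ψ, T χ + P χ⟫_ℂ)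
    (hTpos : ∀ ψ, 0 ≤ (⟪ι ψ, T ψ⟫_ℂ).re) {δ : ℝ} (hδ : 0 < δ)
    (hLpos : ∀ ψ, δ * ‖ι ψ‖ ^ 2 ≤ (⟪ι ψ, T ψ + P ψ⟫_ℂ).re) {C : ℝ} (hC : 0 ≤ C)
    (hP : ∀ ψ, ‖P ψ‖ ^ 2 ≤ C * ((⟪ι ψ, T ψ⟫_ℂ).re + ‖ι ψ‖ ^ 2))
    (hR : ∀ l : ℝ, 0 < l → DenseRange fun ψ => T ψ + (l : ℂ) • ι ψ) :
    ∃ H : E →ₗ.[ℂ] E, (H.graph : Set (E × E)) = closure (range fun ψ => (ι ψ, T ψ + P ψ)) ∧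
      IsSelfAdjoint H ∧ (H.domain : Set E) = {f | ∃ g, ∀ ψ, ⟪T ψ, f⟫_ℂ = ⟪ι ψ, g⟫_ℂ} ∧
      ∀ f : H.domain, δ * ‖(f : E)‖ ^ 2 ≤ (⟪(f : E), H f⟫_ℂ).re := by
  set L : V →ₗ[ℂ] E := T + P with hLdef
  have hLapp : ∀ ψ, T ψ + P ψ = L ψ := fun ψ => rfl
  simp only [hLapp] at *
  have hLnn : ∀ ψ, 0 ≤ (⟪ι ψ, L ψ⟫_ℂ).re := fun ψ =>
    (mul_nonneg hδ.le (sq_nonneg _)).trans (hLpos ψ)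
  -- relative bounds
  have hTle : ∀ ψ, (⟪ι ψ, T ψ⟫_ℂ).re ≤ ‖ι ψ‖ * ‖T ψ‖ := fun ψ =>
    (Complex.re_le_norm _).trans (norm_inner_le_norm _ _)
  -- Form boundedness gives operator boundedness relative to `T`, because the form is at most `‖ιψ‖
  -- ‖Tψ‖`.
  have hPT : ∀ ψ, ‖P ψ‖ ≤ (C + 1) * (‖ι ψ‖ + ‖T ψ‖) := by
    intro ψ
    have h1 := hP ψ
    have h2 := hTle ψ
    have ha := norm_nonneg (ι ψ)
    have hb := norm_nonneg (T ψ)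
    refine abs_le_of_sq_le_sq' ?_ (by positivity) |>.2
    have h3 : (⟪ι ψ, T ψ⟫_ℂ).re + ‖ι ψ‖ ^ 2 ≤ (‖ι ψ‖ + ‖T ψ‖) ^ 2 := by nlinarith
    calc ‖P ψ‖ ^ 2 ≤ C * (‖ι ψ‖ + ‖T ψ‖) ^ 2 := h1.trans (mul_le_mul_of_nonneg_left h3 hC)
      _ ≤ (C + 1) ^ 2 * (‖ι ψ‖ + ‖T ψ‖) ^ 2 :=
        mul_le_mul_of_nonneg_right (by nlinarith) (sq_nonneg _)
      _ = _ := by ring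
  have hPL : ∀ ψ, ‖(-P) ψ‖ ≤ (2 * C + 1) * (‖ι ψ‖ + ‖L ψ‖) := by
    intro ψ
    rw [LinearMap.neg_apply, norm_neg]
    have h1 := hP ψ
    have h2 := hTle ψ
    have h3 : ‖T ψ‖ ≤ ‖L ψ‖ + ‖P ψ‖ := by
      have : T ψ = L ψ - P ψ := by simp [hLdef]
      rw [this]; exact norm_sub_le _ _
    have ha := norm_nonneg (ι ψ)
    have hb := norm_nonneg (L ψ)
    have hc := norm_nonneg (P ψ)
    refine abs_le_of_sq_le_sq' ?_ (by positivity) |>.2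
    set a := ‖ι ψ‖
    set b := ‖L ψ‖
    set c := ‖P ψ‖
    have h4 : c ^ 2 ≤ C * (a * (b + c) + a ^ 2) :=
      h1.trans (mul_le_mul_of_nonneg_left (by nlinarith) hC)
    -- Replacing `T` by `L - P` puts `C a c` on the right; it is absorbed by `2 C a c ≤ c² + C² a²`.
    have h5 : c ^ 2 ≤ 2 * C * (a * b + a ^ 2) + C ^ 2 * a ^ 2 := by
      nlinarith [sq_nonneg (c - C * a)]
    have h6 : a * b + a ^ 2 ≤ (a + b) ^ 2 := by nlinarith
    have h7 : a ^ 2 ≤ (a + b) ^ 2 := by nlinarith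
    nlinarith [mul_le_mul_of_nonneg_left h6 hC, mul_le_mul_of_nonneg_left h7 (sq_nonneg C),
      mul_nonneg hC (sq_nonneg (a + b)), mul_nonneg (sq_nonneg C) (sq_nonneg (a + b)),
      sq_nonneg (a + b)]
  -- dense range of `L + l` for large `l`
  set l : ℝ := 8 * C + 1 with hl
  have hl0 : 0 < l := by positivity
  have hRL : DenseRange fun ψ => L ψ + (l : ℂ) • ι ψ := by
    refine denseRange_of_inner_eq_zero (L + (l : ℂ) • ι) fun v hv => ?_
    have hsmall : ∀ ψ, ‖P ψ‖ ≤ (1 / 2) * ‖T ψ + (l : ℂ) • ι ψ‖ := by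
      intro ψ
      obtain ⟨h1, h2⟩ := norm_le_of_nonneg hTpos hl0 ψ
      have h3 := hP ψ
      set y := ‖T ψ + (l : ℂ) • ι ψ‖
      have hy : 0 ≤ y := norm_nonneg _
      have ha := norm_nonneg (ι ψ)
      refine abs_le_of_sq_le_sq' ?_ (by positivity) |>.2
      have h4 : l * ‖ι ψ‖ ^ 2 ≤ y ^ 2 := by
        have : (l * ‖ι ψ‖) ^ 2 ≤ y ^ 2 := pow_le_pow_left₀ (by positivity) h1 2
        have h5 : l * ‖ι ψ‖ ^ 2 ≤ l ^ 2 * ‖ι ψ‖ ^ 2 :=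
          mul_le_mul_of_nonneg_right (by nlinarith) (sq_nonneg _)
        nlinarith
      have h5 : l * ((⟪ι ψ, T ψ⟫_ℂ).re + ‖ι ψ‖ ^ 2) ≤ 2 * y ^ 2 := by linarith
      have h6 : 8 * C * ((⟪ι ψ, T ψ⟫_ℂ).re + ‖ι ψ‖ ^ 2) ≤ 2 * y ^ 2 := by
        have := add_nonneg (hTpos ψ) (sq_nonneg ‖ι ψ‖)
        nlinarith
      nlinarith
    obtain ⟨x, hx, hlim⟩ := mem_closure_iff_seq_limit.1 (hR l hl0 v)
    choose ψ hψ using hx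
    have hlim' : Tendsto (fun n => T (ψ n) + (l : ℂ) • ι (ψ n)) atTop (𝓝 v) :=
      hlim.congr fun n => (hψ n).symm
    -- If `v` is orthogonal to the range of `L + l`, pairing with `(T + l) ψ_n` equals minus pairing
    -- with `P ψ_n`. As `(T + l) ψ_n → v`, this gives `‖v‖² ≤ ‖v‖² / 2`.
    have h1 : ∀ n, ‖⟪T (ψ n) + (l : ℂ) • ι (ψ n), v⟫_ℂ‖
        ≤ (1 / 2) * ‖T (ψ n) + (l : ℂ) • ι (ψ n)‖ * ‖v‖ := by
      intro n
      have e : ⟪T (ψ n) + (l : ℂ) • ι (ψ n), v⟫_ℂ = -⟪P (ψ n), v⟫_ℂ := by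
        have := hv (ψ n)
        rw [LinearMap.add_apply, hLdef, LinearMap.add_apply, add_right_comm, inner_add_left] at this
        exact eq_neg_of_add_eq_zero_left this
      rw [e, norm_neg]
      exact (norm_inner_le_norm _ _).trans (mul_le_mul_of_nonneg_right (hsmall _) (norm_nonneg _))
    have h2 := le_of_tendsto_of_tendsto' (hlim'.inner tendsto_const_nhds).norm
      ((hlim'.norm.const_mul (1 / 2)).mul_const ‖v‖) h1
    rw [inner_self_eq_norm_sq_to_K] at h2
    simp only [norm_pow] at h2
    norm_num at h2
    have : ‖v‖ ^ 2 ≤ 0 := by nlinarith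
    exact norm_eq_zero.1 (pow_eq_zero_iff two_ne_zero |>.1 (le_antisymm this (sq_nonneg _)))
  -- the closure
  set S : Submodule ℂ (E × E) := (LinearMap.range (ι.prod L)).topologicalClosure with hS
  have hScoe : (S : Set (E × E)) = closure (range fun ψ => (ι ψ, L ψ)) := by
    rw [hS, Submodule.topologicalClosure_coe]; rfl
  have hmem : ∀ {p}, p ∈ S ↔ p ∈ closure (range fun ψ => (ι ψ, L ψ)) := by
    intro p; rw [← hScoe]; rfl
  have hsymm1 : ∀ p ∈ S, ∀ ψ, ⟪L ψ, p.1⟫_ℂ = ⟪ι ψ, p.2⟫_ℂ := by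
    intro p hp ψ
    obtain ⟨χ, h1, h2⟩ := exists_seq_of_mem_closure_range (hmem.1 hp)
    refine tendsto_nhds_unique (tendsto_const_nhds.inner h1) ?_
    refine (tendsto_const_nhds.inner h2).congr fun n => (hL ψ (χ n)).symm
  have hsymm2 : ∀ p ∈ S, ∀ q ∈ S, ⟪p.2, q.1⟫_ℂ = ⟪p.1, q.2⟫_ℂ := by
    intro p hp q hq
    obtain ⟨χ, h1, h2⟩ := exists_seq_of_mem_closure_range (hmem.1 hp)
    refine tendsto_nhds_unique (h2.inner tendsto_const_nhds) ?_
    exact (h1.inner tendsto_const_nhds).congr fun n => (hsymm1 q hq (χ n)).symm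
  have hpos : ∀ p ∈ S, δ * ‖p.1‖ ^ 2 ≤ (⟪p.1, p.2⟫_ℂ).re := by
    intro p hp
    obtain ⟨χ, h1, h2⟩ := exists_seq_of_mem_closure_range (hmem.1 hp)
    exact le_of_tendsto_of_tendsto' ((h1.norm.pow 2).const_mul δ)
      ((Complex.continuous_re.tendsto _).comp (h1.inner h2)) fun n => hLpos (χ n)
  -- Closability: a symmetric operator with dense domain has a closure that is again a graph.
  have hcl : ∀ p ∈ S, p.1 = 0 → p.2 = 0 := by
    intro p hp h0
    refine eq_zero_of_inner_eq_zero hι fun ψ => ?_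
    rw [← hsymm1 p hp ψ, h0, inner_zero_right]
  set H : E →ₗ.[ℂ] E := S.toLinearPMap with hH
  have hgraph : H.graph = S := Submodule.toLinearPMap_graph_eq S hcl
  have hHmem : ∀ f : H.domain, ((f : E), H f) ∈ S := fun f => by
    rw [← hgraph]; exact H.mem_graph f
  have hdomS : ∀ p ∈ S, p.1 ∈ H.domain := fun p hp => by
    rw [← hgraph] at hp; exact LinearPMap.mem_domain_of_mem_graph hp
  have hιmem : ∀ ψ, (ι ψ, L ψ) ∈ S := fun ψ => hmem.2 (subset_closure ⟨ψ, rfl⟩)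
  have hdense : Dense (H.domain : Set E) :=
    hι.mono (range_subset_iff.2 fun ψ => hdomS _ (hιmem ψ))
  have hval : ∀ p (hp : p ∈ S), H ⟨p.1, hdomS p hp⟩ = p.2 := by
    intro p hp
    have h1 := S.sub_mem (hHmem ⟨p.1, hdomS p hp⟩) hp
    have := hcl _ h1 (by simp)
    exact sub_eq_zero.1 this
  refine ⟨H, by rw [hgraph, hScoe], ?_, ?_, fun f => hpos _ (hHmem f)⟩
  · rw [LinearPMap.isSelfAdjoint_def]
    have hform : H.IsFormalAdjoint H := fun x y => by
      exact hsymm2 _ (hHmem x) _ (hHmem y)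
    have hle : H ≤ H.adjoint := hform.le_adjoint hdense
    refine (LinearPMap.eq_of_le_of_domain_eq hle (le_antisymm hle.1 fun y hy => ?_)).symm
    -- For `y` in the adjoint domain, solve `(H + l) p = (H* + l) y` inside the closure; then `y -
    -- p` is orthogonal to the dense range of `L + l`, so `y` lies in the domain.
    obtain ⟨p, hp, hpe⟩ := exists_resolvent hLnn hl0 hRL (H.adjoint ⟨y, hy⟩ + (l : ℂ) • y)
    have hpS := hmem.2 hp
    have : y - p.1 = 0 := by
      refine eq_zero_of_inner_eq_zero hRL fun ψ => ?_
      have h1 := (LinearPMap.adjoint_isFormalAdjoint hdense) ⟨y, hy⟩ ⟨ι ψ, hdomS _ (hιmem ψ)⟩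
      rw [hval _ (hιmem ψ)] at h1
      have h2 := hsymm1 p hpS ψ
      have h1' : ⟪ι ψ, H.adjoint ⟨y, hy⟩⟫_ℂ = ⟪L ψ, y⟫_ℂ := by
        rw [← inner_conj_symm, ← inner_conj_symm (L ψ)]
        exact congrArg _ h1
      have h3 : ⟪ι ψ, p.2 + (l : ℂ) • p.1⟫_ℂ = ⟪ι ψ, H.adjoint ⟨y, hy⟩ + (l : ℂ) • y⟫_ℂ := by
        rw [hpe]
      simp only [inner_add_right, inner_smul_right] at h3
      simp only [inner_sub_right, inner_add_left, inner_smul_left, Complex.conj_ofReal]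
      rw [h2, ← h1']
      linear_combination -h3
    rw [sub_eq_zero.1 this]
    exact hdomS p hpS
  · ext f
    constructor
    · intro hf
      -- `T = L - P`, and `P` is bounded relative to `L`, so elements of the closure of `L` are in
      -- the closure of the symmetric operator `T`, hence in the domain of its adjoint.
      obtain ⟨w, hw⟩ := exists_mem_closure_of_norm_le hPL (hmem.1 (hHmem ⟨f, hf⟩))
      refine ⟨w, fun ψ => ?_⟩
      obtain ⟨χ, h1, h2⟩ := exists_seq_of_mem_closure_range hw
      refine tendsto_nhds_unique (tendsto_const_nhds.inner h1) ?_
      refine (tendsto_const_nhds.inner h2).congr fun n => ?_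
      have : L (χ n) + (-P) (χ n) = T (χ n) := by simp [hLdef]
      rw [this]
      exact (hT ψ (χ n)).symm
    · rintro ⟨g, hg⟩
      -- Conversely, density of the range of `T + 1` shows that the adjoint domain of `T` is that of
      -- its closure, and boundedness relative to `T` carries it into the domain of `H`.
      obtain ⟨p, hp, hpe⟩ := exists_resolvent hTpos one_pos (hR 1 one_pos) (g + ((1 : ℝ) : ℂ) • f)
      obtain ⟨w, hw⟩ := exists_mem_closure_of_norm_le hPT hp
      have : f - p.1 = 0 := by
        refine eq_zero_of_inner_eq_zero (hR 1 one_pos) fun ψ => ?_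
        have h2 : ⟪T ψ, p.1⟫_ℂ = ⟪ι ψ, p.2⟫_ℂ := by
          obtain ⟨χ, h1, h2⟩ := exists_seq_of_mem_closure_range hp
          refine tendsto_nhds_unique (tendsto_const_nhds.inner h1) ?_
          exact (tendsto_const_nhds.inner h2).congr fun n => (hT ψ (χ n)).symm
        have h3 : ⟪ι ψ, p.2 + ((1 : ℝ) : ℂ) • p.1⟫_ℂ = ⟪ι ψ, g + ((1 : ℝ) : ℂ) • f⟫_ℂ := by
          rw [hpe]
        simp only [inner_add_right, inner_smul_right] at h3
        simp only [inner_sub_right, inner_add_left, inner_smul_left, Complex.conj_ofReal]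
        rw [h2, hg]
        linear_combination -h3
      rw [sub_eq_zero.1 this]
      exact hdomS (p.1, w) (hmem.2 hw)

end KatoRellich

/-! ### Integration on the hyperbolic plane -/

theorem measurable_volH_density :
    Measurable fun x : Pt => ENNReal.ofReal (Real.exp (-x 1)) := by fun_prop

theorem integral_volH {F : Type*} [NormedAddCommGroup F] [NormedSpace ℝ F] (f : Pt → F) :
    ∫ x, f x ∂volH = ∫ x, Real.exp (-x 1) • f x := by
  rw [volH, integral_withDensity_eq_integral_toReal_smul measurable_volH_density
    (Eventually.of_forall fun _ => ENNReal.ofReal_lt_top)]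
  simp [ENNReal.toReal_ofReal (Real.exp_pos _).le]

theorem lintegral_volH (f : Pt → ℝ≥0∞) :
    ∫⁻ x, f x ∂volH = ∫⁻ x, ENNReal.ofReal (Real.exp (-x 1)) * f x := by
  rw [volH, lintegral_withDensity_eq_lintegral_mul_non_measurable _ measurable_volH_density
    (Eventually.of_forall fun _ => ENNReal.ofReal_lt_top)]
  rfl

theorem integrable_volH_iff {F : Type*} [NormedAddCommGroup F] [NormedSpace ℝ F] (f : Pt → F) :
    Integrable f volH ↔ Integrable fun x => Real.exp (-x 1) • f x := by
  rw [volH, integrable_withDensity_iff_integrable_smul' measurable_volH_density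
    (Eventually.of_forall fun _ => ENNReal.ofReal_lt_top)]
  simp [ENNReal.toReal_ofReal (Real.exp_pos _).le]

instance isLocallyFiniteMeasure_volH : IsLocallyFiniteMeasure volH :=
  IsLocallyFiniteMeasure.withDensity_ofReal (by fun_prop)

/-! ### Coordinate derivatives -/

section PartialD

variable {F : Type*} [NormedAddCommGroup F] [NormedSpace ℝ F]

theorem continuous_partialD {f : Pt → F} (hf : ContDiff ℝ 1 f) (i : Fin 2) :
    Continuous (partialD i f) :=
  (hf.continuous_fderiv (by norm_num)).clm_apply continuous_const

theorem tsupport_partialD_subset (f : Pt → F) (i : Fin 2) :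
    tsupport (partialD i f) ⊆ tsupport f := tsupport_fderiv_apply_subset ℝ _

theorem hasCompactSupport_partialD {f : Pt → F} (hf : HasCompactSupport f) (i : Fin 2) :
    HasCompactSupport (partialD i f) := hf.fderiv_apply (𝕜 := ℝ) _

/-- The integral of a derivative of a compactly supported function vanishes. -/
theorem integral_partialD_eq_zero [CompleteSpace F] {f : Pt → F} (hf : ContDiff ℝ 1 f)
    (hs : HasCompactSupport f) (i : Fin 2) : ∫ x, partialD i f x = 0 := by
  have h := integral_smul_fderiv_eq_neg_fderiv_smul_of_integrable (μ := (volume : Measure Pt))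
    (f := fun _ : Pt => (1 : ℝ)) (g := f) (v := Pi.single i 1) (by simp)
    (by
      have := (continuous_partialD hf i).integrable_of_hasCompactSupport (μ := volume)
        (hasCompactSupport_partialD hs i)
      simp only [one_smul]
      exact this)
    (by simpa using hf.continuous.integrable_of_hasCompactSupport hs)
    (fun _ _ => differentiableAt_const _) (fun x _ => hf.differentiable (by norm_num) x)
  simpa [partialD] using h

/-- The derivative of `f` along a coordinate line. -/
theorem hasDerivAt_partialD {f : Pt → F} {x : Pt} (hf : DifferentiableAt ℝ f x) (i : Fin 2) :
    HasDerivAt (fun τ : ℝ => f (x + τ • Pi.single i 1)) (partialD i f x) 0 :=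
  hf.hasFDerivAt.hasLineDerivAt _

/-- The only Christoffel symbol surviving in the trace is `Γ²₁₁`, and `h^{11} Γ²₁₁ = 1` produces the
drift `-∂₂`. -/
theorem lap_eq (f : Pt → F) (x : Pt) :
    lap f x = Real.exp (2 * x 1) • partialD 0 (partialD 0 f) x - partialD 1 f x
      + partialD 1 (partialD 1 f) x := by
  have e : Real.exp (2 * x 1) * Real.exp (-(2 * x 1)) = 1 := by rw [← Real.exp_add]; simp
  simp only [lap, Fin.sum_univ_two, metricInv]
  simp [smul_sub, smul_smul, e]

end PartialD

/-! ### Point-pair invariants -/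

/-- The hyperbolic cosine of the distance between `x` and `y`. -/
noncomputable def coshDist (x y : Pt) : ℝ :=
  Real.cosh (x 1 - y 1) + Real.exp (-x 1 - y 1) * (x 0 - y 0) ^ 2 / 2

theorem coshDist_comm (x y : Pt) : coshDist x y = coshDist y x := by
  have e1 : Real.cosh (y 1 - x 1) = Real.cosh (x 1 - y 1) := by
    rw [← Real.cosh_neg]; ring_nf
  have e2 : -y 1 - x 1 = -x 1 - y 1 := by ring
  rw [coshDist, coshDist, e1, e2]; ring

theorem one_le_coshDist (x y : Pt) : 1 ≤ coshDist x y := by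
  have := Real.one_le_cosh (x 1 - y 1)
  have h2 : 0 ≤ Real.exp (-x 1 - y 1) * (x 0 - y 0) ^ 2 / 2 := by positivity
  rw [coshDist]; linarith

theorem contDiff_coshDist : ContDiff ℝ ∞ fun p : Pt × Pt => coshDist p.1 p.2 := by
  have h1 : ∀ k, ContDiff ℝ ∞ fun p : Pt × Pt => p.1 k := fun k =>
    (contDiff_apply ℝ ℝ k).comp contDiff_fst
  have h2 : ∀ k, ContDiff ℝ ∞ fun p : Pt × Pt => p.2 k := fun k =>
    (contDiff_apply ℝ ℝ k).comp contDiff_snd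
  unfold coshDist
  exact (Real.contDiff_cosh.comp ((h1 1).sub (h2 1))).add
    (((((h1 1).neg.sub (h2 1)).exp).mul (((h1 0).sub (h2 0)).pow 2)).div_const 2)

theorem contDiff_coshDist_left (y : Pt) : ContDiff ℝ ∞ fun x : Pt => coshDist x y :=
  contDiff_coshDist.comp (contDiff_id.prodMk contDiff_const)

theorem partialD_eq_of_hasDerivAt {f : Pt → ℝ} {x : Pt} {i : Fin 2} {a : ℝ}
    (hf : DifferentiableAt ℝ f x)
    (h : HasDerivAt (fun τ : ℝ => f (x + τ • Pi.single i 1)) a 0) : partialD i f x = a :=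
  (hasDerivAt_partialD hf i).unique h

theorem hasDerivAt_line (x : Pt) (i k : Fin 2) :
    HasDerivAt (fun τ : ℝ => (x + τ • (Pi.single i 1 : Pt)) k) ((Pi.single i 1 : Pt) k) 0 := by
  have := ((hasDerivAt_id (0 : ℝ)).smul_const (Pi.single i 1 : Pt)).const_add x
  simpa using hasDerivAt_pi.1 this k

theorem partialD_zero_coshDist (x y : Pt) :
    partialD 0 (fun x => coshDist x y) x = Real.exp (-x 1 - y 1) * (x 0 - y 0) := by
  refine partialD_eq_of_hasDerivAt ((contDiff_coshDist_left y).differentiable (by simp) x) ?_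
  have a := hasDerivAt_line x 0 0
  have b := hasDerivAt_line x 0 1
  have h := ((b.sub_const (y 1)).cosh).add
    (((((b.neg.sub_const (y 1)).exp).mul ((a.sub_const (y 0)).pow 2))).div_const 2)
  refine h.congr_deriv ?_
  simp
  ring

theorem partialD_one_coshDist (x y : Pt) :
    partialD 1 (fun x => coshDist x y) x
      = Real.sinh (x 1 - y 1) - Real.exp (-x 1 - y 1) * (x 0 - y 0) ^ 2 / 2 := by
  refine partialD_eq_of_hasDerivAt ((contDiff_coshDist_left y).differentiable (by simp) x) ?_
  have a := hasDerivAt_line x 1 0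
  have b := hasDerivAt_line x 1 1
  have h := ((b.sub_const (y 1)).cosh).add
    (((((b.neg.sub_const (y 1)).exp).mul ((a.sub_const (y 0)).pow 2))).div_const 2)
  refine h.congr_deriv ?_
  simp
  ring

theorem partialD_zero_zero_coshDist (x y : Pt) :
    partialD 0 (partialD 0 fun x => coshDist x y) x = Real.exp (-x 1 - y 1) := by
  have e : (partialD 0 fun x => coshDist x y) = fun x => Real.exp (-x 1 - y 1) * (x 0 - y 0) := by
    funext x; exact partialD_zero_coshDist x y
  refine partialD_eq_of_hasDerivAt
    ((contDiff_partialD (contDiff_coshDist_left y) 0).differentiable (by simp) x) ?_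
  rw [e]
  have a := hasDerivAt_line x 0 0
  have b := hasDerivAt_line x 0 1
  have h := ((b.neg.sub_const (y 1)).exp).mul (a.sub_const (y 0))
  refine h.congr_deriv ?_
  simp

theorem partialD_one_one_coshDist (x y : Pt) :
    partialD 1 (partialD 1 fun x => coshDist x y) x = coshDist x y := by
  have e : (partialD 1 fun x => coshDist x y) = fun x => Real.sinh (x 1 - y 1)
      - Real.exp (-x 1 - y 1) * (x 0 - y 0) ^ 2 / 2 := by
    funext x; exact partialD_one_coshDist x y
  refine partialD_eq_of_hasDerivAt
    ((contDiff_partialD (contDiff_coshDist_left y) 1).differentiable (by simp) x) ?_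
  rw [e]
  have a := hasDerivAt_line x 1 0
  have b := hasDerivAt_line x 1 1
  have h := ((b.sub_const (y 1)).sinh).sub
    (((((b.neg.sub_const (y 1)).exp).mul ((a.sub_const (y 0)).pow 2))).div_const 2)
  refine h.congr_deriv ?_
  simp [coshDist]
  ring

theorem partialD_comp {k : ℝ → ℝ} {f : Pt → ℝ} {x : Pt} (hk : DifferentiableAt ℝ k (f x))
    (hf : DifferentiableAt ℝ f x) (i : Fin 2) :
    partialD i (fun y => k (f y)) x = deriv k (f x) * partialD i f x := by
  refine partialD_eq_of_hasDerivAt (hk.comp x hf) ?_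
  have h1 := hasDerivAt_partialD hf i
  have h2 : HasDerivAt k (deriv k (f x)) (f (x + (0 : ℝ) • Pi.single i 1)) := by
    simpa using hk.hasDerivAt
  exact h2.comp (0 : ℝ) h1

theorem partialD_mul {f g : Pt → ℝ} {x : Pt} (hf : DifferentiableAt ℝ f x)
    (hg : DifferentiableAt ℝ g x) (i : Fin 2) :
    partialD i (fun y => f y * g y) x = partialD i f x * g x + f x * partialD i g x := by
  refine partialD_eq_of_hasDerivAt (hf.mul hg) ?_
  refine ((hasDerivAt_partialD hf i).mul (hasDerivAt_partialD hg i)).congr_deriv ?_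
  simp

theorem partialD_partialD_comp {k : ℝ → ℝ} {f : Pt → ℝ} (hk : ContDiff ℝ ∞ k)
    (hf : ContDiff ℝ ∞ f) (i : Fin 2) (x : Pt) :
    partialD i (partialD i fun y => k (f y)) x
      = deriv (deriv k) (f x) * partialD i f x ^ 2 + deriv k (f x) * partialD i (partialD i f) x := by
  have hk' : ContDiff ℝ ∞ (deriv k) := (contDiff_infty_iff_deriv.1 hk).2
  have hf1 : Differentiable ℝ f := hf.differentiable (by simp)
  have e : (partialD i fun y => k (f y)) = fun y => deriv k (f y) * partialD i f y := by
    funext y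
    exact partialD_comp (hk.differentiable (by simp) _) (hf1 y) i
  rw [e, partialD_mul (f := fun y => deriv k (f y)) ((hk'.comp hf).differentiable (by simp) x)
    ((contDiff_partialD hf i).differentiable (by simp) x),
    partialD_comp (hk'.differentiable (by simp) _) (hf1 x)]
  ring

/-- This is `|∇ cosh d|² = sinh² d`, reflecting `|∇d| = 1`. -/
theorem exp_mul_partialD_coshDist_sq (x y : Pt) :
    Real.exp (2 * x 1) * partialD 0 (fun x => coshDist x y) x ^ 2
      + partialD 1 (fun x => coshDist x y) x ^ 2 = coshDist x y ^ 2 - 1 := by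
  rw [partialD_zero_coshDist, partialD_one_coshDist, coshDist]
  have e1 : Real.exp (2 * x 1) * Real.exp (-x 1 - y 1) = Real.cosh (x 1 - y 1)
      + Real.sinh (x 1 - y 1) := by
    rw [← Real.exp_add, Real.cosh_add_sinh]; ring_nf
  have e2 := Real.cosh_sq (x 1 - y 1)
  linear_combination (Real.exp (-x 1 - y 1) * (x 0 - y 0) ^ 2) * e1 - e2

/-- The Laplacian of a point-pair invariant. -/
theorem lap_comp_coshDist {k : ℝ → ℝ} (hk : ContDiff ℝ ∞ k) (x y : Pt) :
    lap (fun x => k (coshDist x y)) x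
      = deriv (deriv k) (coshDist x y) * (coshDist x y ^ 2 - 1)
        + 2 * coshDist x y * deriv k (coshDist x y) := by
  have hf := contDiff_coshDist_left y
  rw [lap_eq, partialD_partialD_comp hk hf, partialD_partialD_comp hk hf,
    partialD_comp (hk.differentiable (by simp) _) (hf.differentiable (by simp) x),
    ← exp_mul_partialD_coshDist_sq, partialD_zero_zero_coshDist, partialD_one_one_coshDist]
  rw [partialD_one_coshDist]
  have e1 : Real.exp (2 * x 1) * Real.exp (-x 1 - y 1) = Real.cosh (x 1 - y 1)
      + Real.sinh (x 1 - y 1) := by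
    rw [← Real.exp_add, Real.cosh_add_sinh]; ring_nf
  simp only [smul_eq_mul, coshDist]
  linear_combination (deriv k (Real.cosh (x 1 - y 1) +
    Real.exp (-x 1 - y 1) * (x 0 - y 0) ^ 2 / 2)) * e1

/-- Each of the two nonnegative summands of `coshDist` is at most `R`, which encloses hyperbolic
balls in coordinate boxes. -/
theorem abs_sub_le_of_coshDist_le {x y : Pt} {R : ℝ} (h : coshDist x y ≤ R) :
    |x 1 - y 1| ≤ 2 * R ∧ (x 0 - y 0) ^ 2 ≤ 2 * R * Real.exp (x 1 + y 1) := by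
  rw [coshDist] at h
  have h1 : 0 ≤ Real.exp (-x 1 - y 1) * (x 0 - y 0) ^ 2 / 2 := by positivity
  have h2 : 1 ≤ Real.cosh (x 1 - y 1) := Real.one_le_cosh _
  constructor
  · have h3 : Real.cosh |x 1 - y 1| ≤ R := by rw [Real.cosh_abs]; linarith
    rw [Real.cosh_eq] at h3
    have h4 := Real.add_one_le_exp |x 1 - y 1|
    have h5 := Real.exp_pos (-|x 1 - y 1|)
    linarith
  · have e : Real.exp (x 1 + y 1) * Real.exp (-x 1 - y 1) = 1 := by
      rw [← Real.exp_add, Real.exp_eq_one_iff]; ring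
    have h3 : Real.exp (-x 1 - y 1) * (x 0 - y 0) ^ 2 ≤ 2 * R := by linarith
    calc (x 0 - y 0) ^ 2 = Real.exp (x 1 + y 1) * (Real.exp (-x 1 - y 1) * (x 0 - y 0) ^ 2) := by
          rw [← mul_assoc, e, one_mul]
      _ ≤ Real.exp (x 1 + y 1) * (2 * R) := mul_le_mul_of_nonneg_left h3 (Real.exp_pos _).le
      _ = _ := by ring

/-- Hyperbolic neighbourhoods of bounded sets are bounded. -/
theorem exists_ball_of_coshDist_le (N R : ℝ) :
    ∃ M, ∀ x ∈ Metric.closedBall (0 : Pt) N, ∀ y, coshDist x y ≤ R → y ∈ Metric.closedBall (0 : Pt) M := by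
  refine ⟨max (N + 2 * R) (N + (1 + 2 * R * Real.exp (N + (N + 2 * R)))), fun x hx y hy => ?_⟩
  have hR : 1 ≤ R := (one_le_coshDist x y).trans hy
  obtain ⟨h1, h2⟩ := abs_sub_le_of_coshDist_le hy
  rw [mem_closedBall_zero_iff] at hx ⊢
  have hx0 : |x 0| ≤ N := (norm_le_pi_norm x 0).trans hx
  have hx1 : |x 1| ≤ N := (norm_le_pi_norm x 1).trans hx
  have hN : 0 ≤ N := (abs_nonneg _).trans hx0
  have hy1 : |y 1| ≤ N + 2 * R := by
    have : y 1 = x 1 - (x 1 - y 1) := by ring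
    rw [this]
    exact (abs_sub _ _).trans (add_le_add hx1 h1)
  have h3 : Real.exp (x 1 + y 1) ≤ Real.exp (N + (N + 2 * R)) :=
    Real.exp_le_exp.2 (add_le_add ((le_abs_self _).trans hx1) ((le_abs_self _).trans hy1))
  have h4 : |x 0 - y 0| ≤ 1 + 2 * R * Real.exp (N + (N + 2 * R)) := by
    have h5 : |x 0 - y 0| ≤ 1 + (x 0 - y 0) ^ 2 := by
      rw [← sq_abs]; nlinarith [sq_nonneg (|x 0 - y 0| - 1), abs_nonneg (x 0 - y 0)]
    have h6 : 2 * R * Real.exp (x 1 + y 1) ≤ 2 * R * Real.exp (N + (N + 2 * R)) :=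
      mul_le_mul_of_nonneg_left h3 (by linarith)
    linarith
  have hy0 : |y 0| ≤ N + (1 + 2 * R * Real.exp (N + (N + 2 * R))) := by
    have : y 0 = x 0 - (x 0 - y 0) := by ring
    rw [this]
    exact (abs_sub _ _).trans (add_le_add hx0 h4)
  refine (pi_norm_le_iff_of_nonneg ?_).2 fun k => ?_
  · exact le_max_of_le_left (by linarith)
  · fin_cases k
    · exact le_max_of_le_right hy0
    · exact le_max_of_le_left hy1

/-- Small hyperbolic neighbourhoods. -/
theorem eventually_of_coshDist_lt {y : Pt} {N : Set Pt} (hN : N ∈ 𝓝 y) :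
    ∃ ε > 0, ∀ x, coshDist x y < 1 + ε → x ∈ N := by
  obtain ⟨M, hM⟩ := exists_ball_of_coshDist_le ‖y‖ 2
  by_contra! hcon
  have hK : IsCompact (Metric.closedBall (0 : Pt) M \ interior N) :=
    (isCompact_closedBall 0 M).diff isOpen_interior
  have hne : (Metric.closedBall (0 : Pt) M \ interior N).Nonempty := by
    obtain ⟨x, hx, hxN⟩ := hcon 1 one_pos
    refine ⟨x, hM y (by simp) x (by rw [coshDist_comm]; linarith), fun h => hxN (interior_subset h)⟩
  -- On a compact set avoiding the neighbourhood the distance attains its minimum, which is positive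
  -- because `coshDist` equals `1` only on the diagonal; this minimum supplies `ε`.
  obtain ⟨x₀, hx₀, hmin⟩ := hK.exists_isMinOn hne
    (contDiff_coshDist_left y).continuous.continuousOn
  have h1 : 1 < coshDist x₀ y := by
    rcases (one_le_coshDist x₀ y).lt_or_eq with h | h
    · exact h
    · exfalso
      rw [coshDist] at h
      have h2 : 0 ≤ Real.exp (-x₀ 1 - y 1) * (x₀ 0 - y 0) ^ 2 / 2 := by positivity
      have h3 : Real.cosh (x₀ 1 - y 1) = 1 :=
        le_antisymm (by linarith) (Real.one_le_cosh _)
      have h4 : x₀ 1 - y 1 = 0 := by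
        by_contra hne
        exact absurd h3 (Real.one_lt_cosh.2 hne).ne'
      have h5 : (x₀ 0 - y 0) ^ 2 = 0 := by
        have : Real.exp (-x₀ 1 - y 1) * (x₀ 0 - y 0) ^ 2 = 0 := by linarith
        exact (mul_eq_zero.1 this).resolve_left (Real.exp_pos _).ne'
      have h6 : x₀ 0 - y 0 = 0 := by simpa using h5
      have : x₀ = y := by
        funext k; fin_cases k
        · simpa using sub_eq_zero.1 h6
        · simpa using sub_eq_zero.1 h4
      rw [this] at hx₀
      exact hx₀.2 (mem_interior_iff_mem_nhds.2 hN)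
  obtain ⟨x, hx, hxN⟩ := hcon (min 1 (coshDist x₀ y - 1)) (lt_min one_pos (by linarith))
  have hx2 : coshDist x y ≤ 2 := by have := min_le_left 1 (coshDist x₀ y - 1); linarith
  have h2 := hmin ⟨hM y (by simp) x (by rwa [coshDist_comm]), fun h => hxN (interior_subset h)⟩
  have h3 := min_le_right 1 (coshDist x₀ y - 1)
  simp only [mem_ofPred_eq] at h2
  linarith

attribute [irreducible] coshDist

/-! ### Integral operators with smooth, locally supported kernels -/

/-- A smooth kernel whose support is, locally in the first variable, bounded in the second. -/
structure IsLocalKernel (K : Pt → Pt → ℝ) : Prop where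
  contDiff : ContDiff ℝ ∞ fun p : Pt × Pt => K p.1 p.2
  support : ∀ N : ℝ, ∃ M : ℝ, ∀ x ∈ Metric.closedBall (0 : Pt) N,
    ∀ y ∉ Metric.closedBall (0 : Pt) M, K x y = 0

namespace IsLocalKernel

variable {K : Pt → Pt → ℝ}

theorem contDiff_left (hK : IsLocalKernel K) (y : Pt) : ContDiff ℝ ∞ fun x => K x y :=
  hK.contDiff.comp (contDiff_id.prodMk contDiff_const)

theorem contDiff_right (hK : IsLocalKernel K) (x : Pt) : ContDiff ℝ ∞ fun y => K x y :=
  hK.contDiff.comp (contDiff_const.prodMk contDiff_id)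

theorem hasCompactSupport_right (hK : IsLocalKernel K) (x : Pt) :
    HasCompactSupport fun y => K x y := by
  obtain ⟨M, hM⟩ := hK.support ‖x‖
  exact HasCompactSupport.intro (isCompact_closedBall 0 M) fun y hy => hM x (by simp) y hy

theorem fderiv_left (hK : IsLocalKernel K) (x y : Pt) :
    fderiv ℝ (fun x => K x y) x
      = (fderiv ℝ (fun p : Pt × Pt => K p.1 p.2) (x, y)).comp (ContinuousLinearMap.inl ℝ Pt Pt) := by
  have h1 : HasFDerivAt (fun x : Pt => (x, y)) (ContinuousLinearMap.inl ℝ Pt Pt) x :=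
    (hasFDerivAt_id x).prodMk (hasFDerivAt_const y x)
  have h2 := (hK.contDiff.differentiable (by simp) (x, y)).hasFDerivAt
  exact (h2.comp x h1).fderiv

theorem continuous_fderiv_left (hK : IsLocalKernel K) :
    Continuous fun p : Pt × Pt => fderiv ℝ (fun x => K x p.2) p.1 := by
  simp only [hK.fderiv_left]
  exact (hK.contDiff.continuous_fderiv (by simp)).clm_comp continuous_const

/-- The open ball lets the kernel vanish in a neighbourhood of `x`, so its derivative vanishes too.
-/
theorem fderiv_left_eq_zero (hK : IsLocalKernel K) (N : ℝ) : ∃ M : ℝ,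
    ∀ x ∈ Metric.ball (0 : Pt) N, ∀ y ∉ Metric.closedBall (0 : Pt) M,
      fderiv ℝ (fun x => K x y) x = 0 := by
  obtain ⟨M, hM⟩ := hK.support N
  refine ⟨M, fun x hx y hy => ?_⟩
  have : (fun x => K x y) =ᶠ[𝓝 x] fun _ => 0 := by
    filter_upwards [Metric.isOpen_ball.mem_nhds hx] with z hz
    exact hM z (Metric.ball_subset_closedBall hz) y hy
  rw [this.fderiv_eq]; simp

/-- The partial derivatives of a local kernel are local kernels. -/
theorem partialD (hK : IsLocalKernel K) (i : Fin 2) :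
    IsLocalKernel fun x y => MagneticHyp.partialD i (fun x => K x y) x where
  contDiff := by
    simp only [MagneticHyp.partialD, hK.fderiv_left]
    exact ((hK.contDiff.fderiv_right (m := ∞) (by simp)).clm_comp contDiff_const).clm_apply
      contDiff_const
  support := fun N => by
    obtain ⟨M, hM⟩ := hK.fderiv_left_eq_zero (N + 1)
    refine ⟨M, fun x hx y hy => ?_⟩
    rw [MagneticHyp.partialD, hM x (Metric.closedBall_subset_ball (lt_add_one N) hx) y hy]
    rfl

end IsLocalKernel

theorem ball_mem_nhds_norm_add_one (x : Pt) : Metric.ball (0 : Pt) (‖x‖ + 1) ∈ 𝓝 x :=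
  Metric.isOpen_ball.mem_nhds (by simp)

/-- A dominating function for local kernels. -/
theorem exists_dominating {W : Type*} [NormedAddCommGroup W] [NormedSpace ℝ W] {K : Pt → Pt → W}
    (hc : Continuous fun p : Pt × Pt => K p.1 p.2)
    (hs : ∀ N : ℝ, ∃ M : ℝ, ∀ x ∈ Metric.ball (0 : Pt) N, ∀ y ∉ Metric.closedBall (0 : Pt) M, K x y = 0)
    {g : Pt → ℝ} (hg : LocallyIntegrable g volH) (N : ℝ) :
    ∃ b : Pt → ℝ, Integrable b volH ∧ ∀ x ∈ Metric.ball (0 : Pt) N, ∀ y, ‖g y • K x y‖ ≤ b y := by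
  obtain ⟨M, hM⟩ := hs N
  obtain ⟨C, hC⟩ := ((isCompact_closedBall (0 : Pt) N).prod
    (isCompact_closedBall (0 : Pt) M)).exists_bound_of_continuousOn hc.continuousOn
  refine ⟨(Metric.closedBall (0 : Pt) M).indicator fun y => ‖g y‖ * C, ?_, fun x hx y => ?_⟩
  · rw [integrable_indicator_iff measurableSet_closedBall]
    exact (hg.integrableOn_isCompact (isCompact_closedBall 0 M)).norm.mul_const C
  · by_cases hy : y ∈ Metric.closedBall (0 : Pt) M
    · rw [indicator_of_mem hy, norm_smul]
      exact mul_le_mul_of_nonneg_left (hC (x, y) ⟨Metric.ball_subset_closedBall hx, hy⟩)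
        (norm_nonneg _)
    · rw [indicator_of_notMem hy, hM x hx y hy]; simp

theorem continuous_integral_kernel {W : Type*} [NormedAddCommGroup W] [NormedSpace ℝ W]
    {K : Pt → Pt → W} (hc : Continuous fun p : Pt × Pt => K p.1 p.2)
    (hs : ∀ N : ℝ, ∃ M : ℝ, ∀ x ∈ Metric.ball (0 : Pt) N, ∀ y ∉ Metric.closedBall (0 : Pt) M, K x y = 0)
    {g : Pt → ℝ} (hg : LocallyIntegrable g volH) :
    Continuous fun x => ∫ y, g y • K x y ∂volH := by
  refine continuous_iff_continuousAt.2 fun x => ?_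
  obtain ⟨b, hb, hbd⟩ := exists_dominating hc hs hg (‖x‖ + 1)
  have hc' : ∀ x, Continuous (K x) := fun x => hc.comp (by fun_prop : Continuous fun y => (x, y))
  refine continuousAt_of_dominated (bound := b) ?_ ?_ hb ?_
  · exact Eventually.of_forall fun z => hg.aestronglyMeasurable.smul
      (hc' z).aestronglyMeasurable
  · filter_upwards [ball_mem_nhds_norm_add_one x] with z hz
    exact Eventually.of_forall (hbd z hz)
  · refine Eventually.of_forall fun y => ?_
    exact (continuous_const.smul (hc.comp (by fun_prop : Continuous fun x => (x, y)))).continuousAt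

theorem IsLocalKernel.support_ball {K : Pt → Pt → ℝ} (hK : IsLocalKernel K) (N : ℝ) :
    ∃ M : ℝ, ∀ x ∈ Metric.ball (0 : Pt) N, ∀ y ∉ Metric.closedBall (0 : Pt) M, K x y = 0 := by
  obtain ⟨M, hM⟩ := hK.support N
  exact ⟨M, fun x hx => hM x (Metric.ball_subset_closedBall hx)⟩

/-- Differentiation under the integral sign. -/
theorem IsLocalKernel.hasFDerivAt_integral {K : Pt → Pt → ℝ} (hK : IsLocalKernel K) {g : Pt → ℝ}
    (hg : LocallyIntegrable g volH) (x : Pt) :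
    HasFDerivAt (fun x => ∫ y, g y • K x y ∂volH)
      (∫ y, g y • fderiv ℝ (fun x => K x y) x ∂volH) x := by
  obtain ⟨b, hb, hbd⟩ := exists_dominating (K := fun x y => fderiv ℝ (fun x => K x y) x)
    hK.continuous_fderiv_left hK.fderiv_left_eq_zero hg (‖x‖ + 1)
  obtain ⟨b', hb', hbd'⟩ := exists_dominating hK.contDiff.continuous hK.support_ball hg (‖x‖ + 1)
  have hm : ∀ x, AEStronglyMeasurable (fun y => g y • K x y) volH := fun x =>
    hg.aestronglyMeasurable.smul (hK.contDiff_right x).continuous.aestronglyMeasurable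
  refine hasFDerivAt_integral_of_dominated_of_fderiv_le (ball_mem_nhds_norm_add_one x)
    (Eventually.of_forall hm) (hb'.mono' (hm x) (Eventually.of_forall (hbd' x (by simp)))) ?_
    (Eventually.of_forall fun y z hz => hbd z hz y) hb
    (Eventually.of_forall fun y z _ =>
      ((hK.contDiff_left y).differentiable (by simp) z).hasFDerivAt.const_smul (g y))
  exact hg.aestronglyMeasurable.smul (hK.continuous_fderiv_left.comp
    (by fun_prop : Continuous fun y => (x, y))).aestronglyMeasurable

theorem IsLocalKernel.partialD_integral {K : Pt → Pt → ℝ} (hK : IsLocalKernel K) {g : Pt → ℝ}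
    (hg : LocallyIntegrable g volH) (i : Fin 2) :
    (MagneticHyp.partialD i fun x => ∫ y, g y • K x y ∂volH)
      = fun x => ∫ y, g y • MagneticHyp.partialD i (fun x => K x y) x ∂volH := by
  funext x
  obtain ⟨b, hb, hbd⟩ := exists_dominating (K := fun x y => fderiv ℝ (fun x => K x y) x)
    hK.continuous_fderiv_left hK.fderiv_left_eq_zero hg (‖x‖ + 1)
  have hint : Integrable (fun y => g y • fderiv ℝ (fun x => K x y) x) volH :=
    hb.mono' (hg.aestronglyMeasurable.smul (hK.continuous_fderiv_left.comp
      (by fun_prop : Continuous fun y => (x, y))).aestronglyMeasurable)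
      (Eventually.of_forall (hbd x (by simp)))
  rw [MagneticHyp.partialD, (hK.hasFDerivAt_integral hg x).fderiv,
    ContinuousLinearMap.integral_apply hint]
  rfl

theorem IsLocalKernel.contDiff_integral {K : Pt → Pt → ℝ} (hK : IsLocalKernel K) {g : Pt → ℝ}
    (hg : LocallyIntegrable g volH) : ContDiff ℝ 1 fun x => ∫ y, g y • K x y ∂volH := by
  rw [contDiff_one_iff_fderiv]
  refine ⟨fun x => (hK.hasFDerivAt_integral hg x).differentiableAt, ?_⟩
  have : fderiv ℝ (fun x => ∫ y, g y • K x y ∂volH)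
      = fun x => ∫ y, g y • fderiv ℝ (fun x => K x y) x ∂volH := by
    funext x; exact (hK.hasFDerivAt_integral hg x).fderiv
  rw [this]
  exact continuous_integral_kernel hK.continuous_fderiv_left hK.fderiv_left_eq_zero hg

theorem IsLocalKernel.integrable {K : Pt → Pt → ℝ} (hK : IsLocalKernel K) {g : Pt → ℝ}
    (hg : LocallyIntegrable g volH) (x : Pt) : Integrable (fun y => g y • K x y) volH := by
  obtain ⟨b, hb, hbd⟩ := exists_dominating hK.contDiff.continuous hK.support_ball hg (‖x‖ + 1)
  exact hb.mono' (hg.aestronglyMeasurable.smul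
    (hK.contDiff_right x).continuous.aestronglyMeasurable) (Eventually.of_forall (hbd x (by simp)))

theorem integral_smul_sub_add {α : Type*} [MeasurableSpace α] {μ : Measure α} {A B C : α → ℝ}
    (hA : Integrable A μ) (hB : Integrable B μ) (hC : Integrable C μ) (c : ℝ) :
    ∫ x, (c * A x - B x + C x) ∂μ = c * ∫ x, A x ∂μ - ∫ x, B x ∂μ + ∫ x, C x ∂μ := by
  rw [← integral_const_mul, ← integral_sub (hA.const_mul c) hB]
  exact integral_add ((hA.const_mul c).sub hB) hC

/-- Partial derivatives of a local kernel are local kernels, so differentiation under the integral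
can be iterated for merely locally integrable `g`. -/
theorem IsLocalKernel.lap_integral {K : Pt → Pt → ℝ} (hK : IsLocalKernel K) {g : Pt → ℝ}
    (hg : LocallyIntegrable g volH) (x : Pt) :
    lap (fun x => ∫ y, g y • K x y ∂volH) x = ∫ y, g y • lap (fun x => K x y) x ∂volH := by
  have h0 := hK.partialD 0
  have h1 := hK.partialD 1
  have e := integral_smul_sub_add ((h0.partialD 0).integrable hg x) (h1.integrable hg x)
    ((h1.partialD 1).integrable hg x) (Real.exp (2 * x 1))
  rw [lap_eq, hK.partialD_integral hg, hK.partialD_integral hg, h0.partialD_integral hg,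
    h1.partialD_integral hg, smul_eq_mul, ← e]
  refine integral_congr_ae (Eventually.of_forall fun y => ?_)
  simp only [lap_eq, smul_eq_mul]
  ring

/-! ### Kernels depending on the distance -/

theorem isLocalKernel_coshDist {k : ℝ → ℝ} (hk : ContDiff ℝ ∞ k) {R : ℝ} (hR : ∀ p, R ≤ p → k p = 0) :
    IsLocalKernel fun x y => k (coshDist x y) where
  contDiff := hk.comp contDiff_coshDist
  support := fun N => by
    obtain ⟨M, hM⟩ := exists_ball_of_coshDist_le N R
    refine ⟨M, fun x hx y hy => hR _ ?_⟩
    by_contra! h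
    exact hy (hM x hx y h.le)

/-- The action of the solvable group of isometries. -/
noncomputable def translate (x z : Pt) : Pt := ![x 0 + Real.exp (x 1) * z 0, x 1 + z 1]

/-- `translate x` is an isometry carrying the origin to `x`; it reduces integrals of radial kernels
to the origin. -/
theorem coshDist_translate (x z : Pt) : coshDist x (translate x z) = coshDist 0 z := by
  have e : Real.exp (-x 1 - (x 1 + z 1)) * (Real.exp (x 1) * Real.exp (x 1))
      = Real.exp (-z 1) := by
    rw [← Real.exp_add, ← Real.exp_add]; ring_nf
  have e1 : Real.cosh (x 1 - (x 1 + z 1)) = Real.cosh (0 - z 1) := by ring_nf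
  simp only [coshDist, translate, Matrix.cons_val_zero, Matrix.cons_val_one, Pi.zero_apply,
    neg_zero, zero_sub] at *
  rw [e1]
  linear_combination (z 0 ^ 2 / 2) * e

theorem continuous_translate (x : Pt) : Continuous (translate x) := by
  refine continuous_pi fun k => ?_
  fin_cases k <;> simp [translate] <;> fun_prop

/-- Translations preserve the hyperbolic volume. -/
theorem lintegral_translate (x : Pt) {f : Pt → ℝ≥0∞} (hf : Measurable f) :
    ∫⁻ z, f (translate x z) ∂volH = ∫⁻ y, f y ∂volH := by
  have hD : (Matrix.diagonal ![Real.exp (x 1), 1]).det = Real.exp (x 1) := by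
    simp [Matrix.det_diagonal]
  have h := Real.smul_map_diagonal_volume_pi (D := ![Real.exp (x 1), 1])
    (by rw [hD]; exact (Real.exp_pos _).ne')
  rw [hD, abs_of_pos (Real.exp_pos _)] at h
  have hm : Measurable (Matrix.toLin' (Matrix.diagonal ![Real.exp (x 1), 1])) :=
    (LinearMap.continuous_on_pi _).measurable
  have hw : Measurable fun y : Pt => ENNReal.ofReal (Real.exp (-y 1)) * f y :=
    measurable_volH_density.mul hf
  -- The translation is affine with diagonal linear part of determinant `e^{x₂}`; this Jacobian
  -- cancels the factor `e^{-x₂}` picked up by the volume density.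
  have key : ∀ F : Pt → ℝ≥0∞, Measurable F →
      ∫⁻ y, F y = ENNReal.ofReal (Real.exp (x 1)) * ∫⁻ z, F (translate x z) := by
    intro F hF
    rw [← lintegral_add_left_eq_self F x]
    conv_lhs => rw [← h]
    rw [lintegral_smul_measure, smul_eq_mul,
      lintegral_map (f := fun a => F (x + a)) (hF.comp (measurable_const_add x)) hm]
    congr 2
    funext z
    congr 1
    funext k
    fin_cases k <;> simp [translate, Matrix.toLin'_apply]
  have hw' : Measurable fun z : Pt => ENNReal.ofReal (Real.exp (-translate x z 1))
      * f (translate x z) := hw.comp (continuous_translate x).measurable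
  rw [lintegral_volH, lintegral_volH, key _ hw, ← lintegral_const_mul _ hw']
  congr 1
  funext z
  rw [← mul_assoc, ← ENNReal.ofReal_mul (Real.exp_pos _).le, ← Real.exp_add]
  simp [translate]

/-! ### Uniqueness of square integrable weak solutions of `Δ g = l g` -/

/-- A smooth cutoff, equal to `1` on `(-∞, 1]` and to `0` on `[2, ∞)`. -/
noncomputable def cutoff (p : ℝ) : ℝ := Real.smoothTransition (2 - p)

theorem contDiff_cutoff : ContDiff ℝ ∞ cutoff :=
  Real.smoothTransition.contDiff.comp (contDiff_const.sub contDiff_id)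

theorem cutoff_eq_one {p : ℝ} (h : p ≤ 1) : cutoff p = 1 :=
  Real.smoothTransition.one_of_one_le (by linarith)

theorem cutoff_eq_zero {p : ℝ} (h : 2 ≤ p) : cutoff p = 0 :=
  Real.smoothTransition.zero_of_nonpos (by linarith)

theorem cutoff_nonneg (p : ℝ) : 0 ≤ cutoff p := Real.smoothTransition.nonneg _

theorem cutoff_le_one (p : ℝ) : cutoff p ≤ 1 := Real.smoothTransition.le_one _

theorem exists_abs_deriv_cutoff_le : ∃ M, ∀ p, 0 ≤ p → |deriv cutoff p| ≤ M ∧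
    (2 < p → deriv cutoff p = 0) := by
  have hc : Continuous (deriv cutoff) := contDiff_cutoff.continuous_deriv (by simp)
  obtain ⟨M, hM⟩ := (isCompact_Icc (a := (0 : ℝ)) (b := 2)).exists_bound_of_continuousOn
    hc.continuousOn
  have h0 : ∀ p, 2 < p → deriv cutoff p = 0 := fun p hp => by
    have : cutoff =ᶠ[𝓝 p] fun _ => 0 := by
      filter_upwards [lt_mem_nhds hp] with q hq using cutoff_eq_zero (le_of_lt hq)
    rw [this.deriv_eq]; simp
  refine ⟨M, fun p hp => ⟨?_, h0 p⟩⟩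
  rcases le_or_gt p 2 with h | h
  · exact hM p ⟨hp, h⟩
  · rw [h0 p h, abs_zero]
    exact (norm_nonneg _).trans (hM 0 ⟨le_rfl, by norm_num⟩)

/-- The isometric change of variables `y = translate x z` makes the mass of a radial kernel
independent of its centre. -/
theorem lintegral_coshDist {k : ℝ → ℝ} (hk : Continuous k) (x : Pt) :
    ∫⁻ y, ENNReal.ofReal (k (coshDist x y)) ∂volH
      = ∫⁻ z, ENNReal.ofReal (k (coshDist 0 z)) ∂volH := by
  have hm : Measurable fun y => ENNReal.ofReal (k (coshDist x y)) :=
    (ENNReal.continuous_ofReal.comp (hk.comp (contDiff_coshDist.continuous.comp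
      (by fun_prop : Continuous fun y : Pt => (x, y))))).measurable
  rw [← lintegral_translate x hm]
  simp only [coshDist_translate]

/-- Cauchy–Schwarz for `a w = w^{1/2} · (a w^{1/2})`, the pointwise half of Schur's test. -/
theorem lintegral_mul_sq_le {α : Type*} [MeasurableSpace α] (μ : Measure α) {a w : α → ℝ≥0∞}
    (ha : AEMeasurable a μ) (hw : AEMeasurable w μ) :
    (∫⁻ y, a y * w y ∂μ) ^ 2 ≤ (∫⁻ y, w y ∂μ) * ∫⁻ y, a y ^ 2 * w y ∂μ := by
  have hp : Real.HolderConjugate 2 2 := Real.HolderConjugate.two_two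
  have hsq : ∀ t : ℝ≥0∞, (t ^ (1 / 2 : ℝ)) ^ (2 : ℝ) = t := fun t => by
    rw [← ENNReal.rpow_mul]; norm_num
  have h := ENNReal.lintegral_mul_le_Lp_mul_Lq μ hp (f := fun y => w y ^ (1 / 2 : ℝ))
    (g := fun y => a y * w y ^ (1 / 2 : ℝ)) (hw.pow_const _) (ha.mul (hw.pow_const _))
  have e1 : ∀ y, w y ^ (1 / 2 : ℝ) * (a y * w y ^ (1 / 2 : ℝ)) = a y * w y := fun y => by
    have : w y ^ (1 / 2 : ℝ) * w y ^ (1 / 2 : ℝ) = w y := by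
      rw [← ENNReal.rpow_add_of_nonneg _ _ (by norm_num) (by norm_num)]; norm_num
    rw [mul_left_comm, this]
  simp only [Pi.mul_apply, e1, ENNReal.mul_rpow_of_nonneg _ _ (zero_le_two (α := ℝ)), hsq] at h
  have h2 := ENNReal.rpow_le_rpow h (zero_le_two (α := ℝ))
  rw [ENNReal.mul_rpow_of_nonneg _ _ (zero_le_two (α := ℝ)), hsq, hsq] at h2
  simpa only [ENNReal.rpow_two] using h2

theorem lintegral_coshDist_lt_top {k : ℝ → ℝ} (hk : ContDiff ℝ ∞ k) {R : ℝ}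
    (hR : ∀ p, R ≤ p → k p = 0) : ∫⁻ z, ENNReal.ofReal (k (coshDist 0 z)) ∂volH < ⊤ := by
  have hK := isLocalKernel_coshDist hk hR
  have h1 : Integrable (fun z => k (coshDist 0 z)) volH :=
    (hK.contDiff_right 0).continuous.integrable_of_hasCompactSupport (hK.hasCompactSupport_right 0)
  exact h1.lintegral_lt_top

/-- Schur's test for kernels depending on the distance, in terms of lower integrals. -/
theorem lintegral_sq_lintegral_coshDist_lt_top {k : ℝ → ℝ} (hk : ContDiff ℝ ∞ k) {R : ℝ}
    (hR : ∀ p, R ≤ p → k p = 0) {a : Pt → ℝ≥0∞} (ha : AEMeasurable a volH)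
    (hfin : ∫⁻ y, a y ^ 2 ∂volH < ⊤) :
    ∫⁻ x, (∫⁻ y, a y * ENNReal.ofReal (k (coshDist x y)) ∂volH) ^ 2 ∂volH < ⊤ := by
  have hKm : Measurable fun p : Pt × Pt => ENNReal.ofReal (k (coshDist p.1 p.2)) :=
    (ENNReal.continuous_ofReal.comp (hk.continuous.comp contDiff_coshDist.continuous)).measurable
  have hcfin := lintegral_coshDist_lt_top hk hR
  have hx : ∀ x, ∫⁻ y, ENNReal.ofReal (k (coshDist x y)) ∂volH
      = ∫⁻ z, ENNReal.ofReal (k (coshDist 0 z)) ∂volH := lintegral_coshDist hk.continuous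
  have hy : ∀ y, ∫⁻ x, ENNReal.ofReal (k (coshDist x y)) ∂volH
      = ∫⁻ z, ENNReal.ofReal (k (coshDist 0 z)) ∂volH := fun y => by
    rw [← hx y]
    simp only [coshDist_comm _ y]
  generalize ∫⁻ z, ENNReal.ofReal (k (coshDist 0 z)) ∂volH = c at hcfin hx hy
  have h1 : ∫⁻ x, (∫⁻ y, a y * ENNReal.ofReal (k (coshDist x y)) ∂volH) ^ 2 ∂volH
      ≤ ∫⁻ x, c * ∫⁻ y, a y ^ 2 * ENNReal.ofReal (k (coshDist x y)) ∂volH ∂volH := by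
    refine lintegral_mono fun x => ?_
    refine (lintegral_mul_sq_le volH ha (hKm.comp measurable_prodMk_left).aemeasurable).trans_eq ?_
    rw [← hx x]
    rfl
  refine h1.trans_lt ?_
  have hm : AEMeasurable (Function.uncurry fun x y : Pt =>
      a y ^ 2 * ENNReal.ofReal (k (coshDist x y))) (volH.prod volH) :=
    ((ha.pow_const 2).comp_snd (μ := volH)).mul hKm.aemeasurable
  rw [lintegral_const_mul' _ _ hcfin.ne, lintegral_lintegral_swap hm]
  have h2 : ∀ y, ∫⁻ x, a y ^ 2 * ENNReal.ofReal (k (coshDist x y)) ∂volH = a y ^ 2 * c := fun y => by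
    have hmy : Measurable fun x => ENNReal.ofReal (k (coshDist x y)) :=
      (ENNReal.continuous_ofReal.comp
        (hk.continuous.comp (contDiff_coshDist_left y).continuous)).measurable
    rw [lintegral_const_mul _ hmy, hy y]
  simp only [h2]
  rw [lintegral_mul_const' _ _ hcfin.ne]
  exact ENNReal.mul_lt_top hcfin (ENNReal.mul_lt_top hfin hcfin)

/-- Schur's test for kernels depending on the distance. -/
theorem memLp_integral_coshDist {k : ℝ → ℝ} (hk : ContDiff ℝ ∞ k) {R : ℝ}
    (hR : ∀ p, R ≤ p → k p = 0) (hk0 : ∀ p, 0 ≤ k p) {g : Pt → ℝ} (hg : MemLp g 2 volH) :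
    MemLp (fun x => ∫ y, g y • k (coshDist x y) ∂volH) 2 volH := by
  have hgl : LocallyIntegrable g volH := hg.locallyIntegrable (by norm_num)
  refine ⟨((isLocalKernel_coshDist hk hR).contDiff_integral hgl).continuous.aestronglyMeasurable, ?_⟩
  have hgfin := (eLpNorm_lt_top_iff_lintegral_rpow_enorm_lt_top (by norm_num) (by norm_num)).1 hg.2
  rw [eLpNorm_lt_top_iff_lintegral_rpow_enorm_lt_top (by norm_num) (by norm_num)]
  simp only [ENNReal.toReal_ofNat, ENNReal.rpow_two] at hgfin ⊢
  refine (lintegral_mono fun x => ?_).trans_lt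
    (lintegral_sq_lintegral_coshDist_lt_top hk hR hg.1.enorm hgfin)
  refine pow_le_pow_left₀ zero_le ?_ 2
  refine (enorm_integral_le_lintegral_enorm _).trans_eq (lintegral_congr fun y => ?_)
  rw [enorm_smul, Real.enorm_of_nonneg (hk0 _)]

/-- The energy inequality for `Δ G = l G` with a cutoff. -/
theorem integral_cutoff_nonpos {G χ : Pt → ℝ} {l : ℝ} (hG : ContDiff ℝ 1 G)
    (hG' : ∀ i, ContDiff ℝ 1 (partialD i G)) (hlap : ∀ x, lap G x = l * G x)
    (hχ : ContDiff ℝ ∞ χ) (hχs : HasCompactSupport χ) :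
    ∫ x, (l * χ x ^ 2 - (Real.exp (2 * x 1) * partialD 0 χ x ^ 2 + partialD 1 χ x ^ 2))
      * G x ^ 2 ∂volH ≤ 0 := by
  have hχ1 : ContDiff ℝ 1 χ := hχ.of_le (by simp)
  have hw : ∀ c : ℝ, ContDiff ℝ 1 fun x : Pt => Real.exp (c * x 1) := fun c =>
    (contDiff_const.mul (contDiff_apply ℝ ℝ 1)).exp
  -- The fluxes are `√h h^{ii} χ² G ∂_i G`, with `√h h^{ii}` equal to `e^{x₂}` for the first
  -- direction (`c = 1`) and to `e^{-x₂}` for the second (`c = -1`).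
  have hF : ∀ (c : ℝ) i, ContDiff ℝ 1 fun x : Pt =>
      Real.exp (c * x 1) * ((χ x * χ x) * (G x * partialD i G x)) := fun c i =>
    (hw c).mul ((hχ1.mul hχ1).mul (hG.mul (hG' i)))
  have hFs : ∀ (c : ℝ) i, HasCompactSupport fun x : Pt =>
      Real.exp (c * x 1) * ((χ x * χ x) * (G x * partialD i G x)) := fun c i =>
    hχs.mul_right.mul_right.mul_left
  have hd : ∀ (c : ℝ) i x, partialD i (fun x : Pt =>
      Real.exp (c * x 1) * ((χ x * χ x) * (G x * partialD i G x))) x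
      = Real.exp (c * x 1) * (c * (Pi.single i 1 : Pt) 1 * (χ x ^ 2 * (G x * partialD i G x))
        + 2 * χ x * partialD i χ x * (G x * partialD i G x)
        + χ x ^ 2 * (partialD i G x ^ 2 + G x * partialD i (partialD i G) x)) := by
    intro c i x
    refine partialD_eq_of_hasDerivAt ((hF c i).differentiable (by simp) x) ?_
    have a := ((hasDerivAt_line x i 1).const_mul c).exp
    have b := hasDerivAt_partialD (hχ1.differentiable (by simp) x) i
    have d := hasDerivAt_partialD (hG.differentiable (by simp) x) i
    have e := hasDerivAt_partialD ((hG' i).differentiable (by simp) x) i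
    refine (a.mul ((b.mul b).mul (d.mul e))).congr_deriv ?_
    simp
    ring
  have h0 := integral_partialD_eq_zero (hF 1 0) (hFs 1 0) 0
  have h1 := integral_partialD_eq_zero (hF (-1) 1) (hFs (-1) 1) 1
  have hi : ∀ (c : ℝ) i, Integrable (partialD i fun x : Pt =>
      Real.exp (c * x 1) * ((χ x * χ x) * (G x * partialD i G x))) := fun c i =>
    (continuous_partialD (hF c i) i).integrable_of_hasCompactSupport
      (hasCompactSupport_partialD (hFs c i) i)
  have hsum := integral_add (hi 1 0) (hi (-1) 1)
  rw [h0, h1, add_zero] at hsum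
  rw [integral_volH, ← hsum]
  refine integral_mono ?_ ((hi 1 0).add (hi (-1) 1)) fun x => ?_
  · refine Continuous.integrable_of_hasCompactSupport ?_ ?_
    · have e1 : Continuous fun x : Pt => Real.exp (-x 1) := by fun_prop
      have e2 : Continuous fun x : Pt => Real.exp (2 * x 1) := by fun_prop
      exact e1.smul (((continuous_const.mul (hχ1.continuous.pow 2)).sub
        ((e2.mul ((continuous_partialD hχ1 0).pow 2)).add ((continuous_partialD hχ1 1).pow 2))).mul
        (hG.continuous.pow 2))
    · refine HasCompactSupport.intro hχs fun x hx => ?_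
      have e0 : χ x = 0 := image_eq_zero_of_notMem_tsupport hx
      have e1 : ∀ i, partialD i χ x = 0 := fun i =>
        image_eq_zero_of_notMem_tsupport fun h => hx (tsupport_partialD_subset χ i h)
      simp [e0, e1]
  · simp only [hd, smul_eq_mul]
    have hl := hlap x
    rw [lap_eq, smul_eq_mul] at hl
    have e1 : Real.exp (1 * x 1) = Real.exp (-x 1) * Real.exp (2 * x 1) := by
      rw [← Real.exp_add]; ring_nf
    have e2 : Real.exp (-1 * x 1) = Real.exp (-x 1) := by ring_nf
    rw [e1, e2]
    have e3 : l * G x ^ 2 * χ x ^ 2 = G x * χ x ^ 2 * (Real.exp (2 * x 1)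
        * partialD 0 (partialD 0 G) x - partialD 1 G x + partialD 1 (partialD 1 G) x) := by
      rw [hl]; ring
    -- Completing the square: `div(χ² G ∇G) = |∇(χG)|² - G² |∇χ|² + l χ² G²`, and the first term is
    -- dropped.
    have e4 : 0 ≤ Real.exp (2 * x 1) * (χ x * partialD 0 G x + G x * partialD 0 χ x) ^ 2
        + (χ x * partialD 1 G x + G x * partialD 1 χ x) ^ 2 := by positivity
    have e5 := mul_nonneg (Real.exp_pos (-x 1)).le e4
    have e6 := congrArg (fun t => Real.exp (-x 1) * t) e3
    simp
    linarith

/-- With cutoffs in `cosh d / (n + 1)`, the energy inequality bounds `l ∫ χ_n² G²` by `∫ |∇χ_n|²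
G²`. The gradients are uniformly bounded and tend to `0` pointwise, so dominated convergence with
`G² ∈ L¹` gives `∫ G² = 0`. -/
theorem ae_eq_zero_of_lap_eq {G : Pt → ℝ} {l : ℝ} (hl : 0 < l) (hG : ContDiff ℝ 1 G)
    (hG' : ∀ i, ContDiff ℝ 1 (partialD i G)) (hlap : ∀ x, lap G x = l * G x)
    (hL : MemLp G 2 volH) : G =ᵐ[volH] 0 := by
  obtain ⟨M, hM⟩ := exists_abs_deriv_cutoff_le
  have hGi : Integrable (fun x => G x ^ 2) volH := hL.integrable_sq
  set χ : ℕ → Pt → ℝ := fun n x => cutoff (coshDist x 0 * (n + 1 : ℝ)⁻¹) with hχdef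
  have hk : ∀ n : ℕ, ContDiff ℝ ∞ fun p : ℝ => cutoff (p * (n + 1 : ℝ)⁻¹) := fun n =>
    contDiff_cutoff.comp (contDiff_id.mul contDiff_const)
  have hR : ∀ (n : ℕ) (p : ℝ), 2 * (n + 1 : ℝ) ≤ p → cutoff (p * (n + 1 : ℝ)⁻¹) = 0 :=
    fun n p hp => cutoff_eq_zero (by
      rw [← div_eq_mul_inv, le_div_iff₀ (by positivity)]; exact hp)
  have hχ : ∀ n, ContDiff ℝ ∞ (χ n) := fun n => (hk n).comp (contDiff_coshDist_left 0)
  have hχs : ∀ n, HasCompactSupport (χ n) := fun n => by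
    have := (isLocalKernel_coshDist (hk n) (hR n)).hasCompactSupport_right 0
    simpa only [coshDist_comm 0] using this
  have hder : ∀ (n : ℕ) i x, partialD i (χ n) x = deriv cutoff (coshDist x 0 * (n + 1 : ℝ)⁻¹)
      * (n + 1 : ℝ)⁻¹ * partialD i (fun x => coshDist x 0) x := by
    intro n i x
    rw [hχdef]
    simp only
    rw [partialD_comp (k := fun p : ℝ => cutoff (p * (n + 1 : ℝ)⁻¹))
      ((hk n).differentiable (by simp) _)
      ((contDiff_coshDist_left 0).differentiable (by simp) x)]
    congr 1
    have := (contDiff_cutoff.differentiable (by simp) (coshDist x 0 * (n + 1 : ℝ)⁻¹)).hasDerivAt.comp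
      (coshDist x 0) ((hasDerivAt_id (coshDist x 0)).mul_const ((n + 1 : ℝ)⁻¹))
    simpa [Function.comp_def] using this.deriv
  have hgrad : ∀ (n : ℕ) x, Real.exp (2 * x 1) * partialD 0 (χ n) x ^ 2 + partialD 1 (χ n) x ^ 2
      = (deriv cutoff (coshDist x 0 * (n + 1 : ℝ)⁻¹)) ^ 2 * (n + 1 : ℝ)⁻¹ ^ 2
        * (coshDist x 0 ^ 2 - 1) := by
    intro n x
    rw [hder, hder, ← exp_mul_partialD_coshDist_sq]
    ring
  have hp0 : ∀ (n : ℕ) x, 0 ≤ coshDist x 0 * (n + 1 : ℝ)⁻¹ := fun n x =>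
    mul_nonneg (zero_le_one.trans (one_le_coshDist x 0)) (by positivity)
  have hgrad_nonneg : ∀ (n : ℕ) x, 0 ≤ Real.exp (2 * x 1) * partialD 0 (χ n) x ^ 2
      + partialD 1 (χ n) x ^ 2 := fun n x => by positivity
  have hsqM : ∀ (n : ℕ) x, (deriv cutoff (coshDist x 0 * (n + 1 : ℝ)⁻¹)) ^ 2 ≤ M ^ 2 := fun n x =>
    sq_le_sq.2 ((hM _ (hp0 n x)).1.trans (le_abs_self M))
  -- Although `|∇ cosh d| = sinh d` is unbounded, the derivative of the cutoff lives where `cosh d ≤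
  -- 2 (n + 1)`, and this compensates the factor `1 / (n + 1)`.
  have hgrad_le : ∀ (n : ℕ) x, Real.exp (2 * x 1) * partialD 0 (χ n) x ^ 2 + partialD 1 (χ n) x ^ 2
      ≤ 4 * M ^ 2 := by
    intro n x
    rw [hgrad]
    rcases le_or_gt (coshDist x 0 * (n + 1 : ℝ)⁻¹) 2 with h | h
    · have h1 : (n + 1 : ℝ)⁻¹ ^ 2 * (coshDist x 0 ^ 2 - 1) ≤ 4 := by
        have h2 : (coshDist x 0 * (n + 1 : ℝ)⁻¹) ^ 2 ≤ 2 ^ 2 := pow_le_pow_left₀ (hp0 n x) h 2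
        have h3 : 0 ≤ (n + 1 : ℝ)⁻¹ ^ 2 := sq_nonneg _
        nlinarith
      have h4 : 0 ≤ (n + 1 : ℝ)⁻¹ ^ 2 * (coshDist x 0 ^ 2 - 1) :=
        mul_nonneg (sq_nonneg _) (by nlinarith [one_le_coshDist x 0])
      rw [mul_assoc]
      calc _ ≤ M ^ 2 * 4 := mul_le_mul (hsqM n x) h1 h4 (sq_nonneg _)
        _ = _ := by ring
    · rw [(hM _ (hp0 n x)).2 h]
      have := sq_nonneg M
      norm_num
      linarith
  have hinv : Tendsto (fun n : ℕ => (n + 1 : ℝ)⁻¹) atTop (𝓝 0) := by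
    simpa [one_div] using tendsto_one_div_add_atTop_nhds_zero_nat (𝕜 := ℝ)
  have hgrad_lim : ∀ x, Tendsto (fun n => Real.exp (2 * x 1) * partialD 0 (χ n) x ^ 2
      + partialD 1 (χ n) x ^ 2) atTop (𝓝 0) := by
    intro x
    have h1 : Tendsto (fun n : ℕ => M ^ 2 * (n + 1 : ℝ)⁻¹ ^ 2 * (coshDist x 0 ^ 2 - 1)) atTop
        (𝓝 0) := by
      have := ((hinv.pow 2).const_mul (M ^ 2)).mul_const (coshDist x 0 ^ 2 - 1)
      simpa using this
    refine squeeze_zero (fun n => hgrad_nonneg n x) (fun n => ?_) h1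
    rw [hgrad]
    exact mul_le_mul_of_nonneg_right (mul_le_mul_of_nonneg_right (hsqM n x) (sq_nonneg _))
      (by nlinarith [one_le_coshDist x 0])
  have hχ_lim : ∀ x, Tendsto (fun n => χ n x) atTop (𝓝 1) := by
    intro x
    have h1 := (hinv.const_mul (coshDist x 0))
    rw [mul_zero] at h1
    refine tendsto_const_nhds.congr' ?_
    filter_upwards [h1.eventually (gt_mem_nhds one_pos)] with n hn
    exact (cutoff_eq_one (le_of_lt hn)).symm
  have hlim : Tendsto (fun n => ∫ x, (l * χ n x ^ 2 - (Real.exp (2 * x 1) * partialD 0 (χ n) x ^ 2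
      + partialD 1 (χ n) x ^ 2)) * G x ^ 2 ∂volH) atTop (𝓝 (∫ x, (l * 1 ^ 2 - 0) * G x ^ 2 ∂volH)) := by
    refine tendsto_integral_of_dominated_convergence (fun x => (l + 4 * M ^ 2) * G x ^ 2) ?_
      (hGi.const_mul _) ?_ ?_
    · intro n
      have hc1 : ContDiff ℝ 1 (χ n) := (hχ n).of_le (by simp)
      have e2 : Continuous fun x : Pt => Real.exp (2 * x 1) := by fun_prop
      exact (((continuous_const.mul ((hχ n).continuous.pow 2)).sub
        ((e2.mul ((continuous_partialD hc1 0).pow 2)).add ((continuous_partialD hc1 1).pow 2))).mul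
        (hG.continuous.pow 2)).aestronglyMeasurable
    · refine fun n => Eventually.of_forall fun x => ?_
      rw [Real.norm_eq_abs, abs_mul, abs_of_nonneg (sq_nonneg (G x))]
      refine mul_le_mul_of_nonneg_right ?_ (sq_nonneg _)
      have h1 : χ n x ^ 2 ≤ 1 := pow_le_one₀ (cutoff_nonneg _) (cutoff_le_one _)
      have h2 := sq_nonneg (χ n x)
      have h3 := hgrad_nonneg n x
      have h4 := hgrad_le n x
      rw [abs_le]
      constructor <;> nlinarith
    · refine Eventually.of_forall fun x => ?_
      exact ((((hχ_lim x).pow 2).const_mul l).sub (hgrad_lim x)).mul_const _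
  have hle : ∫ x, (l * 1 ^ 2 - 0) * G x ^ 2 ∂volH ≤ 0 :=
    le_of_tendsto' hlim fun n => integral_cutoff_nonpos hG hG' hlap (hχ n) (hχs n)
  simp only [one_pow, mul_one, sub_zero] at hle
  rw [integral_const_mul] at hle
  have h0 : ∫ x, G x ^ 2 ∂volH = 0 := by
    have : 0 ≤ ∫ x, G x ^ 2 ∂volH := integral_nonneg fun x => sq_nonneg _
    nlinarith
  rw [integral_eq_zero_iff_of_nonneg (fun x => sq_nonneg _) hGi] at h0
  filter_upwards [h0] with x hx
  simpa using hx

attribute [irreducible] cutoff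

/-! ### Square integrable solutions of `Δ g = l g` in the sense of distributions vanish -/

theorem contDiff_lap {F : Type*} [NormedAddCommGroup F] [NormedSpace ℝ F] {f : Pt → F}
    (hf : ContDiff ℝ ∞ f) : ContDiff ℝ ∞ (lap f) := by
  have h : lap f = fun x => Real.exp (2 * x 1) • partialD 0 (partialD 0 f) x - partialD 1 f x
      + partialD 1 (partialD 1 f) x := funext (lap_eq f)
  have hw : ContDiff ℝ ∞ fun x : Pt => Real.exp (2 * x 1) :=
    (contDiff_const.mul (contDiff_apply ℝ ℝ 1)).exp
  rw [h]
  exact ((hw.smul (contDiff_partialD (contDiff_partialD hf 0) 0)).sub (contDiff_partialD hf 1)).add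
    (contDiff_partialD (contDiff_partialD hf 1) 1)

theorem hasCompactSupport_lap {F : Type*} [NormedAddCommGroup F] [NormedSpace ℝ F] {f : Pt → F}
    (hf : HasCompactSupport f) : HasCompactSupport (lap f) := by
  refine HasCompactSupport.intro hf fun x hx => ?_
  have e : ∀ i, ∀ y ∉ tsupport f, partialD i f y = 0 := fun i y hy =>
    image_eq_zero_of_notMem_tsupport fun h => hy (tsupport_partialD_subset f i h)
  have e' : ∀ i, partialD i (partialD i f) x = 0 := fun i =>
    image_eq_zero_of_notMem_tsupport fun h =>
      hx (tsupport_partialD_subset f i (tsupport_partialD_subset _ i h))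
  rw [lap_eq, e 1 x hx, e', e']
  simp

theorem integral_coshDist {k : ℝ → ℝ} (hk : Continuous k) (hk0 : ∀ p, 0 ≤ k p) (y : Pt) :
    ∫ x, k (coshDist x y) ∂volH = ∫ z, k (coshDist 0 z) ∂volH := by
  have hc : ∀ y, Continuous fun x => k (coshDist x y) := fun y =>
    hk.comp (contDiff_coshDist_left y).continuous
  simp only [coshDist_comm 0]
  rw [integral_eq_lintegral_of_nonneg_ae (Eventually.of_forall fun x => hk0 _)
      (hc y).aestronglyMeasurable,
    integral_eq_lintegral_of_nonneg_ae (Eventually.of_forall fun x => hk0 _)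
      (hc 0).aestronglyMeasurable]
  simp only [coshDist_comm _ y, coshDist_comm _ 0]
  rw [lintegral_coshDist hk]

/-- Normalized radial bump functions concentrating at the diagonal. -/
theorem exists_radial_bump {ε : ℝ} (hε : 0 < ε) : ∃ k : ℝ → ℝ, ContDiff ℝ ∞ k ∧ (∀ p, 0 ≤ k p) ∧
    (∀ p, 1 + ε ≤ p → k p = 0) ∧ ∀ y, ∫ x, k (coshDist x y) ∂volH = 1 := by
  -- The rescaling places the transition of the cutoff between `1 + ε/2` and `1 + ε`; the value `1`
  -- of `cosh d` is the diagonal.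
  set j : ℝ → ℝ := fun p => cutoff ((p - 1) * (2 / ε)) with hj
  have hjc : ContDiff ℝ ∞ j :=
    contDiff_cutoff.comp ((contDiff_id.sub contDiff_const).mul contDiff_const)
  have hj0 : ∀ p, 0 ≤ j p := fun p => cutoff_nonneg _
  have hjR : ∀ p, 1 + ε ≤ p → j p = 0 := fun p hp => cutoff_eq_zero (by
    rw [mul_div_assoc', le_div_iff₀ hε]
    linarith)
  have hK := isLocalKernel_coshDist hjc hjR
  have hpos : 0 < ∫ z, j (coshDist 0 z) ∂volH := by
    rw [integral_volH]
    have hw : Continuous fun z : Pt => Real.exp (-z 1) := by fun_prop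
    have hc : Continuous fun z : Pt => Real.exp (-z 1) • j (coshDist 0 z) :=
      hw.smul (hK.contDiff_right 0).continuous
    have hcs : HasCompactSupport fun z : Pt => Real.exp (-z 1) • j (coshDist 0 z) :=
      (hK.hasCompactSupport_right 0).mono fun z hz hz' => hz (by simp [hz'])
    refine hc.integral_pos_of_hasCompactSupport_nonneg_nonzero (x := 0) hcs
      (fun z => mul_nonneg (Real.exp_pos _).le (hj0 _)) ?_
    have h1 : coshDist 0 0 = 1 := by simp [coshDist]
    have h2 : j 1 = 1 := cutoff_eq_one (by simp)
    simp [h1, h2]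
  refine ⟨fun p => (∫ z, j (coshDist 0 z) ∂volH)⁻¹ * j p, contDiff_const.mul hjc,
    fun p => mul_nonneg (inv_pos.2 hpos).le (hj0 p), fun p hp => ?_, fun y => ?_⟩
  · simp only [hjR p hp, mul_zero]
  · rw [integral_const_mul, integral_coshDist hjc.continuous hj0, inv_mul_cancel₀ hpos.ne']

/-- The weak equation, tested against a radial kernel. -/
theorem lap_integral_coshDist {g : Pt → ℝ} {l : ℝ} (hg : LocallyIntegrable g volH)
    (h : ∀ φ : Pt → ℝ, ContDiff ℝ ∞ φ → HasCompactSupport φ →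
      ∫ x, (-lap φ x + l * φ x) * g x ∂volH = 0)
    {k : ℝ → ℝ} (hk : ContDiff ℝ ∞ k) {R : ℝ} (hR : ∀ p, R ≤ p → k p = 0) (x : Pt) :
    lap (fun x => ∫ y, g y • k (coshDist x y) ∂volH) x
      = l * ∫ y, g y • k (coshDist x y) ∂volH := by
  have hK := isLocalKernel_coshDist hk hR
  -- The Laplacian of a point-pair invariant is again a function of the distance, so it may be taken
  -- in either variable; this moves it onto the test function of the weak equation.
  have hsymm : ∀ y, lap (fun x => k (coshDist x y)) x = lap (fun y => k (coshDist x y)) y := by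
    intro y
    have e : (fun y => k (coshDist x y)) = fun y => k (coshDist y x) := by
      funext y; rw [coshDist_comm]
    rw [e, lap_comp_coshDist hk, lap_comp_coshDist hk, coshDist_comm y x]
  rw [hK.lap_integral hg]
  simp only [hsymm]
  have hφ := hK.contDiff_right x
  have hφs := hK.hasCompactSupport_right x
  have h0 := h _ hφ hφs
  have hi := hK.integrable hg x
  have hA : Integrable (fun y => g y • lap (fun y => k (coshDist x y)) y) volH := by
    have := hg.integrable_smul_left_of_hasCompactSupport (contDiff_lap hφ).continuous
      (hasCompactSupport_lap hφs)
    refine this.congr (Eventually.of_forall fun y => ?_)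
    simp only [smul_eq_mul, mul_comm]
  have h1 : ∫ y, (-lap (fun y => k (coshDist x y)) y + l * k (coshDist x y)) * g y ∂volH
      = l * ∫ y, g y • k (coshDist x y) ∂volH
        - ∫ y, g y • lap (fun y => k (coshDist x y)) y ∂volH := by
    rw [← integral_const_mul, ← integral_sub (hi.const_mul l) hA]
    refine integral_congr_ae (Eventually.of_forall fun y => ?_)
    simp only [smul_eq_mul]
    ring
  linarith

/-- The smoothed function solves `ΔG = l G` classically and stays in `L²`, so uniqueness for regular
solutions applies. -/
theorem integral_coshDist_eq_zero {g : Pt → ℝ} {l : ℝ} (hl : 0 < l) (hg : MemLp g 2 volH)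
    (h : ∀ φ : Pt → ℝ, ContDiff ℝ ∞ φ → HasCompactSupport φ →
      ∫ x, (-lap φ x + l * φ x) * g x ∂volH = 0)
    {k : ℝ → ℝ} (hk : ContDiff ℝ ∞ k) (hk0 : ∀ p, 0 ≤ k p) {R : ℝ} (hR : ∀ p, R ≤ p → k p = 0) :
    ∀ᵐ x ∂volH, ∫ y, g y • k (coshDist x y) ∂volH = 0 := by
  have hK := isLocalKernel_coshDist hk hR
  have hgl : LocallyIntegrable g volH := hg.locallyIntegrable (by norm_num)
  refine ae_eq_zero_of_lap_eq hl (hK.contDiff_integral hgl) (fun i => ?_)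
    (lap_integral_coshDist hgl h hk hR) (memLp_integral_coshDist hk hR hk0 hg)
  rw [hK.partialD_integral hgl i]
  exact (hK.partialD i).contDiff_integral hgl

/-- By Fubini and the symmetry of the setting, smoothing `g` and testing against `φ` equals testing
`g` against the smoothed `φ`. -/
theorem integral_mul_radial_average_eq_zero {g : Pt → ℝ} (hg : LocallyIntegrable g volH)
    {k : ℝ → ℝ} (hk : ContDiff ℝ ∞ k) {R : ℝ} (hR : ∀ p, R ≤ p → k p = 0)
    (h : ∀ᵐ x ∂volH, ∫ y, g y • k (coshDist x y) ∂volH = 0) {φ : Pt → ℝ} (hφ : Continuous φ)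
    (hφs : HasCompactSupport φ) :
    ∫ y, (∫ x, φ x * k (coshDist x y) ∂volH) * g y ∂volH = 0 := by
  have hK := isLocalKernel_coshDist hk hR
  obtain ⟨N, hN⟩ := hφs.isCompact.isBounded.subset_ball 0
  obtain ⟨b, hb, hbd⟩ := exists_dominating hK.contDiff.continuous hK.support_ball hg N
  have hint : Integrable (Function.uncurry fun x y => φ x * (g y • k (coshDist x y)))
      (volH.prod volH) := by
    have hφi : Integrable φ volH := hφ.integrable_of_hasCompactSupport hφs
    refine (hφi.norm.mul_prod hb).mono' ?_ (Eventually.of_forall fun p => ?_)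
    · exact (hφ.comp continuous_fst).aestronglyMeasurable.mul
        (hg.aestronglyMeasurable.comp_snd.smul hK.contDiff.continuous.aestronglyMeasurable)
    · by_cases hp : p.1 ∈ tsupport φ
      · simp only [Function.uncurry, norm_mul]
        exact mul_le_mul_of_nonneg_left (hbd p.1 (hN hp) p.2) (norm_nonneg _)
      · simp [Function.uncurry, image_eq_zero_of_notMem_tsupport hp]
  have hswap := integral_integral_swap hint
  have e1 : ∫ x, ∫ y, φ x * (g y • k (coshDist x y)) ∂volH ∂volH = 0 := by
    refine integral_eq_zero_of_ae ?_
    filter_upwards [h] with x hx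
    rw [integral_const_mul, hx, mul_zero]
    rfl
  rw [← e1, hswap]
  refine integral_congr_ae (Eventually.of_forall fun y => ?_)
  simp only
  rw [← integral_mul_const]
  refine integral_congr_ae (Eventually.of_forall fun x => ?_)
  simp only [smul_eq_mul]
  ring

theorem abs_radial_average_le {k : ℝ → ℝ} (hk0 : ∀ p, 0 ≤ k p) {y : Pt}
    (hki : ∫ x, k (coshDist x y) ∂volH = 1) {φ : Pt → ℝ} {c : ℝ}
    (h : ∀ x, k (coshDist x y) ≠ 0 → |φ x| ≤ c) :
    |∫ x, φ x * k (coshDist x y) ∂volH| ≤ c := by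
  -- A non-integrable function has integral `0` by convention, so total mass `1` already forces
  -- integrability.
  have hI : Integrable (fun x => k (coshDist x y)) volH := by
    by_contra hn
    rw [integral_undef hn] at hki
    exact zero_ne_one hki
  have h1 := norm_integral_le_of_norm_le (f := fun x => φ x * k (coshDist x y)) (hI.const_mul c)
    (Eventually.of_forall fun x => ?_)
  · rwa [integral_const_mul, hki, mul_one] at h1
  · rw [norm_mul, Real.norm_of_nonneg (hk0 _)]
    by_cases hx : k (coshDist x y) = 0
    · simp [hx]
    · exact mul_le_mul_of_nonneg_right (h x hx) (hk0 _)

/-- Radial averages of `g` vanish at every scale. Transposed to a test function `φ`, they converge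
to `φ` pointwise and with support in one ball, so `g` annihilates every `φ`. -/
theorem ae_eq_zero_of_weak_resolvent {g : Pt → ℝ} {l : ℝ} (hl : 0 < l) (hg : MemLp g 2 volH)
    (h : ∀ φ : Pt → ℝ, ContDiff ℝ ∞ φ → HasCompactSupport φ →
      ∫ x, (-lap φ x + l * φ x) * g x ∂volH = 0) : ∀ᵐ x ∂volH, g x = 0 := by
  have hgl : LocallyIntegrable g volH := hg.locallyIntegrable (by norm_num)
  refine ae_eq_zero_of_integral_contDiff_smul_eq_zero hgl fun φ hφ hφs => ?_
  choose k hkc hk0 hkR hki using fun n : ℕ => exists_radial_bump (ε := (n + 1 : ℝ)⁻¹) (by positivity)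
  have hz : ∀ n, ∫ y, (∫ x, φ x * k n (coshDist x y) ∂volH) * g y ∂volH = 0 := fun n =>
    integral_mul_radial_average_eq_zero hgl (hkc n) (hkR n)
      (integral_coshDist_eq_zero hl hg h (hkc n) (hk0 n) (hkR n)) hφ.continuous hφs
  have hsupp : ∀ n x y, k n (coshDist x y) ≠ 0 → coshDist x y < 1 + (n + 1 : ℝ)⁻¹ :=
    fun n x y hne => not_le.1 fun hle => hne (hkR n _ hle)
  have hinv : ∀ n : ℕ, (n + 1 : ℝ)⁻¹ ≤ 1 := fun n => inv_le_one_of_one_le₀ (by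
    have := n.cast_nonneg (α := ℝ)
    linarith)
  obtain ⟨C, hC⟩ := hφs.exists_bound_of_continuous hφ.continuous
  obtain ⟨N, hN⟩ := hφs.isCompact.isBounded.subset_closedBall 0
  obtain ⟨M, hM⟩ := exists_ball_of_coshDist_le N 2
  have hlim : ∀ y, Tendsto (fun n => ∫ x, φ x * k n (coshDist x y) ∂volH) atTop (𝓝 (φ y)) := by
    intro y
    rw [Metric.tendsto_atTop]
    intro η hη
    obtain ⟨ε, hε, hN'⟩ := eventually_of_coshDist_lt
      (hφ.continuous.continuousAt.preimage_mem_nhds (Metric.ball_mem_nhds (φ y) (half_pos hη)))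
    obtain ⟨n₀, hn₀⟩ := exists_nat_one_div_lt hε
    refine ⟨n₀, fun n hn => ?_⟩
    have hle : (n + 1 : ℝ)⁻¹ ≤ ε := by
      refine le_trans ?_ (one_div (n₀ + 1 : ℝ) ▸ hn₀.le)
      have : (n₀ : ℝ) ≤ n := by exact_mod_cast hn
      gcongr
    have hI : Integrable (fun x => k n (coshDist x y)) volH := by
      by_contra hni
      have := hki n y
      rw [integral_undef hni] at this
      exact zero_ne_one this
    have hI' : Integrable (fun x => φ x * k n (coshDist x y)) volH :=
      hI.bdd_mul hφ.continuous.aestronglyMeasurable (c := C) (Eventually.of_forall hC)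
    have e : (∫ x, φ x * k n (coshDist x y) ∂volH) - φ y
        = ∫ x, (φ x - φ y) * k n (coshDist x y) ∂volH := by
      simp only [sub_mul]
      rw [integral_sub hI' (hI.const_mul _), integral_const_mul, hki, mul_one]
    rw [Real.dist_eq, e]
    refine (abs_radial_average_le (φ := fun x => φ x - φ y) (c := η / 2) (hk0 n) (hki n y)
      fun x hx => ?_).trans_lt (half_lt_self hη)
    have := hN' x ((hsupp n x y hx).trans_le (by linarith))
    exact (le_of_lt (by simpa [Real.dist_eq] using this))
  have hdom := tendsto_integral_of_dominated_convergence
    (F := fun n y => (∫ x, φ x * k n (coshDist x y) ∂volH) * g y) (f := fun y => φ y * g y)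
    -- All kernels are supported in `cosh d < 2`, so the averages of `φ` have supports in a common
    -- ball; as averages they keep the bound `C`.
    (μ := volH) ((Metric.closedBall (0 : Pt) M).indicator fun y => C * ‖g y‖) ?_ ?_ ?_ ?_
  · simp only [hz] at hdom
    exact (tendsto_nhds_unique hdom tendsto_const_nhds)
  · intro n
    have hφl : LocallyIntegrable φ volH := hφ.continuous.locallyIntegrable
    have hc := ((isLocalKernel_coshDist (hkc n) (hkR n)).contDiff_integral hφl).continuous
    have e : (fun y => ∫ x, φ x • k n (coshDist y x) ∂volH)
        = fun y => ∫ x, φ x * k n (coshDist x y) ∂volH := by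
      funext y
      simp only [coshDist_comm y, smul_eq_mul]
    rw [e] at hc
    exact hc.aestronglyMeasurable.mul hgl.aestronglyMeasurable
  · rw [integrable_indicator_iff measurableSet_closedBall]
    exact (hgl.integrableOn_isCompact (isCompact_closedBall 0 M)).norm.const_mul C
  · refine fun n => Eventually.of_forall fun y => ?_
    rw [norm_mul]
    by_cases hy : y ∈ Metric.closedBall (0 : Pt) M
    · rw [indicator_of_mem hy]
      exact mul_le_mul_of_nonneg_right
        (abs_radial_average_le (hk0 n) (hki n y) fun x _ => hC x) (norm_nonneg _)
    · have h0 : ∀ x, φ x * k n (coshDist x y) = 0 := by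
        intro x
        by_contra hne
        have hx : x ∈ tsupport φ := subset_tsupport _ (left_ne_zero_of_mul hne)
        exact hy (hM x (hN hx) y ((hsupp n x y (right_ne_zero_of_mul hne)).le.trans
          (by linarith [hinv n])))
      rw [indicator_of_notMem hy]
      simp [h0]
  · exact Eventually.of_forall fun y => (hlim y).mul_const _

/-! ### The quadratic form of `-Δ + W` -/

/-- The divergence `h^{ii} (∂_i a_i - Γ^k_{ii} a_k)` of the connection one-form of `Q`. -/
noncomputable def divScalar (Q : Pt → Pt) (x : Pt) : ℝ :=
  Real.exp (2 * x 1) * partialD 0 (connScalar Q 0) x - connScalar Q 1 x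
    + partialD 1 (connScalar Q 1) x

theorem divConn_connInf {Q : Pt → Pt} (hQ : ContDiff ℝ ∞ Q) (x : Pt) :
    divConn (connInf Q) x = !![0, -divScalar Q x; divScalar Q x, 0] := by
  have hd : ∀ y, DifferentiableAt ℝ Q y := fun y => hQ.differentiable (by simp) y
  have e : Real.exp (2 * x 1) * Real.exp (-(2 * x 1)) = 1 := by rw [← Real.exp_add]; simp
  have h1 : ∀ i k j, (fun y => connInf Q i y k j)
      = fun y => (!![0, -connScalar Q i y; connScalar Q i y, 0] : Matrix (Fin 2) (Fin 2) ℝ) k j := by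
    intro i k j; funext y; rw [connInf_eq (hd y)]
  have hz : ∀ i, partialD i (fun _ : Pt => (0 : ℝ)) x = 0 := fun i => by simp [partialD]
  have hn : ∀ i (f : Pt → ℝ), partialD i (fun y => -f y) x = -partialD i f x := fun i f => by
    simp [partialD, fderiv_fun_neg]
  ext k j
  simp only [divConn, h1, connInf_eq (hd x), Fin.sum_univ_two, Matrix.add_apply, Matrix.smul_apply,
    Matrix.sub_apply, Matrix.of_apply, divScalar]
  fin_cases k <;> fin_cases j <;> simp [metricInv, hz, hn] <;>
    first | linear_combination (connScalar Q 1 x) * e | linear_combination (-connScalar Q 1 x) * e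

/-- The components of `W ψ`. -/
theorem magneticW_zero {Q : Pt → Pt} (hQ : ContDiff ℝ ∞ Q) (ψ : Pt → Fin 2 → ℂ) (x : Pt) :
    magneticW Q ψ x 0 = ∑ i, (metricInv x i : ℂ) * (2 * connScalar Q i x * partialD i ψ x 1
      + (connScalar Q i x ^ 2 + partialD i Q x 1 ^ 2) * ψ x 0
      - connScalar Q i x * partialD i Q x 1 * ψ x 1) + divScalar Q x * ψ x 1 := by
  have hd : DifferentiableAt ℝ Q x := hQ.differentiable (by simp) x
  simp only [magneticW, matAct, connInf_eq hd, divConn_connInf hQ, phiInf_eq, wedge,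
    Fin.sum_univ_two, dotProduct, Pi.add_apply, Pi.sub_apply, Pi.neg_apply, Pi.smul_apply,
    mulVec_two, Matrix.map_apply, Complex.coe_algebraMap, Pi.star_apply, Complex.real_smul,
    neg_smul]
  simp
  ring

theorem magneticW_one {Q : Pt → Pt} (hQ : ContDiff ℝ ∞ Q) (ψ : Pt → Fin 2 → ℂ) (x : Pt) :
    magneticW Q ψ x 1 = ∑ i, (metricInv x i : ℂ) * (-2 * connScalar Q i x * partialD i ψ x 0
      + 2 * connScalar Q i x ^ 2 * ψ x 1
      - connScalar Q i x * partialD i Q x 1 * ψ x 0) - divScalar Q x * ψ x 0 := by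
  have hd : DifferentiableAt ℝ Q x := hQ.differentiable (by simp) x
  simp only [magneticW, matAct, connInf_eq hd, divConn_connInf hQ, phiInf_eq, wedge,
    Fin.sum_univ_two, dotProduct, Pi.add_apply, Pi.sub_apply, Pi.neg_apply, Pi.smul_apply,
    mulVec_two, Matrix.map_apply, Complex.coe_algebraMap, Pi.star_apply, Complex.real_smul,
    neg_smul]
  simp
  ring

/-- The Hermitian product of `ℂ²`, linear in the second slot. -/
noncomputable def pair (u v : Fin 2 → ℂ) : ℂ := starRingEnd ℂ (u 0) * v 0 + starRingEnd ℂ (u 1) * v 1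

/-- The covariant derivative `D_i = ∂_i + A_i^∞`. -/
noncomputable def gradA (Q : Pt → Pt) (i : Fin 2) (ψ : Pt → Fin 2 → ℂ) (x : Pt) : Fin 2 → ℂ :=
  ![partialD i ψ x 0 - connScalar Q i x * ψ x 1, partialD i ψ x 1 + connScalar Q i x * ψ x 0]

/-- The density of the form of `-Δ + W`. -/
noncomputable def formDensity (Q : Pt → Pt) (χ ψ : Pt → Fin 2 → ℂ) (x : Pt) : ℂ :=
  ∑ i, (metricInv x i : ℂ) * (pair (gradA Q i χ x) (gradA Q i ψ x)
    + (connScalar Q i x ^ 2 + partialD i Q x 1 ^ 2) * pair (χ x) (ψ x)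
    - (connScalar Q i x * starRingEnd ℂ (χ x 0) + partialD i Q x 1 * starRingEnd ℂ (χ x 1))
      * (connScalar Q i x * ψ x 0 + partialD i Q x 1 * ψ x 1))

theorem contDiff_gradA {Q : Pt → Pt} (hQ : ContDiff ℝ ∞ Q) {ψ : Pt → Fin 2 → ℂ}
    (hψ : ContDiff ℝ ∞ ψ) (i : Fin 2) : ContDiff ℝ ∞ (gradA Q i ψ) := by
  have ha : ContDiff ℝ ∞ fun x => (connScalar Q i x : ℂ) :=
    Complex.ofRealCLM.contDiff.comp (contDiff_connScalar hQ i)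
  have hp := contDiff_pi.1 (contDiff_partialD hψ i)
  have h := contDiff_pi.1 hψ
  refine contDiff_pi.2 fun k => ?_
  fin_cases k
  · exact (hp 0).sub (ha.mul (h 1))
  · exact (hp 1).add (ha.mul (h 0))

/-- The flux whose divergence relates the form to the operator. -/
theorem partialD_flux {Q : Pt → Pt} (hQ : ContDiff ℝ ∞ Q) {χ ψ : Pt → Fin 2 → ℂ}
    (hχ : ContDiff ℝ ∞ χ) (hψ : ContDiff ℝ ∞ ψ) (c : ℝ) (i : Fin 2) (x : Pt) :
    partialD i (fun x => (Real.exp (c * x 1) : ℂ) * pair (χ x) (gradA Q i ψ x)) x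
      = Real.exp (c * x 1) * (c * (Pi.single i 1 : Pt) 1 * pair (χ x) (gradA Q i ψ x)
        + pair (gradA Q i χ x) (gradA Q i ψ x) + pair (χ x) (partialD i (partialD i ψ) x)
        + starRingEnd ℂ (χ x 0) * (-2 * connScalar Q i x * partialD i ψ x 1
          - partialD i (connScalar Q i) x * ψ x 1 - connScalar Q i x ^ 2 * ψ x 0)
        + starRingEnd ℂ (χ x 1) * (2 * connScalar Q i x * partialD i ψ x 0
          + partialD i (connScalar Q i) x * ψ x 0 - connScalar Q i x ^ 2 * ψ x 1)) := by
  have hχd : ∀ k, HasDerivAt (fun τ : ℝ => starRingEnd ℂ (χ (x + τ • Pi.single i 1) k))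
      (starRingEnd ℂ (partialD i χ x k)) 0 := fun k =>
    (hasDerivAt_pi.1 (hasDerivAt_partialD (hχ.differentiable (by simp) x) i) k).star
  have hψd := hasDerivAt_pi.1 (hasDerivAt_partialD (hψ.differentiable (by simp) x) i)
  have hψdd := hasDerivAt_pi.1 (hasDerivAt_partialD
    ((contDiff_partialD hψ i).differentiable (by simp) x) i)
  have ha := (hasDerivAt_partialD ((contDiff_connScalar hQ i).differentiable (by simp) x) i).ofReal_comp
  have hw := ((hasDerivAt_line x i 1).const_mul c).exp.ofReal_comp
  have hflux : ContDiff ℝ ∞ fun x => (Real.exp (c * x 1) : ℂ) * pair (χ x) (gradA Q i ψ x) := by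
    have h1 : ContDiff ℝ ∞ fun x : Pt => (Real.exp (c * x 1) : ℂ) :=
      Complex.ofRealCLM.contDiff.comp (contDiff_const.mul (contDiff_apply ℝ ℝ 1)).exp
    have h2 : ∀ k, ContDiff ℝ ∞ fun x => starRingEnd ℂ (χ x k) := fun k =>
      Complex.conjCLE.contDiff.comp (contDiff_pi.1 hχ k)
    have h3 := contDiff_pi.1 (contDiff_gradA hQ hψ i)
    exact h1.mul (((h2 0).mul (h3 0)).add ((h2 1).mul (h3 1)))
  refine (hasDerivAt_partialD (hflux.differentiable (by simp) x) i).unique ?_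
  have h := hw.mul (((hχd 0).mul ((hψdd 0).sub (ha.mul (hψd 1)))).add
    ((hχd 1).mul ((hψdd 1).add (ha.mul (hψd 0)))))
  refine h.congr_deriv ?_
  simp only [pair, gradA, zero_smul, add_zero, Matrix.cons_val_zero, Matrix.cons_val_one, map_add,
    map_sub, map_mul, Complex.conj_ofReal]
  simp
  ring

theorem contDiff_divScalar {Q : Pt → Pt} (hQ : ContDiff ℝ ∞ Q) : ContDiff ℝ ∞ (divScalar Q) := by
  have hw : ContDiff ℝ ∞ fun x : Pt => Real.exp (2 * x 1) :=
    (contDiff_const.mul (contDiff_apply ℝ ℝ 1)).exp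
  exact ((hw.mul (contDiff_partialD (contDiff_connScalar hQ 0) 0)).sub
    (contDiff_connScalar hQ 1)).add (contDiff_partialD (contDiff_connScalar hQ 1) 1)

theorem contDiff_metricInv (i : Fin 2) : ContDiff ℝ ∞ fun x : Pt => metricInv x i := by
  fin_cases i
  · exact (contDiff_const.mul (contDiff_apply ℝ ℝ 1)).exp
  · exact contDiff_const

theorem contDiff_magneticW {Q : Pt → Pt} (hQ : ContDiff ℝ ∞ Q) {ψ : Pt → Fin 2 → ℂ}
    (hψ : ContDiff ℝ ∞ ψ) : ContDiff ℝ ∞ (magneticW Q ψ) := by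
  have hr : ∀ {f : Pt → ℝ}, ContDiff ℝ ∞ f → ContDiff ℝ ∞ fun x => (f x : ℂ) := fun hf =>
    Complex.ofRealCLM.contDiff.comp hf
  have ha := fun i => hr (contDiff_connScalar hQ i)
  have hb := fun i => hr (contDiff_pi.1 (contDiff_partialD hQ i) 1)
  have hm := fun i => hr (contDiff_metricInv i)
  have hd := hr (contDiff_divScalar hQ)
  have hp := fun i => contDiff_pi.1 (contDiff_partialD hψ i)
  have h := contDiff_pi.1 hψ
  refine contDiff_pi.2 fun k => ?_
  fin_cases k
  · simp only [Fin.zero_eta, magneticW_zero hQ]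
    exact (ContDiff.sum fun i _ => (hm i).mul ((((contDiff_const.mul (ha i)).mul (hp i 1)).add
      ((((ha i).pow 2).add ((hb i).pow 2)).mul (h 0))).sub (((ha i).mul (hb i)).mul (h 1)))).add
      (hd.mul (h 1))
  · simp only [Fin.mk_one, magneticW_one hQ]
    exact (ContDiff.sum fun i _ => (hm i).mul ((((contDiff_const.mul (ha i)).mul (hp i 0)).add
      ((contDiff_const.mul ((ha i).pow 2)).mul (h 1))).sub (((ha i).mul (hb i)).mul (h 0)))).sub
      (hd.mul (h 0))

theorem magneticW_eq_zero {Q : Pt → Pt} (hQ : ContDiff ℝ ∞ Q) {ψ : Pt → Fin 2 → ℂ} {x : Pt}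
    (hx : x ∉ tsupport ψ) : magneticW Q ψ x = 0 := by
  have h0 : ψ x = 0 := image_eq_zero_of_notMem_tsupport hx
  have h1 : ∀ i, partialD i ψ x = 0 := fun i =>
    image_eq_zero_of_notMem_tsupport fun h => hx (tsupport_partialD_subset ψ i h)
  funext k
  fin_cases k
  · simp [magneticW_zero hQ, h0, h1]
  · simp [magneticW_one hQ, h0, h1]

theorem continuous_pair {u v : Pt → Fin 2 → ℂ} (hu : Continuous u) (hv : Continuous v) :
    Continuous fun x => pair (u x) (v x) := by
  have h1 := continuous_pi_iff.1 hu
  have h2 := continuous_pi_iff.1 hv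
  exact ((Complex.continuous_conj.comp (h1 0)).mul (h2 0)).add
    ((Complex.continuous_conj.comp (h1 1)).mul (h2 1))

theorem integrable_pair {u v : Pt → Fin 2 → ℂ} (hu : Continuous u) (hv : Continuous v)
    (hs : HasCompactSupport u) : Integrable (fun x => pair (u x) (v x)) volH := by
  refine (continuous_pair hu hv).integrable_of_hasCompactSupport
    (HasCompactSupport.intro hs fun x hx => ?_)
  simp [pair, image_eq_zero_of_notMem_tsupport hx]

/-- The pointwise form of Green's identity. -/
theorem formDensity_eq {Q : Pt → Pt} (hQ : ContDiff ℝ ∞ Q) {χ ψ : Pt → Fin 2 → ℂ}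
    (hχ : ContDiff ℝ ∞ χ) (hψ : ContDiff ℝ ∞ ψ) (x : Pt) :
    (Real.exp (-x 1) : ℂ) * formDensity Q χ ψ x
      -- The two boundary terms carry the weights `√h h^{ii}`, i.e. `e^{x₂}` and `e^{-x₂}`, so their
      -- sum is a divergence for the hyperbolic volume.
      = Real.exp (-x 1) * pair (χ x) (-lap ψ x + magneticW Q ψ x)
        + (partialD 0 (fun x => (Real.exp (1 * x 1) : ℂ) * pair (χ x) (gradA Q 0 ψ x)) x
          + partialD 1 (fun x => (Real.exp (-1 * x 1) : ℂ) * pair (χ x) (gradA Q 1 ψ x)) x) := by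
  rw [partialD_flux hQ hχ hψ, partialD_flux hQ hχ hψ]
  have e1 : Real.exp (1 * x 1) = Real.exp (-x 1) * Real.exp (2 * x 1) := by
    rw [← Real.exp_add]; ring_nf
  have e2 : Real.exp (-1 * x 1) = Real.exp (-x 1) := by ring_nf
  have h0 : metricInv x 0 = Real.exp (2 * x 1) := rfl
  have h1 : metricInv x 1 = 1 := rfl
  rw [e1, e2]
  simp only [formDensity, pair, Pi.add_apply, Pi.neg_apply, magneticW_zero hQ, magneticW_one hQ,
    lap_eq, Pi.sub_apply, Pi.smul_apply, Fin.sum_univ_two, h0, h1, divScalar, gradA,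
    Matrix.cons_val_zero, Matrix.cons_val_one, map_add, map_sub, map_mul, Complex.conj_ofReal,
    Complex.real_smul]
  push_cast
  generalize (Real.exp (-x 1) : ℂ) = E
  generalize (Real.exp (2 * x 1) : ℂ) = F
  simp
  ring

theorem integral_add_add_eq_left {α : Type*} [MeasurableSpace α] {μ : Measure α} {A B C : α → ℂ}
    (hA : Integrable A μ) (hB : Integrable B μ) (hC : Integrable C μ) (hB0 : ∫ x, B x ∂μ = 0)
    (hC0 : ∫ x, C x ∂μ = 0) : ∫ x, (A x + (B x + C x)) ∂μ = ∫ x, A x ∂μ := by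
  have h1 : ∫ x, (A x + (B x + C x)) ∂μ = _ := integral_add hA (hB.add hC)
  have h2 : ∫ x, (B x + C x) ∂μ = _ := integral_add hB hC
  rw [h1, h2, hB0, hC0, add_zero, add_zero]

/-- Green's identity for `-Δ + W`. -/
theorem integral_pair_eq_integral_formDensity {Q : Pt → Pt} (hQ : ContDiff ℝ ∞ Q)
    {χ ψ : Pt → Fin 2 → ℂ} (hχ : ContDiff ℝ ∞ χ) (hχs : HasCompactSupport χ)
    (hψ : ContDiff ℝ ∞ ψ) :
    ∫ x, pair (χ x) (-lap ψ x + magneticW Q ψ x) ∂volH = ∫ x, formDensity Q χ ψ x ∂volH := by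
  have hF : ∀ (c : ℝ) i, ContDiff ℝ 1
      fun x => (Real.exp (c * x 1) : ℂ) * pair (χ x) (gradA Q i ψ x) := by
    intro c i
    have h1 : ContDiff ℝ ∞ fun x : Pt => (Real.exp (c * x 1) : ℂ) :=
      Complex.ofRealCLM.contDiff.comp (contDiff_const.mul (contDiff_apply ℝ ℝ 1)).exp
    have h2 : ∀ k, ContDiff ℝ ∞ fun x => starRingEnd ℂ (χ x k) := fun k =>
      Complex.conjCLE.contDiff.comp (contDiff_pi.1 hχ k)
    have h3 := contDiff_pi.1 (contDiff_gradA hQ hψ i)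
    exact (h1.mul (((h2 0).mul (h3 0)).add ((h2 1).mul (h3 1)))).of_le (by simp)
  have hFs : ∀ (c : ℝ) i, HasCompactSupport
      fun x => (Real.exp (c * x 1) : ℂ) * pair (χ x) (gradA Q i ψ x) := fun c i =>
    HasCompactSupport.intro hχs fun x hx => by
      simp [pair, image_eq_zero_of_notMem_tsupport hx]
  have hi : ∀ (c : ℝ) i, Integrable (partialD i
      fun x => (Real.exp (c * x 1) : ℂ) * pair (χ x) (gradA Q i ψ x)) := fun c i =>
    (continuous_partialD (hF c i) i).integrable_of_hasCompactSupport
      (hasCompactSupport_partialD (hFs c i) i)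
  have hB := integrable_pair hχ.continuous
    ((contDiff_lap hψ).neg.add (contDiff_magneticW hQ hψ)).continuous hχs
  rw [integrable_volH_iff] at hB
  rw [integral_volH, integral_volH]
  have e : ∀ x, Real.exp (-x 1) • formDensity Q χ ψ x = _ := fun x =>
    (Complex.real_smul).trans (formDensity_eq hQ hχ hψ x)
  simp only [e]
  exact (integral_add_add_eq_left hB (hi 1 0) (hi (-1) 1)
    (integral_partialD_eq_zero (hF 1 0) (hFs 1 0) 0)
    (integral_partialD_eq_zero (hF (-1) 1) (hFs (-1) 1) 1)).symm

/-! ### The operators on test functions -/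

/-- Continuous compactly supported maps `ℍ² → ℂ²`. -/
noncomputable def compSpace : Submodule ℂ (Pt → Fin 2 → ℂ) where
  carrier := {f | Continuous f ∧ HasCompactSupport f}
  add_mem' h h' := ⟨h.1.add h'.1, h.2.add h'.2⟩
  zero_mem' := ⟨continuous_const, HasCompactSupport.zero⟩
  smul_mem' c f h := ⟨h.1.const_smul c, h.2.mono fun x hx hx' => hx (by simp [hx'])⟩

/-- Test functions. -/
noncomputable def testSpace : Submodule ℂ (Pt → Fin 2 → ℂ) where
  carrier := {ψ | IsTest ψ}
  add_mem' h h' := ⟨h.1.add h'.1, h.2.add h'.2⟩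
  zero_mem' := ⟨contDiff_const, HasCompactSupport.zero⟩
  smul_mem' c f h := ⟨h.1.const_smul c, h.2.mono fun x hx hx' => hx (by simp [hx'])⟩

theorem memLp_of_mem_compSpace {f : Pt → Fin 2 → ℂ} (hf : f ∈ compSpace) :
    MemLp (fun x => (WithLp.toLp 2 (f x) : EuclideanSpace ℂ (Fin 2))) 2 volH := by
  have hc : Continuous fun x => (WithLp.toLp 2 (f x) : EuclideanSpace ℂ (Fin 2)) :=
    (PiLp.continuous_toLp 2 _).comp hf.1
  refine hc.memLp_of_hasCompactSupport (HasCompactSupport.intro hf.2 fun x hx => ?_)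
  rw [image_eq_zero_of_notMem_tsupport hx]
  rfl

/-- The class in `L²` of a continuous compactly supported map. -/
noncomputable def toL2 : compSpace →ₗ[ℂ] L2H where
  toFun f := (memLp_of_mem_compSpace f.2).toLp _
  map_add' _ _ := rfl
  map_smul' _ _ := rfl

theorem coeFn_toL2 (f : compSpace) :
    toL2 f =ᵐ[volH] fun x => (WithLp.toLp 2 (f.1 x) : EuclideanSpace ℂ (Fin 2)) :=
  (memLp_of_mem_compSpace f.2).coeFn_toLp

theorem eq_toL2_iff (f : compSpace) (v : L2H) :
    (v =ᵐ[volH] fun x => (WithLp.toLp 2 (f.1 x) : EuclideanSpace ℂ (Fin 2))) ↔ v = toL2 f := by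
  constructor
  · exact fun h => Lp.ext (h.trans (coeFn_toL2 f).symm)
  · rintro rfl
    exact coeFn_toL2 f

theorem inner_toL2 (f : compSpace) (v : L2H) :
    ⟪toL2 f, v⟫_ℂ = ∫ x, ⟪(WithLp.toLp 2 (f.1 x) : EuclideanSpace ℂ (Fin 2)), v x⟫_ℂ ∂volH := by
  rw [L2.inner_def]
  refine integral_congr_ae ?_
  filter_upwards [coeFn_toL2 f] with x hx
  rw [hx]

theorem inner_eq_pair (u v : EuclideanSpace ℂ (Fin 2)) :
    ⟪u, v⟫_ℂ = pair (fun k => u k) fun k => v k := by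
  simp [PiLp.inner_apply, pair, Fin.sum_univ_two, mul_comm]

theorem inner_toL2_toL2 (f g : compSpace) : ⟪toL2 f, toL2 g⟫_ℂ = ∫ x, pair (f.1 x) (g.1 x) ∂volH := by
  rw [inner_toL2]
  refine integral_congr_ae ?_
  filter_upwards [coeFn_toL2 g] with x hx
  rw [hx, inner_eq_pair]

theorem partialD_add {ψ χ : Pt → Fin 2 → ℂ} (hψ : ContDiff ℝ ∞ ψ) (hχ : ContDiff ℝ ∞ χ) (i : Fin 2) :
    partialD i (ψ + χ) = partialD i ψ + partialD i χ := by
  funext x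
  simp only [partialD]
  rw [fderiv_add (hψ.differentiable (by simp) x) (hχ.differentiable (by simp) x)]
  rfl

theorem partialD_smul {ψ : Pt → Fin 2 → ℂ} (hψ : ContDiff ℝ ∞ ψ) (c : ℂ) (i : Fin 2) :
    partialD i (c • ψ) = c • partialD i ψ := by
  funext x
  simp only [partialD]
  rw [fderiv_const_smul (hψ.differentiable (by simp) x)]
  rfl

theorem lap_add {ψ χ : Pt → Fin 2 → ℂ} (hψ : ContDiff ℝ ∞ ψ) (hχ : ContDiff ℝ ∞ χ) :
    lap (ψ + χ) = lap ψ + lap χ := by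
  funext x k
  simp only [lap_eq, partialD_add hψ hχ,
    partialD_add (contDiff_partialD hψ _) (contDiff_partialD hχ _), Pi.add_apply, Pi.sub_apply,
    Pi.smul_apply, smul_add]
  ring

theorem lap_smul {ψ : Pt → Fin 2 → ℂ} (hψ : ContDiff ℝ ∞ ψ) (c : ℂ) : lap (c • ψ) = c • lap ψ := by
  funext x k
  simp only [lap_eq, partialD_smul hψ, partialD_smul (contDiff_partialD hψ _), Pi.add_apply,
    Pi.sub_apply, Pi.smul_apply, smul_eq_mul, Complex.real_smul]
  ring

/-- The inclusion of test functions. -/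
noncomputable def testIncl : testSpace →ₗ[ℂ] compSpace where
  toFun ψ := ⟨ψ.1, ψ.2.1.continuous, ψ.2.2⟩
  map_add' _ _ := rfl
  map_smul' _ _ := rfl

/-- The operator `-Δ` on test functions. -/
noncomputable def testNegLap : testSpace →ₗ[ℂ] compSpace where
  toFun ψ := ⟨-lap ψ.1, (contDiff_lap ψ.2.1).continuous.neg, (hasCompactSupport_lap ψ.2.2).neg⟩
  map_add' ψ χ := Subtype.ext <| by
    simp [lap_add ψ.2.1 χ.2.1, add_comm]
  map_smul' c ψ := Subtype.ext <| by
    simp [lap_smul ψ.2.1]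

/-- The magnetic operator on test functions. -/
noncomputable def testMagnetic {Q : Pt → Pt} (hQ : ContDiff ℝ ∞ Q) : testSpace →ₗ[ℂ] compSpace where
  toFun ψ := ⟨magneticW Q ψ.1, (contDiff_magneticW hQ ψ.2.1).continuous,
    HasCompactSupport.intro ψ.2.2 fun _ hx => magneticW_eq_zero hQ hx⟩
  map_add' ψ χ := Subtype.ext <| by
    funext x k
    fin_cases k
    · simp [magneticW_zero hQ, partialD_add ψ.2.1 χ.2.1]
      ring
    · simp [magneticW_one hQ, partialD_add ψ.2.1 χ.2.1]
      ring
  map_smul' c ψ := Subtype.ext <| by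
    funext x k
    fin_cases k
    · simp [magneticW_zero hQ, partialD_smul ψ.2.1]
      ring
    · simp [magneticW_one hQ, partialD_smul ψ.2.1]
      ring

/-! ### Symmetry and positivity -/

theorem inner_test_form {Q : Pt → Pt} (hQ : ContDiff ℝ ∞ Q) (χ ψ : testSpace) :
    ⟪toL2 (testIncl χ), toL2 (testNegLap ψ) + toL2 (testMagnetic hQ ψ)⟫_ℂ
      = ∫ x, formDensity Q χ.1 ψ.1 x ∂volH := by
  rw [← map_add, inner_toL2_toL2, ← integral_pair_eq_integral_formDensity hQ χ.2.1 χ.2.2 ψ.2.1]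
  rfl

/-- The form is Hermitian pointwise, which makes `-Δ + W` symmetric on test functions. -/
theorem conj_formDensity (Q : Pt → Pt) (χ ψ : Pt → Fin 2 → ℂ) (x : Pt) :
    starRingEnd ℂ (formDensity Q χ ψ x) = formDensity Q ψ χ x := by
  simp only [formDensity, pair, Fin.sum_univ_two, map_add, map_sub, map_mul, map_pow,
    Complex.conj_ofReal, Complex.conj_conj]
  ring

theorem test_symmetric {Q : Pt → Pt} (hQ : ContDiff ℝ ∞ Q) (ψ χ : testSpace) :
    ⟪toL2 (testNegLap ψ) + toL2 (testMagnetic hQ ψ), toL2 (testIncl χ)⟫_ℂ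
      = ⟪toL2 (testIncl ψ), toL2 (testNegLap χ) + toL2 (testMagnetic hQ χ)⟫_ℂ := by
  rw [← inner_conj_symm, inner_test_form, inner_test_form, ← integral_conj]
  simp only [conj_formDensity]

theorem connScalar_zero (i : Fin 2) (x : Pt) : connScalar (0 : Pt → Pt) i x = 0 := by
  simp [connScalar, partialD]

/-- A constant map has vanishing fields, so every statement about `-Δ + W` specializes to `-Δ` by
taking `Q = 0`. -/
theorem testMagnetic_zero (ψ : testSpace) :
    testMagnetic (Q := (0 : Pt → Pt)) contDiff_const ψ = 0 := by
  refine Subtype.ext ?_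
  funext x k
  have h0 : ∀ i, partialD i (0 : Pt → Pt) x = 0 := fun i => by simp [partialD]
  have h1 : ∀ i, connScalar (0 : Pt → Pt) i = fun _ => 0 := fun i => funext (connScalar_zero i)
  have h2 : divScalar (0 : Pt → Pt) x = 0 := by
    simp [divScalar, h1, partialD]
  change magneticW (0 : Pt → Pt) ψ.1 x k = 0
  fin_cases k
  · simp [magneticW_zero (Q := (0 : Pt → Pt)) contDiff_const, h0, h1, h2]
  · simp [magneticW_one (Q := (0 : Pt → Pt)) contDiff_const, h0, h1, h2]

theorem testNegLap_symmetric (ψ χ : testSpace) :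
    ⟪toL2 (testNegLap ψ), toL2 (testIncl χ)⟫_ℂ = ⟪toL2 (testIncl ψ), toL2 (testNegLap χ)⟫_ℂ := by
  have h := test_symmetric (Q := (0 : Pt → Pt)) contDiff_const ψ χ
  simpa only [testMagnetic_zero, map_zero, add_zero] using h

/-- The squared norm of `ℂ²`. -/
noncomputable def sqNorm (u : Fin 2 → ℂ) : ℝ := Complex.normSq (u 0) + Complex.normSq (u 1)

theorem sqNorm_nonneg (u : Fin 2 → ℂ) : 0 ≤ sqNorm u :=
  add_nonneg (Complex.normSq_nonneg _) (Complex.normSq_nonneg _)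

theorem pair_self (u : Fin 2 → ℂ) : pair u u = sqNorm u := by
  simp [pair, sqNorm, Complex.normSq_eq_conj_mul_self]

/-- Lagrange's identity `(a² + b²) |ψ|² - |a ψ₁ + b ψ₂|² = |b ψ₁ - a ψ₂|²`, in the components of
`ψ`, turns the curvature contribution into a square: the negative curvature of the target makes the
form nonnegative. -/
theorem formDensity_self (Q : Pt → Pt) (ψ : Pt → Fin 2 → ℂ) (x : Pt) :
    formDensity Q ψ ψ x = ((∑ i, metricInv x i * (sqNorm (gradA Q i ψ x)
      + Complex.normSq (partialD i Q x 1 * ψ x 0 - connScalar Q i x * ψ x 1)) : ℝ) : ℂ) := by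
  simp only [formDensity, pair_self, Fin.sum_univ_two]
  push_cast
  simp only [sqNorm, Complex.ofReal_add, Complex.normSq_eq_conj_mul_self, map_sub, map_mul,
    Complex.conj_ofReal]
  ring

theorem norm_toL2_sq (f : compSpace) : ‖toL2 f‖ ^ 2 = ∫ x, sqNorm (f.1 x) ∂volH := by
  have h := inner_toL2_toL2 f f
  simp only [pair_self] at h
  rw [inner_self_eq_norm_sq_to_K, integral_complex_ofReal] at h
  exact Complex.ofReal_injective ((Complex.ofReal_pow _ _).trans h)

theorem re_inner_test_form {Q : Pt → Pt} (hQ : ContDiff ℝ ∞ Q) (ψ : testSpace) :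
    (⟪toL2 (testIncl ψ), toL2 (testNegLap ψ) + toL2 (testMagnetic hQ ψ)⟫_ℂ).re
      = ∫ x, ∑ i, metricInv x i * (sqNorm (gradA Q i ψ.1 x)
        + Complex.normSq (partialD i Q x 1 * ψ.1 x 0 - connScalar Q i x * ψ.1 x 1)) ∂volH := by
  rw [inner_test_form]
  simp only [formDensity_self]
  rw [integral_complex_ofReal, Complex.ofReal_re]

theorem re_inner_testNegLap (ψ : testSpace) :
    (⟪toL2 (testIncl ψ), toL2 (testNegLap ψ)⟫_ℂ).re
      = ∫ x, ∑ i, metricInv x i * sqNorm (partialD i ψ.1 x) ∂volH := by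
  have h := re_inner_test_form (Q := (0 : Pt → Pt)) contDiff_const ψ
  simp only [testMagnetic_zero, map_zero, add_zero] at h
  rw [h]
  have h0 : ∀ i x, partialD i (0 : Pt → Pt) x = 0 := fun i x => by simp [partialD]
  simp [gradA, connScalar_zero, h0, sqNorm]

theorem metricInv_nonneg (x : Pt) (i : Fin 2) : 0 ≤ metricInv x i := by
  fin_cases i
  · exact (Real.exp_pos _).le
  · exact zero_le_one

theorem testNegLap_nonneg (ψ : testSpace) :
    0 ≤ (⟪toL2 (testIncl ψ), toL2 (testNegLap ψ)⟫_ℂ).re := by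
  rw [re_inner_testNegLap]
  exact integral_nonneg fun x => Finset.sum_nonneg fun i _ =>
    mul_nonneg (metricInv_nonneg x i) (sqNorm_nonneg _)

theorem continuous_sqNorm {u : Pt → Fin 2 → ℂ} (hu : Continuous u) :
    Continuous fun x => sqNorm (u x) := by
  have h := continuous_pi_iff.1 hu
  exact (Complex.continuous_normSq.comp (h 0)).add (Complex.continuous_normSq.comp (h 1))

theorem integrable_sqNorm {w : Pt → ℝ} (hw : Continuous w) {u : Pt → Fin 2 → ℂ} (hu : Continuous u)
    (hs : HasCompactSupport u) : Integrable (fun x => w x * sqNorm (u x)) volH :=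
  (hw.mul (continuous_sqNorm hu)).integrable_of_hasCompactSupport
    (HasCompactSupport.intro hs fun x hx => by
      simp [sqNorm, image_eq_zero_of_notMem_tsupport hx])

theorem contDiff_exp_mul_sqNorm {ψ : Pt → Fin 2 → ℂ} (hψ : ContDiff ℝ ∞ ψ) :
    ContDiff ℝ ∞ fun x => Real.exp (-1 * x 1) * sqNorm (ψ x) := by
  have h1 : ContDiff ℝ ∞ fun x : Pt => Real.exp (-1 * x 1) :=
    (contDiff_const.mul (contDiff_apply ℝ ℝ 1)).exp
  have h := contDiff_pi.1 hψ
  have hre : ∀ k, ContDiff ℝ ∞ fun x => (ψ x k).re := fun k => Complex.reCLM.contDiff.comp (h k)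
  have him : ∀ k, ContDiff ℝ ∞ fun x => (ψ x k).im := fun k => Complex.imCLM.contDiff.comp (h k)
  simp only [sqNorm, Complex.normSq_apply]
  exact h1.mul ((((hre 0).mul (hre 0)).add ((him 0).mul (him 0))).add
    (((hre 1).mul (hre 1)).add ((him 1).mul (him 1))))

theorem partialD_exp_mul_sqNorm {ψ : Pt → Fin 2 → ℂ} (hψ : ContDiff ℝ ∞ ψ) (x : Pt) :
    partialD 1 (fun x => Real.exp (-1 * x 1) * sqNorm (ψ x)) x
      = Real.exp (-x 1) * (-sqNorm (ψ x) + 2 * ((ψ x 0).re * (partialD 1 ψ x 0).re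
        + (ψ x 0).im * (partialD 1 ψ x 0).im + (ψ x 1).re * (partialD 1 ψ x 1).re
        + (ψ x 1).im * (partialD 1 ψ x 1).im)) := by
  refine partialD_eq_of_hasDerivAt
    ((contDiff_exp_mul_sqNorm hψ).differentiable (by simp) x) ?_
  have h := hasDerivAt_pi.1 (hasDerivAt_partialD (hψ.differentiable (by simp) x) 1)
  have hre : ∀ k, HasDerivAt (fun τ : ℝ => (ψ (x + τ • Pi.single 1 1) k).re)
      (partialD 1 ψ x k).re 0 := fun k => Complex.reCLM.hasFDerivAt.comp_hasDerivAt _ (h k)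
  have him : ∀ k, HasDerivAt (fun τ : ℝ => (ψ (x + τ • Pi.single 1 1) k).im)
      (partialD 1 ψ x k).im 0 := fun k => Complex.imCLM.hasFDerivAt.comp_hasDerivAt _ (h k)
  have hw := ((hasDerivAt_line x 1 1).const_mul (-1)).exp
  simp only [sqNorm, Complex.normSq_apply]
  refine (hw.mul ((((hre 0).mul (hre 0)).add ((him 0).mul (him 0))).add
    (((hre 1).mul (hre 1)).add ((him 1).mul (him 1))))).congr_deriv ?_
  simp
  ring

/-- The spectral gap of the hyperbolic plane, for the magnetic form. -/
theorem quarter_le_form {Q : Pt → Pt} (hQ : ContDiff ℝ ∞ Q) (ψ : testSpace) :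
    1 / 4 * ‖toL2 (testIncl ψ)‖ ^ 2
      ≤ (⟪toL2 (testIncl ψ), toL2 (testNegLap ψ) + toL2 (testMagnetic hQ ψ)⟫_ℂ).re := by
  obtain ⟨ψ, hψ, hψs⟩ := ψ
  have hF := contDiff_exp_mul_sqNorm hψ
  have hFs : HasCompactSupport fun x => Real.exp (-1 * x 1) * sqNorm (ψ x) :=
    HasCompactSupport.intro hψs fun x hx => by
      simp [sqNorm, image_eq_zero_of_notMem_tsupport hx]
  have h0 := integral_partialD_eq_zero (hF.of_le (by simp)) hFs 1
  have hi : Integrable (partialD 1 fun x => Real.exp (-1 * x 1) * sqNorm (ψ x)) :=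
    (contDiff_partialD hF 1).continuous.integrable_of_hasCompactSupport
      (hasCompactSupport_partialD hFs 1)
  have hn : Integrable fun x => Real.exp (-x 1) • (1 / 4 * sqNorm (ψ x)) :=
    (integrable_volH_iff _).1 (integrable_sqNorm continuous_const hψ.continuous hψs)
  rw [norm_toL2_sq, re_inner_test_form, ← integral_const_mul, integral_volH, integral_volH]
  change ∫ x, Real.exp (-x 1) • (1 / 4 * sqNorm (ψ x)) ≤ _
  -- Half of the total derivative `∂₂ (e^{-x₂} |ψ|²)` is added, at no cost to the integral, to make
  -- the inequality hold pointwise.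
  have hsum : ∫ x, (Real.exp (-x 1) • (1 / 4 * sqNorm (ψ x))
      + 1 / 2 * partialD 1 (fun x => Real.exp (-1 * x 1) * sqNorm (ψ x)) x)
      = ∫ x, Real.exp (-x 1) • (1 / 4 * sqNorm (ψ x)) := by
    rw [integral_add hn (hi.const_mul _), integral_const_mul, h0, mul_zero, add_zero]
  rw [← hsum]
  refine integral_mono (hn.add (hi.const_mul _)) ?_ fun x => ?_
  · refine (integrable_volH_iff _).1 (Continuous.integrable_of_hasCompactSupport ?_
      (HasCompactSupport.intro hψs fun x hx => ?_))
    · have ha := fun i => (contDiff_connScalar hQ i).continuous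
      have hb := fun i => continuous_pi_iff.1 (contDiff_partialD hQ i).continuous 1
      have h := continuous_pi_iff.1 hψ.continuous
      refine continuous_finsetSum _ fun i _ => (contDiff_metricInv i).continuous.mul
        ((continuous_sqNorm (contDiff_gradA hQ hψ i).continuous).add
          (Complex.continuous_normSq.comp ?_))
      exact ((Complex.continuous_ofReal.comp (hb i)).mul (h 0)).sub
        ((Complex.continuous_ofReal.comp (ha i)).mul (h 1))
    · have e0 : ψ x = 0 := image_eq_zero_of_notMem_tsupport hx
      have e1 : ∀ i, partialD i ψ x = 0 := fun i =>
        image_eq_zero_of_notMem_tsupport fun h => hx (tsupport_partialD_subset ψ i h)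
      simp [sqNorm, gradA, e0, e1]
  · simp only [partialD_exp_mul_sqNorm hψ, smul_eq_mul]
    have h1 : sqNorm (gradA Q 1 ψ x) ≤ ∑ i, metricInv x i * (sqNorm (gradA Q i ψ x)
        + Complex.normSq (partialD i Q x 1 * ψ x 0 - connScalar Q i x * ψ x 1)) := by
      have e : metricInv x 1 = 1 := rfl
      have a0 := mul_nonneg (metricInv_nonneg x 0) (add_nonneg (sqNorm_nonneg (gradA Q 0 ψ x))
        (Complex.normSq_nonneg (partialD 0 Q x 1 * ψ x 0 - connScalar Q 0 x * ψ x 1)))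
      have a1 := Complex.normSq_nonneg (partialD 1 Q x 1 * ψ x 0 - connScalar Q 1 x * ψ x 1)
      rw [Fin.sum_univ_two, e]
      linarith
    -- This is `|D₂ψ - ψ/2|² ≥ 0`; the connection matrix is real and skew, so it drops out of `Re
    -- ⟨ψ, D₂ψ⟩`.
    have h2 : sqNorm (gradA Q 1 ψ x) ≥ -(1 / 4 * sqNorm (ψ x)) + ((ψ x 0).re * (partialD 1 ψ x 0).re
        + (ψ x 0).im * (partialD 1 ψ x 0).im + (ψ x 1).re * (partialD 1 ψ x 1).re
        + (ψ x 1).im * (partialD 1 ψ x 1).im) := by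
      simp only [sqNorm, gradA, Complex.normSq_apply, Matrix.cons_val_zero, Matrix.cons_val_one]
      simp
      generalize connScalar Q 1 x = a
      generalize (ψ x 0).re = p0
      generalize (ψ x 0).im = q0
      generalize (ψ x 1).re = p1
      generalize (ψ x 1).im = q1
      generalize (partialD 1 ψ x 0).re = P0
      generalize (partialD 1 ψ x 0).im = Q0
      generalize (partialD 1 ψ x 1).re = P1
      generalize (partialD 1 ψ x 1).im = Q1
      nlinarith [sq_nonneg (P0 - a * p1 - p0 / 2), sq_nonneg (Q0 - a * q1 - q0 / 2),
        sq_nonneg (P1 + a * p0 - p1 / 2), sq_nonneg (Q1 + a * q0 - q1 / 2)]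
    have h3 := mul_le_mul_of_nonneg_left (h2.le.trans h1) (Real.exp_pos (-x 1)).le
    linarith

/-! ### The magnetic operator is relatively form bounded -/

/-- The energy density of `Q`. -/
noncomputable def energyDensity (Q : Pt → Pt) (x : Pt) : ℝ :=
  ∑ i, metricInv x i * (connScalar Q i x ^ 2 + partialD i Q x 1 ^ 2)

theorem energyDensity_nonneg (Q : Pt → Pt) (x : Pt) : 0 ≤ energyDensity Q x :=
  Finset.sum_nonneg fun i _ => mul_nonneg (metricInv_nonneg x i) (by positivity)

theorem normIterCovDeriv_zero (Q : Pt → Pt) (x : Pt) :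
    normIterCovDeriv Q 0 x = √(energyDensity Q x) := by
  have h : ∀ i, connScalar Q i x ^ 2 = Real.exp (-2 * Q x 1) * partialD i Q x 0 ^ 2 := fun i => by
    rw [connScalar, mul_pow, ← Real.exp_nat_mul]
    push_cast
    ring_nf
  rw [normIterCovDeriv, energyDensity]
  congr 1
  rw [← (Equiv.funUnique (Fin 1) (Fin 2)).symm.sum_comp]
  refine Finset.sum_congr rfl fun i _ => ?_
  simp [Fin.sum_univ_two, iterCovDeriv, metric, h]
  ring

theorem rad_nonneg (x : Pt) : 0 ≤ rad x := by
  refine Real.arcosh_nonneg ?_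
  have h1 := Real.one_le_cosh (x 1)
  have h2 := mul_nonneg (Real.exp_pos (-x 1)).le (sq_nonneg (x 0))
  simp [lorentz, hyperboloid]
  linarith

/-- Since `ϱ > 0` and `r ≥ 0`, the weight `e^{ϱ r}` is at least `1`, so the decay condition bounds
`|dQ|` itself. -/
theorem IsAdmissible.exists_energyDensity_le {R₀ ϱ : ℝ} {Q : Pt → Pt} (h : IsAdmissible R₀ ϱ Q) :
    ∃ M : ℝ, 0 ≤ M ∧ ∀ᵐ x ∂volH, energyDensity Q x ≤ M := by
  have h1 := h.decay
  rw [eLpNorm_exponent_top] at h1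
  refine ⟨(eLpNormEssSup (fun x => Real.exp (ϱ * rad x) * normIterCovDeriv Q 0 x) volH).toReal ^ 2,
    sq_nonneg _, ?_⟩
  filter_upwards [enorm_ae_le_eLpNormEssSup
    (fun x => Real.exp (ϱ * rad x) * normIterCovDeriv Q 0 x) volH] with x hx
  have h2 := ENNReal.toReal_mono h1.ne hx
  rw [toReal_enorm, norm_mul, Real.norm_of_nonneg (Real.exp_pos _).le, normIterCovDeriv_zero,
    Real.norm_of_nonneg (Real.sqrt_nonneg _)] at h2
  have h3 : 1 ≤ Real.exp (ϱ * rad x) :=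
    Real.one_le_exp (mul_nonneg h.rate_pos.le (rad_nonneg x))
  have h4 := Real.sqrt_nonneg (energyDensity Q x)
  calc energyDensity Q x = √(energyDensity Q x) ^ 2 := (Real.sq_sqrt (energyDensity_nonneg Q x)).symm
    _ ≤ _ := pow_le_pow_left₀ h4 ((le_mul_of_one_le_left h4 h3).trans h2) 2

/-- For a harmonic map the divergence of the connection is quadratic in the differential. -/
theorem divScalar_eq {Q : Pt → Pt} (hQ : ContDiff ℝ ∞ Q) {x : Pt} (h : tension Q x = 0) :
    divScalar Q x = ∑ i, metricInv x i * (connScalar Q i x * partialD i Q x 1) := by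
  have hc : ∀ i, partialD i (connScalar Q i) x
      = Real.exp (-Q x 1) * (partialD i (fun y => partialD i Q y 0) x
        - partialD i Q x 0 * partialD i Q x 1) := by
    intro i
    refine partialD_eq_of_hasDerivAt ((contDiff_connScalar hQ i).differentiable (by simp) x) ?_
    have h1 := hasDerivAt_pi.1 (hasDerivAt_partialD (hQ.differentiable (by simp) x) i) 1
    have h2 := hasDerivAt_partialD
      ((contDiff_pi.1 (contDiff_partialD hQ i) 0).differentiable (by simp) x) i
    refine (h1.neg.exp.mul h2).congr_deriv ?_
    simp
    ring
  have e : Real.exp (2 * x 1) * Real.exp (-(2 * x 1)) = 1 := by rw [← Real.exp_add]; simp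
  -- The first component of `τ(Q) = 0`, multiplied by `e^{-Q₂}`, expresses the second order terms of
  -- the divergence through first order ones.
  have h0 := congrFun h 0
  simp [tension, iterCovDeriv, covDeriv, Fin.sum_univ_two, metricInv, Fin.tail] at h0
  simp only [divScalar, hc, Fin.sum_univ_two, connScalar]
  simp [metricInv]
  linear_combination Real.exp (-Q x 1) * h0 + Real.exp (-Q x 1) * partialD 1 Q x 0 * e

theorem normSq_add_le (z w : ℂ) :
    Complex.normSq (z + w) ≤ 2 * (Complex.normSq z + Complex.normSq w) := by
  simp only [Complex.normSq_apply, Complex.add_re, Complex.add_im]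
  nlinarith [sq_nonneg (z.re - w.re), sq_nonneg (z.im - w.im)]

theorem normSq_ofReal_mul (r : ℝ) (z : ℂ) : Complex.normSq (r * z) = r ^ 2 * Complex.normSq z := by
  rw [map_mul, Complex.normSq_ofReal, sq]

/-- Weighted Cauchy–Schwarz; the defect is the nonnegative Lagrange term in `a 0 * u 1 - a 1 * u 0`.
-/
theorem normSq_sum_le {h a : Fin 2 → ℝ} (hh : ∀ i, 0 ≤ h i) (u : Fin 2 → ℂ) :
    Complex.normSq (∑ i, (h i : ℂ) * (a i * u i))
      ≤ (∑ i, h i * a i ^ 2) * ∑ i, h i * Complex.normSq (u i) := by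
  have h01 := mul_nonneg (hh 0) (hh 1)
  simp only [Fin.sum_univ_two, Complex.normSq_apply, Complex.add_re, Complex.add_im,
    Complex.re_ofReal_mul, Complex.im_ofReal_mul]
  nlinarith [mul_nonneg h01 (sq_nonneg (a 0 * (u 1).re - a 1 * (u 0).re)),
    mul_nonneg h01 (sq_nonneg (a 0 * (u 1).im - a 1 * (u 0).im))]

/-- Harmonicity removes the derivatives of the connection, leaving a first order term with
coefficient `|dQ|` and zeroth order terms quadratic in `dQ`. -/
theorem sqNorm_magneticW_le {Q : Pt → Pt} (hQ : ContDiff ℝ ∞ Q) {x : Pt} (h : tension Q x = 0)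
    (ψ : Pt → Fin 2 → ℂ) :
    sqNorm (magneticW Q ψ x) ≤ 16 * energyDensity Q x * ∑ i, metricInv x i * sqNorm (partialD i ψ x)
      + 16 * energyDensity Q x ^ 2 * sqNorm (ψ x) := by
  set S := energyDensity Q x with hS
  set E := ∑ i, metricInv x i * connScalar Q i x ^ 2 with hE
  set d := divScalar Q x with hd
  have hdiv := divScalar_eq hQ h
  rw [← hd] at hdiv
  have hm := metricInv_nonneg x
  have hE0 : 0 ≤ E := Finset.sum_nonneg fun i _ => mul_nonneg (hm i) (sq_nonneg _)
  have hES : E ≤ S := Finset.sum_le_sum fun i _ =>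
    mul_le_mul_of_nonneg_left (le_add_of_nonneg_right (sq_nonneg _)) (hm i)
  have hdS : |d| ≤ S := by
    rw [hdiv]
    refine (Finset.abs_sum_le_sum_abs _ _).trans (Finset.sum_le_sum fun i _ => ?_)
    rw [abs_mul, abs_of_nonneg (hm i)]
    refine mul_le_mul_of_nonneg_left ?_ (hm i)
    rw [abs_le]
    constructor <;> nlinarith [sq_nonneg (connScalar Q i x + partialD i Q x 1),
      sq_nonneg (connScalar Q i x - partialD i Q x 1), sq_nonneg (connScalar Q i x),
      sq_nonneg (partialD i Q x 1)]
  have hd2 : d ^ 2 ≤ S ^ 2 := sq_le_sq' (neg_le_of_abs_le hdS) (le_of_abs_le hdS)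
  have hE2 : E ^ 2 ≤ S ^ 2 := pow_le_pow_left₀ hE0 hES 2
  set X : Fin 2 → ℂ := fun k => ∑ i, (metricInv x i : ℂ) * (connScalar Q i x * partialD i ψ x k)
    with hX
  have hXle : ∀ k, Complex.normSq (X k)
      ≤ S * ∑ i, metricInv x i * Complex.normSq (partialD i ψ x k) := fun k =>
    (normSq_sum_le hm fun i => partialD i ψ x k).trans (mul_le_mul_of_nonneg_right hES
      (Finset.sum_nonneg fun i _ => mul_nonneg (hm i) (Complex.normSq_nonneg _)))
  -- With the divergence equal to `Σ h^{ii} a_i b_i`, where `b_i = ∂_i Q₂`, it cancels the cross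
  -- term of the wedge in the first component; in the second component the two add up to `-2 d`.
  have e0 : magneticW Q ψ x 0 = (2 : ℝ) * X 1 + S * ψ x 0 := by
    rw [magneticW_zero hQ, ← hd, hdiv, hX, hS, energyDensity]
    simp only [Fin.sum_univ_two]
    push_cast
    ring
  have e1 : magneticW Q ψ x 1 = ((-2 : ℝ) * X 0 + (2 * E : ℝ) * ψ x 1) + (-2 * d : ℝ) * ψ x 0 := by
    rw [magneticW_one hQ, ← hd, hdiv, hX, hE]
    simp only [Fin.sum_univ_two]
    push_cast
    ring
  have b0 := normSq_add_le ((2 : ℝ) * X 1) (S * ψ x 0)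
  have b1 := normSq_add_le ((-2 : ℝ) * X 0 + (2 * E : ℝ) * ψ x 1) ((-2 * d : ℝ) * ψ x 0)
  have b2 := normSq_add_le ((-2 : ℝ) * X 0) ((2 * E : ℝ) * ψ x 1)
  rw [← e0] at b0
  rw [← e1] at b1
  simp only [normSq_ofReal_mul] at b0 b1 b2
  have n0 := Complex.normSq_nonneg (ψ x 0)
  have n1 := Complex.normSq_nonneg (ψ x 1)
  have c0 := mul_le_mul_of_nonneg_right hd2 n0
  have c1 := mul_le_mul_of_nonneg_right hE2 n1
  have x0 := hXle 0
  have x1 := hXle 1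
  have hsum : S * ∑ i, metricInv x i * sqNorm (partialD i ψ x)
      = S * ∑ i, metricInv x i * Complex.normSq (partialD i ψ x 0)
        + S * ∑ i, metricInv x i * Complex.normSq (partialD i ψ x 1) := by
    simp only [sqNorm, Fin.sum_univ_two]
    ring
  have p0 := Complex.normSq_nonneg (X 0)
  have p1 := Complex.normSq_nonneg (X 1)
  have hSn0 := mul_nonneg (sq_nonneg S) n0
  have hSn1 := mul_nonneg (sq_nonneg S) n1
  rw [mul_assoc, hsum]
  simp only [sqNorm]
  nlinarith

theorem norm_testMagnetic_sq_le {R₀ ϱ : ℝ} {Q : Pt → Pt} (h : IsAdmissible R₀ ϱ Q) :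
    ∃ C : ℝ, 0 ≤ C ∧ ∀ ψ : testSpace, ‖toL2 (testMagnetic h.smooth ψ)‖ ^ 2
      ≤ C * ((⟪toL2 (testIncl ψ), toL2 (testNegLap ψ)⟫_ℂ).re + ‖toL2 (testIncl ψ)‖ ^ 2) := by
  obtain ⟨M, hM0, hM⟩ := h.exists_energyDensity_le
  refine ⟨16 * M + 16 * M ^ 2, by positivity, fun ψ => ?_⟩
  obtain ⟨ψ, hψ, hψs⟩ := ψ
  rw [re_inner_testNegLap, norm_toL2_sq, norm_toL2_sq]
  change ∫ x, sqNorm (magneticW Q ψ x) ∂volH ≤ (16 * M + 16 * M ^ 2)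
    * (∫ x, ∑ i, metricInv x i * sqNorm (partialD i ψ x) ∂volH + ∫ x, sqNorm (ψ x) ∂volH)
  have hg : Integrable (fun x => ∑ i, metricInv x i * sqNorm (partialD i ψ x)) volH :=
    integrable_finsetSum _ fun i _ => integrable_sqNorm (contDiff_metricInv i).continuous
      (contDiff_partialD hψ i).continuous (hasCompactSupport_partialD hψs i)
  have hn : Integrable (fun x => sqNorm (ψ x)) volH := by
    simpa using integrable_sqNorm (w := fun _ => 1) continuous_const hψ.continuous hψs
  have hw : Integrable (fun x => sqNorm (magneticW Q ψ x)) volH := by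
    simpa using integrable_sqNorm (w := fun _ => 1) continuous_const
      (contDiff_magneticW h.smooth hψ).continuous
      (HasCompactSupport.intro hψs fun _ hx => magneticW_eq_zero h.smooth hx)
  rw [← integral_add hg hn, ← integral_const_mul]
  refine integral_mono_ae hw ((hg.add hn).const_mul _) ?_
  filter_upwards [hM] with x hx
  have h1 := sqNorm_magneticW_le h.smooth (h.harmonic x) ψ
  have h2 := energyDensity_nonneg Q x
  have h3 : energyDensity Q x ^ 2 ≤ M ^ 2 := pow_le_pow_left₀ h2 hx 2
  have h4 : 0 ≤ ∑ i, metricInv x i * sqNorm (partialD i ψ x) :=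
    Finset.sum_nonneg fun i _ => mul_nonneg (metricInv_nonneg x i) (sqNorm_nonneg _)
  have h5 := sqNorm_nonneg (ψ x)
  have h6 := mul_le_mul_of_nonneg_right hx h4
  have h7 := mul_le_mul_of_nonneg_right h3 h5
  have h8 := mul_nonneg hM0 h5
  have h9 := mul_nonneg (sq_nonneg M) h4
  nlinarith

/-! ### Density of the ranges -/

/-- The real coordinate functionals of `ℂ²`. -/
noncomputable def reCoord (k : Fin 2) : EuclideanSpace ℂ (Fin 2) →L[ℝ] ℝ :=
  Complex.reCLM.comp ((EuclideanSpace.proj k : EuclideanSpace ℂ (Fin 2) →L[ℂ] ℂ).restrictScalars ℝ)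

/-- The imaginary coordinate functionals of `ℂ²`. -/
noncomputable def imCoord (k : Fin 2) : EuclideanSpace ℂ (Fin 2) →L[ℝ] ℝ :=
  Complex.imCLM.comp ((EuclideanSpace.proj k : EuclideanSpace ℂ (Fin 2) →L[ℂ] ℂ).restrictScalars ℝ)

theorem memLp_reCoord (v : L2H) (k : Fin 2) : MemLp (fun x => (v x k).re) 2 volH :=
  (reCoord k).comp_memLp' (Lp.memLp v)

theorem memLp_imCoord (v : L2H) (k : Fin 2) : MemLp (fun x => (v x k).im) 2 volH :=
  (imCoord k).comp_memLp' (Lp.memLp v)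

theorem eq_zero_of_coords {v : L2H} (hre : ∀ k, ∀ᵐ x ∂volH, (v x k).re = 0)
    (him : ∀ k, ∀ᵐ x ∂volH, (v x k).im = 0) : v = 0 := by
  refine Lp.ext ?_
  filter_upwards [Lp.coeFn_zero (EuclideanSpace ℂ (Fin 2)) 2 volH, hre 0, hre 1, him 0, him 1]
    with x h0 h1 h2 h3 h4
  rw [h0]
  ext k
  fin_cases k
  · exact Complex.ext h1 h3
  · exact Complex.ext h2 h4

/-- Real functions placed in one component suffice as tests: they separate the real and imaginary
parts of each component and reduce `ℂ²`-valued questions to real scalar ones. -/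
theorem inner_single_eq_zero {f : compSpace} {ρ : Pt → ℝ} (hρ : Continuous ρ)
    (hρs : HasCompactSupport ρ) {k : Fin 2} (hf : ∀ x, f.1 x = Pi.single k (ρ x : ℂ)) {v : L2H}
    (h : ⟪toL2 f, v⟫_ℂ = 0) :
    ∫ x, ρ x * (v x k).re ∂volH = 0 ∧ ∫ x, ρ x * (v x k).im ∂volH = 0 := by
  have hv : MemLp (fun x => v x k) 2 volH :=
    (EuclideanSpace.proj k : EuclideanSpace ℂ (Fin 2) →L[ℂ] ℂ).comp_memLp' (Lp.memLp v)
  have hi : Integrable (fun x => (ρ x : ℂ) * v x k) volH := by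
    have := (hv.locallyIntegrable (by norm_num)).integrable_smul_left_of_hasCompactSupport hρ hρs
    simpa only [Complex.real_smul] using this
  have e : ∫ x, (ρ x : ℂ) * v x k ∂volH = 0 := by
    rw [← h, inner_toL2]
    refine integral_congr_ae (Eventually.of_forall fun x => ?_)
    simp only [inner_eq_pair, hf, pair]
    fin_cases k <;> simp
  have h1 := Complex.reCLM.integral_comp_comm hi
  have h2 := Complex.imCLM.integral_comp_comm hi
  rw [e, map_zero] at h1 h2
  simp only [Complex.reCLM_apply, Complex.imCLM_apply, Complex.re_ofReal_mul,
    Complex.im_ofReal_mul] at h1 h2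
  exact ⟨h1, h2⟩

theorem partialD_clm_comp {F G : Type*} [NormedAddCommGroup F] [NormedSpace ℝ F]
    [NormedAddCommGroup G] [NormedSpace ℝ G] (A : F →L[ℝ] G) {f : Pt → F} (hf : ContDiff ℝ ∞ f)
    (i : Fin 2) : partialD i (fun x => A (f x)) = fun x => A (partialD i f x) := by
  funext x
  have h := A.hasFDerivAt.comp x (hf.differentiable (by simp) x).hasFDerivAt
  have e : fderiv ℝ (fun x => A (f x)) x = A.comp (fderiv ℝ f x) := h.fderiv
  simp only [partialD, e]
  rfl

theorem lap_clm_comp {F G : Type*} [NormedAddCommGroup F] [NormedSpace ℝ F]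
    [NormedAddCommGroup G] [NormedSpace ℝ G] (A : F →L[ℝ] G) {f : Pt → F} (hf : ContDiff ℝ ∞ f)
    (x : Pt) : lap (fun x => A (f x)) x = A (lap f x) := by
  simp only [lap_eq, partialD_clm_comp A hf, partialD_clm_comp A (contDiff_partialD hf _), map_add,
    map_sub, map_smul]

/-- The embedding of `ℝ` as the real axis of the `k`-th coordinate of `ℂ²`. -/
noncomputable def realSingle (k : Fin 2) : ℝ →L[ℝ] Fin 2 → ℂ :=
  (ContinuousLinearMap.single ℝ (fun _ : Fin 2 => ℂ) k).comp Complex.ofRealCLM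

/-- Real test functions, placed in the `k`-th component. -/
noncomputable def testSingle (k : Fin 2) {φ : Pt → ℝ} (hφ : ContDiff ℝ ∞ φ)
    (hφs : HasCompactSupport φ) : testSpace :=
  ⟨fun x => realSingle k (φ x), (realSingle k).contDiff.comp hφ,
    hφs.comp_left (g := realSingle k) (map_zero _)⟩

theorem denseRange_test : DenseRange fun ψ => toL2 (testIncl ψ) := by
  refine denseRange_of_inner_eq_zero (toL2 ∘ₗ testIncl) fun v hv => ?_
  have h : ∀ k, ∀ φ : Pt → ℝ, ContDiff ℝ ∞ φ → HasCompactSupport φ →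
      ∫ x, φ x * (v x k).re ∂volH = 0 ∧ ∫ x, φ x * (v x k).im ∂volH = 0 := fun k φ hφ hφs =>
    inner_single_eq_zero hφ.continuous hφs (fun x => rfl) (hv (testSingle k hφ hφs))
  exact eq_zero_of_coords
    (fun k => ae_eq_zero_of_integral_contDiff_smul_eq_zero
      ((memLp_reCoord v k).locallyIntegrable (by norm_num)) fun φ hφ hφs => (h k φ hφ hφs).1)
    (fun k => ae_eq_zero_of_integral_contDiff_smul_eq_zero
      ((memLp_imCoord v k).locallyIntegrable (by norm_num)) fun φ hφ hφs => (h k φ hφ hφs).2)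

/-- `-Δ` is essentially self-adjoint on test functions. -/
theorem denseRange_testNegLap_add {l : ℝ} (hl : 0 < l) :
    DenseRange fun ψ => toL2 (testNegLap ψ) + (l : ℂ) • toL2 (testIncl ψ) := by
  refine denseRange_of_inner_eq_zero (toL2 ∘ₗ (testNegLap + (l : ℂ) • testIncl)) fun v hv => ?_
  have h : ∀ k, ∀ φ : Pt → ℝ, ContDiff ℝ ∞ φ → HasCompactSupport φ →
      ∫ x, (-lap φ x + l * φ x) * (v x k).re ∂volH = 0 ∧
      ∫ x, (-lap φ x + l * φ x) * (v x k).im ∂volH = 0 := by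
    intro k φ hφ hφs
    refine inner_single_eq_zero ((contDiff_lap hφ).continuous.neg.add
      (continuous_const.mul hφ.continuous)) ((hasCompactSupport_lap hφs).neg.add hφs.mul_left)
      (fun x => ?_) (hv (testSingle k hφ hφs))
    change -lap (fun x => realSingle k (φ x)) x + (l : ℂ) • realSingle k (φ x)
      = realSingle k (-lap φ x + l * φ x)
    rw [lap_clm_comp _ hφ, map_add, map_neg, ← smul_eq_mul, map_smul]
    congr 1
  exact eq_zero_of_coords
    (fun k => ae_eq_zero_of_weak_resolvent hl (memLp_reCoord v k) fun φ hφ hφs => (h k φ hφ hφs).1)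
    (fun k => ae_eq_zero_of_weak_resolvent hl (memLp_imCoord v k) fun φ hφ hφs => (h k φ hφ hφs).2)

/-! ### The self-adjoint operator -/

theorem coreGraph_eq {Q : Pt → Pt} (hQ : ContDiff ℝ ∞ Q) : coreGraph Q
    = range fun ψ => (toL2 (testIncl ψ), toL2 (testNegLap ψ) + toL2 (testMagnetic hQ ψ)) := by
  ext ⟨p, q⟩
  constructor
  · rintro ⟨ψ, hψ, hp, hq⟩
    refine ⟨⟨ψ, hψ⟩, Prod.ext ?_ ?_⟩
    · exact ((eq_toL2_iff (testIncl ⟨ψ, hψ⟩) p).1 hp).symm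
    · exact (map_add toL2 _ _).symm.trans
        ((eq_toL2_iff (testNegLap ⟨ψ, hψ⟩ + testMagnetic hQ ⟨ψ, hψ⟩) q).1 hq).symm
  · rintro ⟨ψ, h⟩
    obtain ⟨rfl, rfl⟩ := Prod.mk.inj h
    refine ⟨ψ.1, ψ.2, coeFn_toL2 (testIncl ψ), ?_⟩
    simp only [← map_add]
    exact coeFn_toL2 (testNegLap ψ + testMagnetic hQ ψ)

/-- The distributional domain of `Δ` is the domain of the adjoint of `-Δ` on test functions; the
witness `g` only changes sign. -/
theorem lapDomain_eq : lapDomain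
    = {f | ∃ g, ∀ ψ, ⟪toL2 (testNegLap ψ), f⟫_ℂ = ⟪toL2 (testIncl ψ), g⟫_ℂ} := by
  have hT : ∀ (ψ : testSpace) (f : L2H), ⟪toL2 (testNegLap ψ), f⟫_ℂ
      = -∫ x, ⟪(WithLp.toLp 2 (lap ψ.1 x) : EuclideanSpace ℂ (Fin 2)), f x⟫_ℂ ∂volH := by
    intro ψ f
    rw [inner_toL2, ← integral_neg]
    refine integral_congr_ae (Eventually.of_forall fun x => ?_)
    simp only [← inner_neg_left]
    rfl
  ext f
  constructor
  · rintro ⟨g, hg⟩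
    refine ⟨-g, fun ψ => ?_⟩
    rw [hT, inner_neg_right, inner_toL2, hg ψ.1 ψ.2]
    rfl
  · rintro ⟨g, hg⟩
    refine ⟨-g, fun ψ hψ => ?_⟩
    have h := hg ⟨ψ, hψ⟩
    rw [hT, neg_eq_iff_eq_neg, ← inner_neg_right, inner_toL2] at h
    exact h

theorem IsAdmissible.exists_isSelfAdjoint {R₀ ϱ : ℝ} {Q : Pt → Pt} (h : IsAdmissible R₀ ϱ Q) :
    ∃ H : L2H →ₗ.[ℂ] L2H, (H.graph : Set (L2H × L2H)) = closure (coreGraph Q) ∧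
      IsSelfAdjoint H ∧ (H.domain : Set L2H) = lapDomain ∧
      ∀ f : H.domain, 1 / 4 * ‖(f : L2H)‖ ^ 2 ≤ (⟪(f : L2H), H f⟫_ℂ).re := by
  obtain ⟨C, hC, hP⟩ := norm_testMagnetic_sq_le h
  rw [coreGraph_eq h.smooth, lapDomain_eq]
  exact exists_isSelfAdjoint_closure (toL2 ∘ₗ testIncl) (toL2 ∘ₗ testNegLap)
    (toL2 ∘ₗ testMagnetic h.smooth) denseRange_test testNegLap_symmetric
    (test_symmetric h.smooth) testNegLap_nonneg (by norm_num) (quarter_le_form h.smooth) hC hP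
    fun l hl => denseRange_testNegLap_add hl

end MagneticHyp

theorem lemma4p4 :
    ∃ μ₀ : ℝ, 0 < μ₀ ∧ ∃ δ : ℝ, 0 < δ ∧
      ∀ (R₀ ϱ : ℝ) (Q : Pt → Pt), IsAdmissible R₀ ϱ Q →
        -- the wave equation for the heat tension field in the caloric gauge with limit `Θ(Q)`
        (∀ (T : ℝ) (u : ℝ → Pt → Pt) (U : SpaceTime → Pt) (Ω : Fin 2 → SpaceTime → Pt),
          IsCaloricGauge T u Q (limitFrame Q) U Ω →
            (∀ z ∈ slab T,
              fderiv ℝ (fun w => fderiv ℝ (phiS U Ω) w dirT) z dirT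
                - lap (fun y => phiS U Ω (z.1, z.2.1, y)) z.2.2
                + magneticW Q (fun y => phiS U Ω (z.1, z.2.1, y)) z.2.2
              = masterRHS Q U Ω z) ∧
            -- the remainders `A^con`, `φ^con` are the heat-time integrals of the fields
            (∀ s > 0, ∀ t ∈ Set.Ioo 0 T, HeatTimeDominated U Ω s t →
              ∀ (x : Pt) (i k : Fin 2),
                (∀ j : Fin 2, connCon Q U Ω i (s, t, x) k j
                  = -∫ κ in Set.Ioi s, wedge (phiS U Ω (κ, t, x))
                      (diffField U Ω (dirX i) (κ, t, x)) (Pi.single j 1) k) ∧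
                phiCon Q U Ω i (s, t, x) k
                  = -∫ κ in Set.Ioi s, fderiv ℝ (diffField U Ω (dirX i)) (κ, t, x) dirS k)) ∧
        -- `-Δ + W` is self-adjoint with the domain of `Δ` and core `C_c^∞`; strict positivity
        ∃ H : L2H →ₗ.[ℂ] L2H,
          (H.graph : Set (L2H × L2H)) = closure (coreGraph Q) ∧
          IsSelfAdjoint H ∧
          (H.domain : Set L2H) = lapDomain ∧
          (∀ μ₁ : ℝ, 0 < μ₁ → μ₁ ≤ μ₀ → IsSmall μ₁ ϱ Q →
            ∀ f : H.domain, δ * ‖(f : L2H)‖ ^ 2 ≤ (⟪(f : L2H), H f⟫_ℂ).re) := by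
  -- `δ = 1/4` is the bottom of the spectrum of `-Δ` on `ℍ²`; the value `1` for `μ₀` is a default.
  refine ⟨1, one_pos, 1 / 4, by norm_num, fun R₀ ϱ Q hQ => ⟨fun T u U Ω h => ⟨fun z hz =>
    h.wave_equation hQ.smooth hz, fun s hs t ht hdom x i k =>
    h.heat_time_integrals hQ.smooth hs ht hdom x i k⟩, ?_⟩⟩
  obtain ⟨H, hgraph, hself, hdomain, hpos⟩ := hQ.exists_isSelfAdjoint
  exact ⟨H, hgraph, hself, hdomain, fun _ _ _ _ => hpos⟩
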